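/- Let $d\ge 2$. For a field $\varphi$ on the torus $\mathbb T_N=(\mathbb Z/L^N\mathbb Z)^d$ with values in $\mathbb R^m$ put $(\nabla\varphi)^r_j(x)=\varphi^r(x+e_j)-\varphi^r(x)$, and let $\nabla^*$ denote the adjoint of $\nabla$. Let $\mathcal X_N$ be the space of fields $\varphi:\mathbb T_N\to\mathbb R^m$ with $\sum_x\varphi(x)=0$, with the scalar product $\langle\varphi,\psi\rangle=\sum_x\langle\varphi(x),\psi(x)\rangle_{\mathbb R^m}$. Let $U$ be the open cone of positive definite maps in the space of linear maps $\mathbb R^{m\times d}\to\mathbb R^{m\times d}$ that are symmetric for the standard scalar product. For $A\in U$ let $\mathscr C_A$ be the inverse of the operator $\nabla^*A\nabla$ on $\mathcal X_N$. Let $\rho_\infty(x,0)$ be the $\ell^\infty$ distance from $x$ to $0$ on the torus, $\nabla^\alpha=\prod_{i=1}^d\nabla_i^{\alpha_i}$ with $\nabla_i f(x)=f(x+e_i)-f(x)$, and let $\|\cdot\|$ on linear maps be the operator norm for the Euclidean norms. **Theorem 2.2.** There are constants $\eta(\alpha,d)\in\mathbb R$, depending only on $d$ and the multiindex $\alpha$,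 and $C_\alpha(d,c_0,\Lambda)\in\mathbb R$, depending only on $d$, $\alpha$, $c_0$ and $\Lambda$, with the following property. For all integers $m\ge0$ and $N\ge1$ and every odd integer $L\ge16$ there are kernels $\mathcal C_{A,k}:\mathbb T_N\to\mathbb R^{m\times m}$ ($A\in U$, $k=1,\dots,N+1$) with $\sum_x\mathcal C_{A,k}(x)=0$ such that each map $A\mapsto\mathcal C_{A,k}$ is real-analytic on $U$, the operators $(\mathscr C_{A,k}\varphi)(x)=\sum_{y\in\mathbb T_N}\mathcal C_{A,k}(x-y)\varphi(y)$ on $\mathcal X_N$ are symmetric and positive definite, and: 1. $\mathscr C_A=\sum_{k=1}^{N+1}\mathscr C_{A,k}$ for all $A\in U$. 2. For all $A\in U$ and $k=1,\dots,N+1$ there is a constant $m\times m$ matrix $C_{A,k}$ such that $\mathcal C_{A,k}(x)=C_{A,k}$ whenever $\rho_\infty(x,0)\ge\frac12L^k$. 3. If $c_0>0$, $A_0$ is symmetric with $(A_0F,F)\ge c_0\|F\|^2$ for all $F\in\mathbb R^{m\times d}$, and $\|A_0\|\le\Lambda$, then for every multiindex $\alpha$, all $k=1,\dots,N+1$, all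 $x\in\mathbb T_N$ and all $j\ge0$ $$\sup_{\|\dot A\|\le1}\big\|\nabla^\alpha D_A^j\mathcal C_{A_0,k}(x)(\dot A,\dots,\dot A)\big\|\le C_\alpha(d,c_0,\Lambda)\Big(\frac2{c_0}\Big)^j j!\,L^{-(k-1)(d-2+|\alpha|)}L^{\eta(\alpha,d)},$$ where the supremum is over symmetric $\dot A:\mathbb R^{m\times d}\to\mathbb R^{m\times d}$. -/

import Mathlib

noncomputable section

namespace FRD

/-- The discrete torus `(ℤ / nℤ)^d`; the theorem uses side length `n = L ^ N`. -/
abbrev Torus (d n : ℕ) : Type := Fin d → ZMod n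

/-- The target space `ℝ^m` of the fields, with its Euclidean norm. -/
abbrev Vec (m : ℕ) : Type := EuclideanSpace ℝ (Fin m)

/-- The space `ℝ^{m × d}` with its standard scalar product; the entry `(r, j)` is
the `j`-th derivative of the `r`-th component. -/
abbrev Grad (m d : ℕ) : Type := EuclideanSpace ℝ (Fin m × Fin d)

/-- The `m × m` matrices, as operators on `ℝ^m` with the operator norm. -/
abbrev Mat (m : ℕ) : Type := Vec m →L[ℝ] Vec m

/-- The symmetric linear maps `ℝ^{m × d} → ℝ^{m × d}`, with the operator norm. -/
abbrev LSym (m d : ℕ) : Submodule ℝ (Grad m d →L[ℝ] Grad m d) :=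
  selfAdjoint.submodule ℝ (Grad m d →L[ℝ] Grad m d)

/-- The cone of positive definite symmetric maps. -/
def posDefCone (m d : ℕ) : Set (LSym m d) :=
  {A | ∀ F : Grad m d, F ≠ 0 → 0 < inner ℝ (A.1 F) F}

/-- The unit vector `e_i`. -/
def unitVec {d n : ℕ} (i : Fin d) : Torus d n := Pi.single i 1

/-- Forward difference in direction `i`. -/
def nabla {d n : ℕ} {V : Type*} [AddCommGroup V] (i : Fin d) (f : Torus d n → V) :
    Torus d n → V :=
  fun x => f (x + unitVec i) - f x

/-- `∇^α = ∏ᵢ ∇ᵢ^{αᵢ}` for a multiindex `α`. -/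
def nablaPow {d n : ℕ} {V : Type*} [AddCommGroup V] (α : Fin d → ℕ) (f : Torus d n → V) :
    Torus d n → V :=
  (List.finRange d).foldr (fun i g => (nabla i)^[α i] g) f

/-- The discrete gradient `(∇φ)_j^r (x) = φ^r(x + e_j) - φ^r(x)`. -/
def grad {m d n : ℕ} (φ : Torus d n → Vec m) : Torus d n → Grad m d :=
  fun x => WithLp.toLp 2 fun rj : Fin m × Fin d => nabla rj.2 φ x rj.1

/-- The adjoint of the gradient, `(∇^* G)^r (x) = ∑_j (G_j^r(x - e_j) - G_j^r(x))`. -/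
def gradStar {m d n : ℕ} (G : Torus d n → Grad m d) : Torus d n → Vec m :=
  fun x => WithLp.toLp 2 fun r : Fin m =>
    ∑ j : Fin d, (G (x - unitVec j) (r, j) - G x (r, j))

/-- The distance `ρ_∞(x, 0)` on the torus: in each coordinate, `ZMod.valMinAbs` is the
representative of least absolute value. -/
def rhoInf {d n : ℕ} (x : Torus d n) : ℕ :=
  Finset.univ.sup fun i : Fin d => (x i).valMinAbs.natAbs

section Operators

variable {m d n : ℕ} [NeZero n]

/-- The fields on the torus with zero sum. -/
def zeroSum (m d n : ℕ) [NeZero n] : Submodule ℝ (Torus d n → Vec m) where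
  carrier := {φ | ∑ x, φ x = 0}
  add_mem' := by
    intro a b ha hb
    simp only [Set.mem_ofPred_eq] at ha hb ⊢
    simp [Finset.sum_add_distrib, ha, hb]
  zero_mem' := by simp
  smul_mem' := by
    intro c a ha
    simp only [Set.mem_ofPred_eq] at ha ⊢
    simp [← Finset.smul_sum, ha]

/-- The `ℓ²` scalar product of two fields. -/
def fieldInner (φ ψ : Torus d n → Vec m) : ℝ := ∑ x, inner ℝ (φ x) (ψ x)

theorem sum_gradStar (G : Torus d n → Grad m d) : ∑ x, gradStar G x = 0 := by
  ext r
  simp only [gradStar, WithLp.ofLp_sum, Finset.sum_apply, PiLp.zero_apply]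
  rw [Finset.sum_comm]
  refine Finset.sum_eq_zero fun j _ => ?_
  rw [Finset.sum_sub_distrib, sub_eq_zero]
  exact (Equiv.subRight (unitVec j : Torus d n)).sum_comp fun x => G x (r, j)

/-- The elliptic operator `φ ↦ ∇^*(A ∇φ)` on the fields with zero sum. -/
def ellipticOp (m d n : ℕ) [NeZero n] (A : Grad m d →L[ℝ] Grad m d) :
    Module.End ℝ (zeroSum m d n) where
  toFun φ := ⟨gradStar fun x => A (grad φ.1 x), sum_gradStar _⟩
  map_add' φ ψ := by
    have h : ∀ x, grad (φ.1 + ψ.1) x = grad φ.1 x + grad ψ.1 x := by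
      intro x; ext rj; simp [grad, nabla]; ring
    ext x r
    simp only [gradStar, Submodule.coe_add, h, map_add, PiLp.add_apply, Pi.add_apply,
      ← Finset.sum_add_distrib]
    exact Finset.sum_congr rfl fun j _ => by ring
  map_smul' c φ := by
    have h : ∀ x, grad (c • φ.1) x = c • grad φ.1 x := by
      intro x; ext rj; simp [grad, nabla]; ring
    ext x r
    simp only [gradStar, Submodule.coe_smul, h, map_smul, PiLp.smul_apply, Pi.smul_apply,
      RingHom.id_apply, smul_eq_mul, Finset.mul_sum]
    exact Finset.sum_congr rfl fun j _ => by ring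

/-- The Green operator, the inverse of `∇^* A ∇` on the fields with zero sum. That this
operator is invertible for positive definite `A` is `isUnit_ellipticOp` below. -/
def greenOp (m d n : ℕ) [NeZero n] (A : Grad m d →L[ℝ] Grad m d) :
    Module.End ℝ (zeroSum m d n) :=
  Ring.inverse (ellipticOp m d n A)

/-- The translation invariant operator `(Kφ)(x) = ∑_y K(x - y) φ(y)`. -/
def kernelOp (K : Torus d n → Mat m) : Module.End ℝ (zeroSum m d n) where
  toFun φ := ⟨fun x => ∑ y, K (x - y) (φ.1 y), by
    have hφ : ∑ y, φ.1 y = 0 := φ.2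
    change ∑ x, ∑ y, K (x - y) (φ.1 y) = 0
    rw [Finset.sum_comm]
    have h : ∀ y : Torus d n, ∑ x, K (x - y) (φ.1 y) = (∑ z, K z) (φ.1 y) := by
      intro y
      rw [sum_apply]
      exact (Equiv.subRight y).sum_comp fun z => K z (φ.1 y)
    simp only [h, ← map_sum, hφ, map_zero]⟩
  map_add' φ ψ := by
    ext x : 2
    simp [Finset.sum_add_distrib]
  map_smul' c φ := by
    ext x : 2
    simp [Finset.smul_sum]

/-- Symmetric and strictly positive with respect to the `ℓ²` scalar product. -/
def IsPosDefOp (T : Module.End ℝ (zeroSum m d n)) : Prop :=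
  (∀ φ ψ : zeroSum m d n, fieldInner (T φ).1 ψ.1 = fieldInner φ.1 (T ψ).1) ∧
    ∀ φ : zeroSum m d n, φ ≠ 0 → 0 < fieldInner (T φ).1 φ.1

theorem fieldInner_gradStar (G : Torus d n → Grad m d) (φ : Torus d n → Vec m) :
    fieldInner (gradStar G) φ = ∑ x, inner ℝ (G x) (grad φ x) := by
  have e : ∀ (j : Fin d) (r : Fin m),
      ∑ x, φ x r * G (x - unitVec j) (r, j) = ∑ x, φ (x + unitVec j) r * G x (r, j) := by
    intro j r
    have h := Equiv.sum_comp (Equiv.addRight (unitVec j : Torus d n))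
      fun x => φ x r * G (x - unitVec j) (r, j)
    rw [← h]
    simp
  simp only [fieldInner, gradStar, grad, nabla, PiLp.inner_apply, RCLike.inner_apply,
    conj_trivial, Fintype.sum_prod_type, PiLp.sub_apply, Finset.mul_sum, mul_sub, sub_mul]
  rw [Finset.sum_comm, Finset.sum_comm (s := Finset.univ (α := Torus d n))]
  refine Finset.sum_congr rfl fun r _ => ?_
  rw [Finset.sum_comm, Finset.sum_comm (s := Finset.univ (α := Torus d n))]
  refine Finset.sum_congr rfl fun j _ => ?_
  rw [Finset.sum_sub_distrib, Finset.sum_sub_distrib, e]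

theorem eq_of_grad_eq_zero (φ : Torus d n → Vec m) (h : ∀ x, grad φ x = 0)
    (x : Torus d n) : φ x = φ 0 := by
  have h1 : ∀ (i : Fin d) (y : Torus d n), φ (y + unitVec i) = φ y := by
    intro i y
    ext r
    have := congrArg (fun F : Grad m d => F (r, i)) (h y)
    simpa [grad, nabla, sub_eq_zero] using this
  have h2 : ∀ (i : Fin d) (k : ℕ) (y : Torus d n), φ (y + k • unitVec i) = φ y := by
    intro i k
    induction k with
    | zero => simp
    | succ k ih => intro y; rw [succ_nsmul, ← add_assoc, h1, ih]
  have h3 : ∀ (s : Finset (Fin d)), φ (∑ i ∈ s, (x i).val • unitVec i) = φ 0 := by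
    intro s
    induction s using Finset.induction_on with
    | empty => simp
    | insert a s ha ih => rw [Finset.sum_insert ha, add_comm, h2, ih]
  have h4 : ∑ i, (x i).val • (unitVec i : Torus d n) = x := by
    ext i
    have h5 : ∀ j : Fin d, ((x j).val • (unitVec j : Torus d n)) i =
        if i = j then (((x j).val : ℕ) : ZMod n) else 0 := by
      intro j
      simp only [unitVec, Pi.smul_apply, Pi.single_apply, smul_ite, smul_zero, nsmul_eq_mul,
        mul_one]
    simp only [Finset.sum_apply, h5, Finset.sum_ite_eq, Finset.mem_univ, if_true]
    exact ZMod.natCast_zmod_val (x i)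
  rw [← h3 Finset.univ, h4]

theorem isUnit_ellipticOp (A : LSym m d) (hA : A ∈ posDefCone m d) :
    IsUnit (ellipticOp m d n A.1) := by
  rw [LinearMap.isUnit_iff_ker_eq_bot, LinearMap.ker_eq_bot']
  intro φ hφ
  have h0 : fieldInner (gradStar fun x => A.1 (grad φ.1 x)) φ.1 = 0 := by
    have : (gradStar fun x => A.1 (grad φ.1 x)) = 0 := congrArg Subtype.val hφ
    rw [this]; simp [fieldInner]
  rw [fieldInner_gradStar] at h0
  have hnn : ∀ F : Grad m d, 0 ≤ inner ℝ (A.1 F) F := by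
    intro F
    by_cases hF : F = 0
    · simp [hF]
    · exact (hA F hF).le
  have hg : ∀ x, grad φ.1 x = 0 := by
    intro x
    by_contra hx
    have := (Finset.sum_eq_zero_iff_of_nonneg fun y _ => hnn (grad φ.1 y)).1 h0 x
      (Finset.mem_univ x)
    exact (hA _ hx).ne' this
  have hc := eq_of_grad_eq_zero φ.1 hg
  have hs : ∑ x, φ.1 x = 0 := φ.2
  rw [Finset.sum_congr rfl fun x _ => hc x, Finset.sum_const,
    ← Nat.cast_smul_eq_nsmul ℝ, smul_eq_zero] at hs
  have h00 : φ.1 0 = 0 := hs.resolve_left (Nat.cast_ne_zero.2 Fintype.card_ne_zero)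
  ext x : 2
  rw [hc x, h00]; rfl

end Operators

end FRD

end

/-!
# Finite range decomposition of the Green operator of an elliptic system

The decomposition is built from averages of local Dirichlet problems, and everything is read off on
the Fourier side, where a translation invariant operator is a family of operators `f(p)` on `ℂ^m`,
one for each frequency `p`. The operator `∇^* B ∇` has the symbol `Â(p) = q(p)^* B q(p)` (`ahat`),
where `q_j(p) = e^{2πi p_j/n} - 1`. All estimates are made for complex coefficients `B` with a
coercive real part (`Coercive`).

For a box of side `l` let `Ĝ_l(p)` (`green`) be the symbol of the Dirichlet Green function of the
box, averaged over all translates of the box. It has three properties.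

* Its kernel vanishes at distances greater than `l` (`trigRange_green`).
* The operator `R_l = 1 - Ĝ_l Â` (`harm`), an average of harmonic extensions, is small at high
  frequencies: `|R_l(p)| ≤ C (l |q(p)|)^{-1/2}` (`norm_sub_green_ahat_mul_sqrt_le`). The reason is
  that the solution of `∇^* B ∇ u = ∇^* B ∇ e_p v` in the box with zero boundary values differs from
  the wave `e_p v` only in a boundary layer of width of order `1 / |q|`, up to an error of small
  energy. Low frequencies are controlled by `|R_l - 1| ≤ (Λ/c) (l |q|)²`.
* For symmetric `B`, by Jensen's inequality, `Ĝ Â Ĝ ≤ θ Ĝ` with `θ < 1` (`re_inner_ahat_green_le`).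

With `l = L^j`, `j < N`, and `R' = 1 - Â Ĝ`, the inverse `Â⁻¹` is the telescoping sum (`sum_covSymb`)
of the symbols `R_0 ⋯ R_{j-1} (2 Ĝ_j - Ĝ_j Â Ĝ_j) R'_{j-1} ⋯ R'_0` and of a remainder with `Â⁻¹` in
the middle (`covSymb`). The symbols are positive definite by the third property
(`re_inner_covSymb_pos`), and all but the last one have finite range, because ranges add up under
multiplication (`trigRange_covSymb`). Along the scales `L^i` the factors `R_i` decay geometrically
once `L^i |q| > 1`, so that the product of the last `2M` of them already gives the bound
`L^{2j} (L^j |q|)^{-2M}`, at the expense of a power of `L` depending on `M` only (`prod_mul_pow_le`,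
`norm_covSymb_mul_pow_le`). The sum over the frequencies of this bound with `2M = 2 (|α| + d)` is
the kernel bound (`sum_norm_covSymb_le`).

The symbols are holomorphic functions of `B`, with bounds that only depend on the coercivity and the
norm of `B`. Hence the derivatives in `A` follow from Cauchy's estimate on the disc `|z| ≤ c₀ / 2`
for `A₀ + z A'`, which remains coercive there with constant `c₀ / 2`
(`norm_nablaPow_iteratedFDeriv_covKer_le`).
-/

noncomputable section

namespace FRD

/-! ### Characters of the torus -/

section Characters

variable {d n : ℕ} [NeZero n]

/-- The character `x ↦ e^{2πi p·x/n}` of the torus with frequency `p`. -/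
def chr (p x : Torus d n) : ℂ := ZMod.stdAddChar (∑ i, p i * x i)

theorem chr_add (p x y : Torus d n) : chr p (x + y) = chr p x * chr p y := by
  simp [chr, mul_add, Finset.sum_add_distrib, AddChar.map_add_eq_mul]

@[simp] theorem chr_zero (p : Torus d n) : chr p 0 = 1 := by simp [chr]

@[simp] theorem norm_chr (p x : Torus d n) : ‖chr p x‖ = 1 := by
  rw [chr, ZMod.stdAddChar_apply]; exact Circle.norm_coe _

theorem chr_neg (p x : Torus d n) : chr p (-x) = (starRingEnd ℂ) (chr p x) := by
  have h : chr p (-x) * chr p x = 1 := by rw [← chr_add]; simp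
  have h2 : (starRingEnd ℂ) (chr p x) * chr p x = 1 := by
    rw [Complex.conj_mul']; simp
  have h0 : chr p x ≠ 0 := by
    intro h; have := norm_chr p x; rw [h] at this; simp at this
  exact mul_right_cancel₀ h0 (h.trans h2.symm)

theorem chr_sub (p x y : Torus d n) :
    chr p (x - y) = chr p x * (starRingEnd ℂ) (chr p y) := by
  rw [sub_eq_add_neg, chr_add, chr_neg]

theorem chr_zero_left (x : Torus d n) : chr (0 : Torus d n) x = 1 := by simp [chr]

/-- Orthogonality of the characters. -/
theorem sum_chr (x : Torus d n) :
    ∑ p, chr p x = if x = 0 then ((n : ℂ) ^ d) else 0 := by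
  have h1 : ∀ p : Torus d n, chr p x = ∏ i, ZMod.stdAddChar (p i * x i) := by
    intro p
    simp only [chr]
    exact map_sum (ZMod.stdAddChar (N := n)).toAddMonoidHom _ _
  have h2 : ∀ b : ZMod n, ∑ s : ZMod n, (ZMod.stdAddChar (s * b) : ℂ) =
      if b = 0 then (n : ℂ) else 0 := by
    intro b
    rw [AddChar.sum_mulShift b (ZMod.isPrimitive_stdAddChar n)]
    simp [ZMod.card]
  simp only [h1]
  have h3 := Finset.prod_univ_sum (fun _ : Fin d => (Finset.univ : Finset (ZMod n)))
    (fun i s => (ZMod.stdAddChar (s * x i) : ℂ))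
  rw [Fintype.piFinset_univ] at h3
  rw [← h3]
  simp only [h2]
  split_ifs with hx
  · simp [hx]
  · obtain ⟨i, hi⟩ : ∃ i, x i ≠ 0 := by
      by_contra h; push Not at h; exact hx (funext h)
    exact Finset.prod_eq_zero (Finset.mem_univ i) (by simp [hi])

/-- The Fourier symbol `q_j(p) = e^{2πi p_j/n} - 1` of the forward difference `∇_j`. -/
def symb (p : Torus d n) (j : Fin d) : ℂ := chr p (unitVec j) - 1

theorem chr_unitVec (p : Torus d n) (j : Fin d) :
    chr p (unitVec j) = ZMod.stdAddChar (p j) := by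
  simp [chr, unitVec, Pi.single_apply]

theorem chr_add_unitVec (p x : Torus d n) (j : Fin d) :
    chr p (x + unitVec j) - chr p x = symb p j * chr p x := by
  rw [chr_add, symb]; ring

theorem norm_symb_le (p : Torus d n) (j : Fin d) : ‖symb p j‖ ≤ 2 := by
  refine (norm_sub_le _ _).trans ?_
  simp; norm_num

/-- The chord of the unit circle is at least `2/π` times the arc (Jordan's inequality). -/
theorem le_norm_stdAddChar_sub_one (s : ZMod n) :
    4 * (s.valMinAbs.natAbs : ℝ) / n ≤ ‖(ZMod.stdAddChar s : ℂ) - 1‖ := by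
  have hn : (0 : ℝ) < n := by exact_mod_cast Nat.pos_of_ne_zero (NeZero.ne n)
  set k : ℤ := s.valMinAbs with hk
  have hs : s = (k : ZMod n) := by simp [hk]
  have h1 : (ZMod.stdAddChar s : ℂ) =
      Complex.exp (Complex.I * ((2 * Real.pi * k / n : ℝ) : ℂ)) := by
    rw [hs, ZMod.stdAddChar_coe]
    congr 1; push_cast; ring
  rw [h1, Complex.norm_exp_I_mul_ofReal_sub_one]
  have h2 : |(k : ℝ)| ≤ n / 2 := by
    have := ZMod.natAbs_valMinAbs_le s
    have h3 : ((k.natAbs : ℕ) : ℝ) ≤ ((n / 2 : ℕ) : ℝ) := by exact_mod_cast this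
    rw [Nat.cast_natAbs, Int.cast_abs] at h3
    exact h3.trans Nat.cast_div_le
  have h4 : |2 * Real.pi * k / n / 2| ≤ Real.pi / 2 := by
    have : 2 * Real.pi * k / n / 2 = Real.pi * (k / n) := by field_simp
    rw [this, abs_mul, abs_of_pos Real.pi_pos, abs_div, abs_of_pos hn]
    have : |(k : ℝ)| / n ≤ 1 / 2 := by rw [div_le_iff₀ hn]; linarith
    nlinarith [Real.pi_pos]
  have h5 := Real.mul_abs_le_abs_sin h4
  rw [norm_mul, Real.norm_eq_abs, Real.norm_eq_abs, abs_two, Nat.cast_natAbs, Int.cast_abs]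
  refine le_trans (le_of_eq ?_) (mul_le_mul_of_nonneg_left h5 (by norm_num))
  have : 2 * Real.pi * k / n / 2 = Real.pi * (k / n) := by field_simp
  rw [this, abs_mul, abs_of_pos Real.pi_pos, abs_div, abs_of_pos hn]
  field_simp
  ring

/-- The Euclidean length `|q(p)|` of the symbol of the gradient. -/
def symbNorm (p : Torus d n) : ℝ := √(∑ j, ‖symb p j‖ ^ 2)

theorem symbNorm_sq (p : Torus d n) : symbNorm p ^ 2 = ∑ j, ‖symb p j‖ ^ 2 :=
  Real.sq_sqrt (by positivity)

theorem symbNorm_nonneg (p : Torus d n) : 0 ≤ symbNorm p := Real.sqrt_nonneg _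

theorem norm_symb_le_symbNorm (p : Torus d n) (j : Fin d) : ‖symb p j‖ ≤ symbNorm p := by
  refine Real.le_sqrt_of_sq_le ?_
  exact Finset.single_le_sum (f := fun j => ‖symb p j‖ ^ 2) (fun _ _ => by positivity)
    (Finset.mem_univ j)

theorem le_norm_symb (p : Torus d n) (j : Fin d) :
    4 * ((p j).valMinAbs.natAbs : ℝ) / n ≤ ‖symb p j‖ := by
  rw [symb, chr_unitVec]; exact le_norm_stdAddChar_sub_one _

theorem le_symbNorm {p : Torus d n} (hp : p ≠ 0) : 1 / (n : ℝ) ≤ symbNorm p := by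
  obtain ⟨i, hi⟩ : ∃ i, p i ≠ 0 := by
    by_contra h; push Not at h; exact hp (funext h)
  refine le_trans ?_ ((le_norm_symb p i).trans (norm_symb_le_symbNorm p i))
  have : 1 ≤ (p i).valMinAbs.natAbs := by
    rw [Nat.one_le_iff_ne_zero, Int.natAbs_ne_zero]
    simpa [ZMod.valMinAbs_eq_zero] using hi
  have : (1 : ℝ) ≤ (p i).valMinAbs.natAbs := by exact_mod_cast this
  gcongr
  linarith

theorem symbNorm_pos {p : Torus d n} (hp : p ≠ 0) : 0 < symbNorm p :=
  lt_of_lt_of_le (by have := Nat.pos_of_ne_zero (NeZero.ne n); positivity) (le_symbNorm hp)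

theorem symbNorm_le (hd : 1 ≤ d) (p : Torus d n) : symbNorm p ≤ 2 * d := by
  refine Real.sqrt_le_iff.2 ⟨by positivity, ?_⟩
  calc ∑ j, ‖symb p j‖ ^ 2 ≤ ∑ _j : Fin d, (2 : ℝ) ^ 2 := by
        gcongr with j; exact norm_symb_le p j
    _ = 4 * d := by simp; ring
    _ ≤ (2 * d : ℝ) ^ 2 := by
        have : (1 : ℝ) ≤ d := by exact_mod_cast hd
        nlinarith

end Characters

/-! ### The sum over frequencies -/

theorem sum_range_inv_one_add_sq_le {c : ℝ} (hc : 0 < c) (M : ℕ) :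
    ∑ j ∈ Finset.range M, (1 + (c * (j + 1)) ^ 2)⁻¹ ≤ 2 / c := by
  have key : ∀ M : ℕ, ∑ j ∈ Finset.range M, (1 + (c * (j + 1)) ^ 2)⁻¹ ≤
      2 / c * (1 - (1 + c * M)⁻¹) := by
    intro M
    induction M with
    | zero => simp
    | succ M ih =>
      rw [Finset.sum_range_succ]
      have h : (1 + (c * (M + 1)) ^ 2)⁻¹ ≤
          2 / c * ((1 + c * M)⁻¹ - (1 + c * (M + 1))⁻¹) := by
        have e : 2 / c * ((1 + c * M)⁻¹ - (1 + c * (M + 1))⁻¹) =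
            2 / ((1 + c * M) * (1 + c * (M + 1))) := by
          have h1 : 1 + c * M ≠ 0 := by positivity
          have h2 : 1 + c * (M + 1) ≠ 0 := by positivity
          field_simp; ring
        rw [e, inv_eq_one_div, div_le_div_iff₀ (by positivity) (by positivity)]
        have : (0 : ℝ) ≤ M := by positivity
        nlinarith [sq_nonneg (1 - c * (M + 1)), mul_pos hc hc]
      push_cast
      calc _ ≤ _ := add_le_add ih h
        _ = _ := by ring
  refine (key M).trans ?_
  have : (0 : ℝ) ≤ (1 + c * M)⁻¹ := by positivity
  have h2 : 0 < 2 / c := by positivity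
  nlinarith

theorem sum_zmod_inv_one_add_sq_le {n : ℕ} [NeZero n] {c : ℝ} (hc : 0 < c) :
    ∑ s : ZMod n, (1 + (c * (s.valMinAbs.natAbs : ℝ)) ^ 2)⁻¹ ≤ 1 + 4 / c := by
  set F : ℤ → ℝ := fun k => (1 + (c * (k.natAbs : ℝ)) ^ 2)⁻¹ with hF
  have hF0 : ∀ k, 0 ≤ F k := fun k => by simp only [hF]; positivity
  have h1 : ∑ s : ZMod n, F s.valMinAbs =
      ∑ k ∈ Finset.univ.image (fun s : ZMod n => s.valMinAbs), F k := by
    rw [Finset.sum_image]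
    intro a _ b _ h
    exact ZMod.injective_valMinAbs h
  have h2 : (Finset.univ.image (fun s : ZMod n => s.valMinAbs)) ⊆
      insert 0 ((Finset.range n).image (fun j : ℕ => ((j : ℤ) + 1)) ∪
        (Finset.range n).image (fun j : ℕ => (-((j : ℤ) + 1)))) := by
    intro k hk
    simp only [Finset.mem_image, Finset.mem_univ, true_and] at hk
    obtain ⟨s, rfl⟩ := hk
    have hb := ZMod.natAbs_valMinAbs_le s
    have hn := Nat.pos_of_ne_zero (NeZero.ne n)
    simp only [Finset.mem_insert, Finset.mem_union, Finset.mem_image, Finset.mem_range]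
    rcases lt_trichotomy s.valMinAbs 0 with h | h | h
    · right; right
      exact ⟨s.valMinAbs.natAbs - 1, by omega, by omega⟩
    · left; exact h
    · right; left
      exact ⟨s.valMinAbs.natAbs - 1, by omega, by omega⟩
  have h3 := sum_range_inv_one_add_sq_le hc n
  have e1 : ∀ j : ℕ, F ((j : ℤ) + 1) = (1 + (c * (j + 1)) ^ 2)⁻¹ := by
    intro j
    have : ((j : ℤ) + 1).natAbs = j + 1 := by omega
    simp only [hF, this]; push_cast; rfl
  have e2 : ∀ j : ℕ, F (-((j : ℤ) + 1)) = (1 + (c * (j + 1)) ^ 2)⁻¹ := by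
    intro j
    have : (-((j : ℤ) + 1)).natAbs = j + 1 := by omega
    simp only [hF, this]; push_cast; rfl
  change ∑ s : ZMod n, F s.valMinAbs ≤ _
  rw [h1]
  refine (Finset.sum_le_sum_of_subset_of_nonneg h2 fun k _ _ => hF0 k).trans ?_
  rw [Finset.sum_insert (by simp; constructor <;> intros <;> omega)]
  have h4 := Finset.sum_union_inter (s₁ := (Finset.range n).image (fun j : ℕ => ((j : ℤ) + 1)))
    (s₂ := (Finset.range n).image (fun j : ℕ => (-((j : ℤ) + 1)))) (f := F)
  have h5 := Finset.sum_nonneg (s := (Finset.range n).image (fun j : ℕ => ((j : ℤ) + 1)) ∩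
    (Finset.range n).image (fun j : ℕ => (-((j : ℤ) + 1)))) fun k _ => hF0 k
  rw [Finset.sum_image (by intro a _ b _ h; simpa using h),
    Finset.sum_image (by intro a _ b _ h; simpa using h)] at h4
  simp only [e1, e2] at h4
  have h6 : F 0 = 1 := by simp [hF]
  have h7 : 4 / c = 2 / c + 2 / c := by ring
  rw [h6, h7]
  linarith

/-- A Riemann sum bound: the weight `(1 + λ²|q|²)^{-d}` has normalized sum of order `λ^{-d}`,
as long as `λ` does not exceed the side length. -/
theorem sum_inv_one_add_symbNorm_le {d n : ℕ} [NeZero n] {lam : ℝ} (h0 : 0 < lam)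
    (hn : lam ≤ n) :
    ((n : ℝ) ^ d)⁻¹ * ∑ p : Torus d n, ((1 + (lam * symbNorm p) ^ 2) ^ d)⁻¹ ≤
      2 ^ d * (lam ^ d)⁻¹ := by
  have hn0 : (0 : ℝ) < n := by exact_mod_cast Nat.pos_of_ne_zero (NeZero.ne n)
  set g : ZMod n → ℝ := fun s => (1 + (4 * lam / n * (s.valMinAbs.natAbs : ℝ)) ^ 2)⁻¹ with hg
  have h1 : ∀ p : Torus d n, ((1 + (lam * symbNorm p) ^ 2) ^ d)⁻¹ ≤ ∏ i, g (p i) := by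
    intro p
    have e : (1 + (lam * symbNorm p) ^ 2) ^ d = ∏ _i : Fin d, (1 + (lam * symbNorm p) ^ 2) := by
      simp
    rw [e, ← Finset.prod_inv_distrib]
    refine Finset.prod_le_prod (fun i _ => by positivity) fun i _ => ?_
    simp only [hg]
    have := (le_norm_symb p i).trans (norm_symb_le_symbNorm p i)
    have e2 : 4 * lam / n * ((p i).valMinAbs.natAbs : ℝ) =
        lam * (4 * ((p i).valMinAbs.natAbs : ℝ) / n) := by ring
    rw [e2]
    gcongr
  have h2 : ∑ p : Torus d n, ∏ i, g (p i) = (∑ s, g s) ^ d := by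
    have h3 := Finset.prod_univ_sum (fun _ : Fin d => (Finset.univ : Finset (ZMod n)))
      (fun _ s => g s)
    rw [Fintype.piFinset_univ] at h3
    rw [← h3]; simp only [Finset.prod_const, Finset.card_univ, Fintype.card_fin]
  have h3 : ∑ s, g s ≤ 2 * n / lam := by
    refine (sum_zmod_inv_one_add_sq_le (c := 4 * lam / n) (by positivity)).trans ?_
    have : 4 / (4 * lam / n) = n / lam := by field_simp
    rw [this]
    have : 1 ≤ n / lam := by rw [le_div_iff₀ h0]; linarith
    have e : 2 * n / lam = n / lam + n / lam := by ring
    linarith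
  calc _ ≤ ((n : ℝ) ^ d)⁻¹ * (2 * n / lam) ^ d := by
        gcongr
        refine (Finset.sum_le_sum fun p _ => h1 p).trans ?_
        rw [h2]
        have : ∀ s, 0 ≤ g s := fun s => by simp only [hg]; positivity
        gcongr
    _ = _ := by
        rw [div_pow, mul_pow]
        have := pow_ne_zero d hn0.ne'
        field_simp

/-! ### Products over scales -/

/-- A finite product of factors `r_i` attached to the geometric sequence `z_i = L^i x` is bounded
uniformly in the number of factors, if `r_i ≤ 1 + C z_i²` for small and `r_i ≤ 1` for large
`z_i`. -/
theorem prod_le_exp_of_geometric {C Z x L : ℝ} (hC : 0 ≤ C) (hL : 2 ≤ L) (hx : 0 ≤ x)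
    {r : ℕ → ℝ} (hr0 : ∀ i, 0 ≤ r i) (h1 : ∀ i, r i ≤ 1 + C * (L ^ i * x) ^ 2)
    (h2 : ∀ i, Z < L ^ i * x → r i ≤ 1) (K : ℕ) :
    ∏ i ∈ Finset.range K, r i ≤ Real.exp (C * (2 * Z ^ 2)) := by
  set s : ℕ → ℝ := fun i => if L ^ i * x ≤ Z then (L ^ i * x) ^ 2 else 0 with hs
  have hrs : ∀ i, r i ≤ Real.exp (C * s i) := by
    intro i
    by_cases h : L ^ i * x ≤ Z
    · simp only [hs, h, if_true]
      have := Real.add_one_le_exp (C * (L ^ i * x) ^ 2)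
      linarith [h1 i]
    · simp only [hs, h, if_false, mul_zero, Real.exp_zero]
      exact h2 i (not_le.1 h)
  have hA : ∀ K, ∑ i ∈ Finset.range K, s i ≤ (L ^ K * x) ^ 2 := by
    intro K
    induction K with
    | zero => simp; positivity
    | succ K ih =>
      rw [Finset.sum_range_succ]
      have : s K ≤ (L ^ K * x) ^ 2 := by
        simp only [hs]; split_ifs
        · exact le_rfl
        · positivity
      have e : (L ^ (K + 1) * x) ^ 2 = L ^ 2 * (L ^ K * x) ^ 2 := by ring
      rw [e]
      have h4 : 4 ≤ L ^ 2 := by nlinarith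
      nlinarith [sq_nonneg (L ^ K * x)]
  have hB : ∀ K, ∑ i ∈ Finset.range K, s i ≤ 2 * Z ^ 2 := by
    intro K
    induction K with
    | zero => simp; positivity
    | succ K ih =>
      rw [Finset.sum_range_succ]
      by_cases h : L ^ K * x ≤ Z
      · have h3 : (L ^ K * x) ^ 2 ≤ Z ^ 2 := by gcongr
        have : s K = (L ^ K * x) ^ 2 := by simp [hs, h]
        linarith [hA K]
      · have : s K = 0 := by simp [hs, h]
        linarith
  calc ∏ i ∈ Finset.range K, r i ≤ ∏ i ∈ Finset.range K, Real.exp (C * s i) :=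
        Finset.prod_le_prod (fun i _ => hr0 i) fun i _ => hrs i
    _ = Real.exp (C * ∑ i ∈ Finset.range K, s i) := by
        rw [← Real.exp_sum, Finset.mul_sum]
    _ ≤ _ := by
        gcongr; exact hB K

/-- The decay of a product of factors `r_i ≤ min(1 + C z_i², C z_i^{-1/2})` along `z_i = L^i x`:
it is smaller than every power of `1 + L^K x`, at the expense of a fixed power of `L`. Only the
last `2n` factors are used for the decay. -/
theorem prod_mul_pow_le {C X x L : ℝ} (hC : 1 ≤ C) (hX : 0 ≤ X) (hL : 2 ≤ L) (hx : 0 < x)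
    (hxX : x ≤ X) {r : ℕ → ℝ} (K : ℕ) (hr0 : ∀ i, 0 ≤ r i)
    (h1 : ∀ i, r i ≤ 1 + C * (L ^ i * x) ^ 2)
    (h2 : ∀ i, r i * √(L ^ i * x) ≤ C) (n : ℕ) :
    (∏ i ∈ Finset.range K, r i) * (1 + L ^ K * x) ^ n ≤
      Real.exp (C * (2 * (C ^ 2) ^ 2)) * (2 * (1 + X) * C ^ 2) ^ n * L ^ (2 * n * n) := by
  have hL0 : 0 < L := by linarith
  have hL1 : 1 ≤ L := by linarith
  set P := Real.exp (C * (2 * (C ^ 2) ^ 2)) with hP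
  have hP0 : 0 < P := Real.exp_pos _
  have hlarge : ∀ i, C ^ 2 < L ^ i * x → r i ≤ 1 := by
    intro i hi
    have h3 : C ≤ √(L ^ i * x) := Real.le_sqrt_of_sq_le hi.le
    have h4 := h2 i
    by_contra h
    push Not at h
    nlinarith [hr0 i]
  have hprod : ∀ K, ∏ i ∈ Finset.range K, r i ≤ P := fun K =>
    prod_le_exp_of_geometric (by linarith) hL hx.le hr0 h1 hlarge K
  have hprod0 : ∀ K, 0 ≤ ∏ i ∈ Finset.range K, r i := fun K =>
    Finset.prod_nonneg fun i _ => hr0 i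
  have hC2 : 1 ≤ C ^ 2 := one_le_pow₀ hC
  rcases lt_or_ge K (2 * n) with hK | hK
  · -- few scales: `1 + L^K x` itself is at most a fixed power of `L`
    have h3 : 1 + L ^ K * x ≤ (2 * (1 + X) * C ^ 2) * L ^ (2 * n) := by
      have h4 : L ^ K ≤ L ^ (2 * n) := pow_le_pow_right₀ hL1 hK.le
      have h5 : 1 ≤ L ^ (2 * n) := one_le_pow₀ hL1
      have h6 : L ^ K * x ≤ L ^ (2 * n) * X := by gcongr
      have h7 : (1 + X) * L ^ (2 * n) ≤ (2 * (1 + X) * C ^ 2) * L ^ (2 * n) := by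
        gcongr
        nlinarith
      nlinarith
    calc _ ≤ P * ((2 * (1 + X) * C ^ 2) * L ^ (2 * n)) ^ n := by
          gcongr
          exact hprod K
      _ = _ := by rw [mul_pow, ← pow_mul]; ring
  · obtain ⟨K', rfl⟩ : ∃ K', K = K' + 2 * n := ⟨K - 2 * n, by omega⟩
    set y := L ^ (K' + 2 * n) * x with hy
    have hy0 : 0 < y := by positivity
    rcases le_or_gt y 1 with hy1 | hy1
    · have h3 : 1 + y ≤ 2 * (1 + X) * C ^ 2 := by nlinarith
      calc _ ≤ P * (2 * (1 + X) * C ^ 2) ^ n := by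
            gcongr
            exact hprod _
        _ ≤ _ := le_mul_of_one_le_right (by positivity) (one_le_pow₀ hL1)
    · -- each of the last `2n` factors is at most `C L^n y^{-1/2}`
      have htop : (∏ i ∈ Finset.range (2 * n), r (K' + i)) * y ^ n ≤
          (C ^ 2) ^ n * L ^ (2 * n * n) := by
        have h3 : ∀ i ∈ Finset.range (2 * n), r (K' + i) * √y ≤ C * L ^ n := by
          intro i hi
          have h4 : y ≤ (L ^ n) ^ 2 * (L ^ (K' + i) * x) := by
            have : L ^ (K' + 2 * n) ≤ L ^ (n * 2 + (K' + i)) :=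
              pow_le_pow_right₀ hL1 (by omega)
            rw [← mul_assoc, ← pow_mul, ← pow_add]
            exact mul_le_mul_of_nonneg_right this hx.le
          have h5 : √y ≤ L ^ n * √(L ^ (K' + i) * x) := by
            rw [← Real.sqrt_sq (by positivity : 0 ≤ L ^ n), ← Real.sqrt_mul (by positivity)]
            exact Real.sqrt_le_sqrt h4
          calc r (K' + i) * √y ≤ r (K' + i) * (L ^ n * √(L ^ (K' + i) * x)) := by
                gcongr; exact hr0 _
            _ = (r (K' + i) * √(L ^ (K' + i) * x)) * L ^ n := by ring
            _ ≤ C * L ^ n := by gcongr; exact h2 _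
        have h6 : y ^ n = ∏ _i ∈ Finset.range (2 * n), √y := by
          rw [Finset.prod_const, Finset.card_range, pow_mul, Real.sq_sqrt hy0.le]
        rw [h6, ← Finset.prod_mul_distrib]
        calc _ ≤ ∏ _i ∈ Finset.range (2 * n), (C * L ^ n) :=
              Finset.prod_le_prod (fun i _ => mul_nonneg (hr0 _) (Real.sqrt_nonneg _)) h3
          _ = _ := by
              rw [Finset.prod_const, Finset.card_range, mul_pow, pow_mul C, ← pow_mul L]
              congr 2; ring
      rw [Finset.prod_range_add]
      have h7 : (1 + y) ^ n ≤ (2 * y) ^ n := by gcongr; linarith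
      calc _ ≤ P * (∏ i ∈ Finset.range (2 * n), r (K' + i)) * (2 * y) ^ n := by
            have h8 := hprod K'
            have h9 : 0 ≤ ∏ i ∈ Finset.range (2 * n), r (K' + i) :=
              Finset.prod_nonneg fun i _ => hr0 _
            exact mul_le_mul (mul_le_mul_of_nonneg_right h8 h9) h7 (by positivity)
              (by positivity)
        _ = P * 2 ^ n * ((∏ i ∈ Finset.range (2 * n), r (K' + i)) * y ^ n) := by
            rw [mul_pow]; ring
        _ ≤ P * 2 ^ n * ((C ^ 2) ^ n * L ^ (2 * n * n)) := by
            exact mul_le_mul_of_nonneg_left htop (by positivity)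
        _ = P * (2 * 1 * C ^ 2) ^ n * L ^ (2 * n * n) := by simp only [mul_pow]; ring
        _ ≤ P * (2 * (1 + X) * C ^ 2) ^ n * L ^ (2 * n * n) := by gcongr; linarith

/-! ### Coercive operators -/

section Coercive

variable {H : Type*} [NormedAddCommGroup H] [InnerProductSpace ℂ H]

/-- The real part of the form of `T` is bounded below by `c ‖v‖²`. -/
def Coercive (c : ℝ) (T : H →L[ℂ] H) : Prop :=
  ∀ v, c * ‖v‖ ^ 2 ≤ (inner ℂ (T v) v).re

theorem re_inner_le (x y : H) : (inner ℂ x y).re ≤ ‖x‖ * ‖y‖ :=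
  (Complex.re_le_norm _).trans (norm_inner_le_norm x y)

theorem Coercive.le_norm {c : ℝ} {T : H →L[ℂ] H} (h : Coercive c T) (v : H) :
    c * ‖v‖ ≤ ‖T v‖ := by
  rcases eq_or_ne v 0 with rfl | hv
  · simp
  · have h1 := (h v).trans (re_inner_le _ _)
    have h2 : 0 < ‖v‖ := norm_pos_iff.2 hv
    rw [pow_two, ← mul_assoc] at h1
    exact le_of_mul_le_mul_right h1 h2

theorem Coercive.isUnit [FiniteDimensional ℂ H] {c : ℝ} (hc : 0 < c) {T : H →L[ℂ] H}
    (h : Coercive c T) : IsUnit T := by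
  have hinj : Function.Injective T.toLinearMap := by
    rw [injective_iff_map_eq_zero]
    intro v hv
    have h1 := h.le_norm v
    have h2 : T v = 0 := hv
    rw [h2, norm_zero] at h1
    exact norm_le_zero_iff.1 (by nlinarith [norm_nonneg v])
  have hb : Function.Bijective T.toLinearMap :=
    ⟨hinj, LinearMap.injective_iff_surjective.1 hinj⟩
  let e := (LinearEquiv.ofBijective T.toLinearMap hb).toContinuousLinearEquiv
  have he : (e : H →L[ℂ] H) = T := by ext v; rfl
  rw [← he]
  exact ⟨ContinuousLinearEquiv.toUnit e, rfl⟩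

theorem Coercive.norm_inverse_apply_le [FiniteDimensional ℂ H] {c : ℝ} (hc : 0 < c)
    {T : H →L[ℂ] H} (h : Coercive c T) (w : H) : ‖Ring.inverse T w‖ ≤ c⁻¹ * ‖w‖ := by
  have h1 := h.le_norm (Ring.inverse T w)
  have h2 : T (Ring.inverse T w) = w := by
    have := Ring.mul_inverse_cancel T (h.isUnit hc)
    exact congrArg (fun S : H →L[ℂ] H => S w) this
  rw [h2] at h1
  rw [inv_mul_eq_div, le_div_iff₀ hc]; linarith

theorem Coercive.adjoint [CompleteSpace H] {c : ℝ} {T : H →L[ℂ] H} (h : Coercive c T) :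
    Coercive c (ContinuousLinearMap.adjoint T) := by
  intro v
  rw [ContinuousLinearMap.adjoint_inner_left, ← inner_conj_symm, Complex.conj_re]
  exact h v

end Coercive

/-! ### Complex fields on the torus -/

/-- Gradients of `H`-valued fields: `d` elements of `H`, with the `ℓ²` scalar product. -/
abbrev GradH (d : ℕ) (H : Type*) : Type _ := PiLp 2 fun _ : Fin d => H

/-- Fields on the torus with values in a Hilbert space, with the `ℓ²` scalar product. -/
abbrev Field2 (d n : ℕ) (H : Type*) : Type _ := PiLp 2 fun _ : Torus d n => H

section Fields

theorem field_norm_sq {d n : ℕ} [NeZero n] {H : Type*} [NormedAddCommGroup H]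
    (u : Field2 d n H) : ‖u‖ ^ 2 = ∑ x, ‖u x‖ ^ 2 :=
  PiLp.norm_sq_eq_of_L2 _ u

variable {d n : ℕ} [NeZero n] {H : Type*} [NormedAddCommGroup H] [InnerProductSpace ℂ H]
  [FiniteDimensional ℂ H]

/-- Multiplication of a field by a real function. -/
def mulOp (θ : Torus d n → ℝ) : Field2 d n H →L[ℂ] Field2 d n H :=
  LinearMap.toContinuousLinearMap
    { toFun := fun u => WithLp.toLp 2 fun x => (θ x : ℂ) • u x
      map_add' := fun u w => by ext x; simp
      map_smul' := fun c u => by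
        apply PiLp.ext; intro x
        simp only [PiLp.smul_apply, RingHom.id_apply]; rw [smul_comm] }

@[simp] theorem mulOp_apply (θ : Torus d n → ℝ) (u : Field2 d n H) (x : Torus d n) :
    mulOp θ u x = (θ x : ℂ) • u x := rfl

theorem inner_mulOp_left (θ : Torus d n → ℝ) (u w : Field2 d n H) :
    inner ℂ (mulOp θ u) w = inner ℂ u (mulOp θ w) := by
  simp only [PiLp.inner_apply, mulOp_apply, inner_smul_left, inner_smul_right, Complex.conj_ofReal]

theorem mulOp_mulOp (θ η : Torus d n → ℝ) (u : Field2 d n H) :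
    mulOp θ (mulOp η u) = mulOp (fun x => θ x * η x) u := by
  apply PiLp.ext; intro x; simp only [mulOp_apply, smul_smul, Complex.ofReal_mul]

/-- The plane wave `x ↦ e_p(x) v`. -/
def wave (p : Torus d n) : H →L[ℂ] Field2 d n H :=
  LinearMap.toContinuousLinearMap
    { toFun := fun v => WithLp.toLp 2 fun x => chr p x • v
      map_add' := fun u w => by ext x; simp
      map_smul' := fun c u => by
        apply PiLp.ext; intro x
        simp only [PiLp.smul_apply, RingHom.id_apply]; rw [smul_comm] }

@[simp] theorem wave_apply (p : Torus d n) (v : H) (x : Torus d n) :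
    wave p v x = chr p x • v := rfl

theorem adjoint_wave_apply (p : Torus d n) (u : Field2 d n H) :
    ContinuousLinearMap.adjoint (wave p) u = ∑ x, (starRingEnd ℂ) (chr p x) • u x := by
  refine ext_inner_left ℂ fun v => ?_
  rw [ContinuousLinearMap.adjoint_inner_right, inner_sum, PiLp.inner_apply]
  simp [inner_smul_left, inner_smul_right]

theorem norm_mulOp_wave_sq (θ : Torus d n → ℝ) (p : Torus d n) (v : H) :
    ‖mulOp θ (wave p v)‖ ^ 2 = (∑ x, θ x ^ 2) * ‖v‖ ^ 2 := by
  rw [field_norm_sq, Finset.sum_mul]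
  simp [norm_smul, mul_pow]

/-- The pointwise action of an operator on the values of a field. -/
def lift : (H →L[ℂ] H) →ₗ[ℂ] (Field2 d n H →L[ℂ] Field2 d n H) where
  toFun B := LinearMap.toContinuousLinearMap
    { toFun := fun u => WithLp.toLp 2 fun x => B (u x)
      map_add' := fun u w => by ext x; simp
      map_smul' := fun c u => by ext x; simp }
  map_add' B B' := by ext u x; rfl
  map_smul' c B := by ext u x; rfl

@[simp] theorem lift_apply (B : H →L[ℂ] H) (u : Field2 d n H) (x : Torus d n) :
    lift B u x = B (u x) := rfl

theorem adjoint_lift (B : H →L[ℂ] H) :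
    ContinuousLinearMap.adjoint (lift B : Field2 d n H →L[ℂ] Field2 d n H) =
      lift (ContinuousLinearMap.adjoint B) := by
  symm
  rw [ContinuousLinearMap.eq_adjoint_iff]
  intro u w
  simp [PiLp.inner_apply, ContinuousLinearMap.adjoint_inner_left]

theorem norm_lift_le (B : H →L[ℂ] H) (u : Field2 d n H) : ‖lift B u‖ ≤ ‖B‖ * ‖u‖ := by
  refine le_of_sq_le_sq ?_ (by positivity)
  rw [mul_pow, field_norm_sq, field_norm_sq, Finset.mul_sum]
  refine Finset.sum_le_sum fun x _ => ?_
  rw [← mul_pow]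
  gcongr
  exact B.le_opNorm _

theorem Coercive.lift {c : ℝ} {B : H →L[ℂ] H} (h : Coercive c B) :
    Coercive c (lift B : Field2 d n H →L[ℂ] Field2 d n H) := by
  intro u
  rw [field_norm_sq, Finset.mul_sum, PiLp.inner_apply, Complex.re_sum]
  exact Finset.sum_le_sum fun x _ => h (u x)

theorem lift_wave (B : H →L[ℂ] H) (p : Torus d n) (v : H) :
    FRD.lift B (wave p v) = wave p (B v) := by
  apply PiLp.ext; intro x; simp

theorem lift_mulOp (B : H →L[ℂ] H) (θ : Torus d n → ℝ) (u : Field2 d n H) :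
    FRD.lift B (mulOp θ u) = mulOp θ (FRD.lift B u) := by
  apply PiLp.ext; intro x; simp

end Fields

section Gradient

variable {d n : ℕ} [NeZero n] {H : Type*} [NormedAddCommGroup H] [InnerProductSpace ℂ H]
  [FiniteDimensional ℂ H]

/-- The tensor `v ⊗ q`, with components `q_j v`. -/
def tens (q : Fin d → ℂ) : H →L[ℂ] GradH d H :=
  LinearMap.toContinuousLinearMap
    { toFun := fun v => WithLp.toLp 2 fun j => q j • v
      map_add' := fun u w => by apply PiLp.ext; intro x; simp
      map_smul' := fun c u => by
        apply PiLp.ext; intro x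
        simp only [PiLp.smul_apply, RingHom.id_apply]; rw [smul_comm] }

@[simp] theorem tens_apply (q : Fin d → ℂ) (v : H) (j : Fin d) : tens q v j = q j • v := rfl

theorem norm_tens_symb (p : Torus d n) (v : H) :
    ‖tens (symb p) v‖ = symbNorm p * ‖v‖ := by
  have h : ‖tens (symb p) v‖ ^ 2 = (symbNorm p * ‖v‖) ^ 2 := by
    rw [PiLp.norm_sq_eq_of_L2, mul_pow, symbNorm_sq, Finset.sum_mul]
    simp only [tens_apply, norm_smul, mul_pow]
  exact (pow_left_inj₀ (norm_nonneg _) (by have := symbNorm_nonneg p; positivity)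
    two_ne_zero).1 h

/-- The gradient of complex fields. -/
def gradC : Field2 d n H →L[ℂ] Field2 d n (GradH d H) :=
  LinearMap.toContinuousLinearMap
    { toFun := fun u => WithLp.toLp 2 fun x => WithLp.toLp 2 fun j => u (x + unitVec j) - u x
      map_add' := fun u w => by
        apply PiLp.ext; intro x; apply PiLp.ext; intro j
        simp only [PiLp.add_apply]; abel
      map_smul' := fun c u => by
        apply PiLp.ext; intro x; apply PiLp.ext; intro j
        simp only [PiLp.smul_apply, RingHom.id_apply, smul_sub] }

@[simp] theorem gradC_apply (u : Field2 d n H) (x : Torus d n) (j : Fin d) :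
    gradC u x j = u (x + unitVec j) - u x := rfl

theorem norm_gradC_apply_sq (u : Field2 d n H) (x : Torus d n) :
    ‖gradC u x‖ ^ 2 = ∑ j, ‖u (x + unitVec j) - u x‖ ^ 2 := by
  rw [PiLp.norm_sq_eq_of_L2]; rfl

theorem gradC_wave (p : Torus d n) (v : H) :
    gradC (wave p v) = wave p (tens (symb p) v) := by
  apply PiLp.ext; intro x; apply PiLp.ext; intro j
  simp only [gradC_apply, wave_apply, PiLp.smul_apply, tens_apply, ← sub_smul,
    chr_add_unitVec, smul_smul]
  rw [mul_comm]

theorem adjoint_wave_gradC (p : Torus d n) (u : Field2 d n H) :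
    ContinuousLinearMap.adjoint (wave p) (gradC u) =
      tens (symb p) (ContinuousLinearMap.adjoint (wave p) u) := by
  rw [adjoint_wave_apply, adjoint_wave_apply]
  apply PiLp.ext; intro j
  have h := Equiv.sum_comp (Equiv.addRight (unitVec j : Torus d n))
    fun x => (starRingEnd ℂ) (chr p (x - unitVec j)) • u x
  simp only [Equiv.coe_addRight, add_sub_cancel_right] at h
  have h2 : ∀ x, (starRingEnd ℂ) (chr p (x - unitVec j)) =
      (starRingEnd ℂ) (chr p x) * chr p (unitVec j) := by
    intro x; rw [chr_sub]; simp
  simp only [WithLp.ofLp_sum, Finset.sum_apply, PiLp.smul_apply, gradC_apply,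
    tens_apply, smul_sub, Finset.sum_sub_distrib, h, h2, symb,
    Finset.smul_sum, smul_smul]
  rw [← Finset.sum_sub_distrib]
  exact Finset.sum_congr rfl fun x _ => by rw [← sub_smul]; ring_nf

/-- The symbol `q(p)^* B q(p)` of the elliptic operator `∇^* B ∇`. -/
def ahat (p : Torus d n) (B : GradH d H →L[ℂ] GradH d H) : H →L[ℂ] H :=
  ContinuousLinearMap.adjoint (tens (symb p)) ∘L B ∘L tens (symb p)

theorem inner_ahat (p : Torus d n) (B : GradH d H →L[ℂ] GradH d H) (v w : H) :
    inner ℂ (ahat p B v) w = inner ℂ (B (tens (symb p) v)) (tens (symb p) w) := by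
  rw [ahat, ContinuousLinearMap.comp_apply, ContinuousLinearMap.comp_apply,
    ContinuousLinearMap.adjoint_inner_left]

theorem adjoint_ahat (p : Torus d n) (B : GradH d H →L[ℂ] GradH d H) :
    ContinuousLinearMap.adjoint (ahat p B) = ahat p (ContinuousLinearMap.adjoint B) := by
  symm
  rw [ContinuousLinearMap.eq_adjoint_iff]
  intro v w
  rw [inner_ahat, ContinuousLinearMap.adjoint_inner_left, ← inner_conj_symm, ← inner_ahat,
    inner_conj_symm]

theorem Coercive.ahat {c : ℝ} {B : GradH d H →L[ℂ] GradH d H} (h : Coercive c B)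
    (p : Torus d n) : Coercive (c * symbNorm p ^ 2) (ahat p B) := by
  intro v
  rw [inner_ahat]
  refine le_trans (le_of_eq ?_) (h _)
  rw [norm_tens_symb]; ring

theorem norm_ahat_apply_le (p : Torus d n) (B : GradH d H →L[ℂ] GradH d H) (v : H) :
    ‖FRD.ahat p B v‖ ≤ ‖B‖ * symbNorm p ^ 2 * ‖v‖ := by
  have h : ‖FRD.ahat p B v‖ ^ 2 ≤ ‖B‖ * symbNorm p ^ 2 * ‖v‖ * ‖FRD.ahat p B v‖ := by
    rw [← inner_self_eq_norm_sq (𝕜 := ℂ), inner_ahat]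
    refine (re_inner_le _ _).trans ?_
    have h1 := B.le_opNorm (tens (symb p) v)
    rw [norm_tens_symb] at h1
    rw [norm_tens_symb]
    have := symbNorm_nonneg p
    calc _ ≤ ‖B‖ * (symbNorm p * ‖v‖) * (symbNorm p * ‖FRD.ahat p B v‖) := by gcongr
      _ = _ := by ring
  rcases (norm_nonneg (FRD.ahat p B v)).eq_or_lt with h0 | h0
  · rw [← h0]; positivity
  · rw [pow_two] at h
    exact le_of_mul_le_mul_right h h0

/-- The elliptic operator `∇^* B ∇` on complex fields. -/
def ellip (B : GradH d H →L[ℂ] GradH d H) : Field2 d n H →L[ℂ] Field2 d n H :=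
  ContinuousLinearMap.adjoint gradC ∘L lift B ∘L gradC

theorem inner_ellip (B : GradH d H →L[ℂ] GradH d H) (u w : Field2 d n H) :
    inner ℂ (ellip B u) w = inner ℂ (lift B (gradC u)) (gradC w) := by
  rw [ellip, ContinuousLinearMap.comp_apply, ContinuousLinearMap.comp_apply,
    ContinuousLinearMap.adjoint_inner_left]

theorem adjoint_ellip (B : GradH d H →L[ℂ] GradH d H) :
    ContinuousLinearMap.adjoint (ellip B : Field2 d n H →L[ℂ] Field2 d n H) =
      ellip (ContinuousLinearMap.adjoint B) := by
  symm
  rw [ContinuousLinearMap.eq_adjoint_iff]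
  intro v w
  rw [inner_ellip, ← adjoint_lift, ContinuousLinearMap.adjoint_inner_left, ← inner_conj_symm,
    ← inner_ellip, inner_conj_symm]

theorem ellip_wave (B : GradH d H →L[ℂ] GradH d H) (p : Torus d n) (v : H) :
    ellip B (wave p v) = wave p (FRD.ahat p B v) := by
  refine ext_inner_right ℂ fun w => ?_
  rw [inner_ellip, gradC_wave, lift_wave, ← ContinuousLinearMap.adjoint_inner_right,
    adjoint_wave_gradC, ← inner_ahat, ContinuousLinearMap.adjoint_inner_right]

end Gradient

/-! ### Boxes and the Poincaré inequality -/

section Boxes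

/-- The closed box `{0, …, l}^d`. -/
def closedBox (d n l : ℕ) [NeZero n] : Finset (Torus d n) :=
  Fintype.piFinset fun _ => Finset.univ.filter fun s : ZMod n => s.val ≤ l

/-- The inner box `{1, …, l}^d`; fields supported there have their gradient supported in the
closed box. -/
def innerBox (d n l : ℕ) [NeZero n] : Finset (Torus d n) :=
  Fintype.piFinset fun _ => Finset.univ.filter fun s : ZMod n => 1 ≤ s.val ∧ s.val ≤ l

/-- The indicator function of a finite set. -/
def ind {X : Type*} [DecidableEq X] (s : Finset X) (x : X) : ℝ := if x ∈ s then 1 else 0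

theorem add_unitVec_apply {d n : ℕ} (x : Torus d n) (i j : Fin d) :
    (x + unitVec j : Torus d n) i = if i = j then x i + 1 else x i := by
  simp only [unitVec, Pi.add_apply, Pi.single_apply]
  split_ifs <;> simp

variable {d n l : ℕ} [NeZero n]

theorem mem_closedBox {x : Torus d n} : x ∈ closedBox d n l ↔ ∀ i, (x i).val ≤ l := by
  simp [closedBox]

theorem mem_innerBox {x : Torus d n} :
    x ∈ innerBox d n l ↔ ∀ i, 1 ≤ (x i).val ∧ (x i).val ≤ l := by
  simp [innerBox]

theorem innerBox_subset : innerBox d n l ⊆ closedBox d n l := fun _ hx =>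
  mem_closedBox.2 fun i => (mem_innerBox.1 hx i).2

theorem sum_filter_val_le (h : l < n) (f : ℕ → ℝ) :
    ∑ s ∈ Finset.univ.filter (fun s : ZMod n => s.val ≤ l), f s.val =
      ∑ k ∈ Finset.range (l + 1), f k := by
  refine Finset.sum_bij (fun s _ => s.val) ?_ ?_ ?_ ?_
  · intro s hs; simp at hs ⊢; omega
  · intro a _ b _ hab; exact ZMod.val_injective n hab
  · intro k hk
    rw [Finset.mem_range] at hk
    exact ⟨(k : ZMod n), by simp [ZMod.val_natCast, Nat.mod_eq_of_lt (by omega : k < n)]; omega,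
      by simp [ZMod.val_natCast, Nat.mod_eq_of_lt (by omega : k < n)]⟩
  · intros; rfl

theorem card_filter_val_le (h : l < n) :
    (Finset.univ.filter (fun s : ZMod n => s.val ≤ l)).card = l + 1 := by
  have := sum_filter_val_le h (fun _ => (1 : ℝ))
  simp only [Finset.sum_const, nsmul_eq_mul, mul_one, Finset.card_range] at this
  exact_mod_cast this

theorem card_closedBox (h : l < n) : (closedBox d n l).card = (l + 1) ^ d := by
  rw [closedBox, Fintype.card_piFinset]
  simp [card_filter_val_le h]

/-- The sum over the closed box of a function of one coordinate. -/
theorem sum_closedBox_apply (h : l < n) (f : ℕ → ℝ) (i : Fin d) :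
    ∑ x ∈ closedBox d n l, f (x i).val =
      ((l : ℝ) + 1) ^ (d - 1) * ∑ k ∈ Finset.range (l + 1), f k := by
  have := Fintype.sum_piFinset_apply (fun s : ZMod n => f s.val)
    (Finset.univ.filter fun s : ZMod n => s.val ≤ l) i
  rw [card_filter_val_le h, sum_filter_val_le h, Fintype.card_fin, nsmul_eq_mul] at this
  push_cast at this
  exact this

theorem val_add_one (s : ZMod n) : (s + 1).val = if s.val + 1 = n then 0 else s.val + 1 := by
  have h : s + 1 = ((s.val + 1 : ℕ) : ZMod n) := by simp
  have h2 := ZMod.val_lt s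
  rw [h, ZMod.val_natCast]
  split_ifs with h3
  · rw [h3, Nat.mod_self]
  · exact Nat.mod_eq_of_lt (by omega)

theorem mem_closedBox_of_add_unitVec {x : Torus d n} {j : Fin d}
    (h : (x + unitVec j : Torus d n) ∈ innerBox d n l) : x ∈ closedBox d n l := by
  rw [mem_innerBox] at h
  rw [mem_closedBox]
  intro i
  have := h i
  rw [add_unitVec_apply] at this
  split_ifs at this with hij
  · rw [val_add_one] at this
    split_ifs at this <;> omega
  · exact this.2

theorem ind_sq {X : Type*} [DecidableEq X] (s : Finset X) (x : X) : ind s x ^ 2 = ind s x := by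
  simp [ind]

theorem sum_ind {X : Type*} [DecidableEq X] [Fintype X] (s : Finset X) :
    ∑ x, ind s x = s.card := by
  simp [ind]

variable {H : Type*} [NormedAddCommGroup H] [InnerProductSpace ℂ H] [FiniteDimensional ℂ H]

theorem mulOp_ind_mulOp_ind (s : Finset (Torus d n)) (u : Field2 d n H) :
    mulOp (ind s) (mulOp (ind s) u) = mulOp (ind s) u := by
  rw [mulOp_mulOp]
  simp only [← pow_two, ind_sq]

theorem mulOp_ind_eq_self {s : Finset (Torus d n)} {u : Field2 d n H} :
    mulOp (ind s) u = u ↔ ∀ x ∉ s, u x = 0 := by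
  constructor
  · intro h x hx
    rw [← h]; simp [ind, hx]
  · intro h
    apply PiLp.ext; intro x
    by_cases hx : x ∈ s
    · simp [ind, hx]
    · simp [ind, hx, h x hx]

theorem norm_mulOp_ind_le (s : Finset (Torus d n)) (u : Field2 d n H) :
    ‖mulOp (ind s) u‖ ≤ ‖u‖ := by
  refine le_of_sq_le_sq ?_ (norm_nonneg _)
  rw [field_norm_sq, field_norm_sq]
  refine Finset.sum_le_sum fun x _ => ?_
  by_cases hx : x ∈ s <;> simp [ind, hx]

/-- Restriction to the inner box. -/
def proj (l : ℕ) : Field2 d n H →L[ℂ] Field2 d n H := mulOp (ind (innerBox d n l))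

theorem proj_proj (u : Field2 d n H) : proj l (proj l u) = proj l u := mulOp_ind_mulOp_ind _ u

theorem inner_proj_left (u w : Field2 d n H) :
    inner ℂ (proj l u) w = inner ℂ u (proj l w) := inner_mulOp_left _ u w

theorem gradC_supported {u : Field2 d n H} (hu : proj l u = u) :
    mulOp (ind (closedBox d n l)) (gradC u) = gradC u := by
  rw [proj, mulOp_ind_eq_self] at hu
  rw [mulOp_ind_eq_self]
  intro x hx
  apply PiLp.ext; intro j
  rw [gradC_apply, hu x (fun h => hx (innerBox_subset h)),
    hu _ (fun h => hx (mem_closedBox_of_add_unitVec h))]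
  simp

/-- The Poincaré inequality for fields supported in the inner box. -/
theorem poincare (hd : 1 ≤ d) {u : Field2 d n H} (hu : proj l u = u) :
    ‖u‖ ≤ l * ‖gradC u‖ := by
  have hu' := mulOp_ind_eq_self.1 hu
  set j : Fin d := ⟨0, hd⟩ with hj
  have key : ∀ k ≤ l, ∀ x : Torus d n, (x j).val = k →
      ‖u x‖ ≤ ∑ i ∈ Finset.range k, ‖gradC u (x - (i + 1) • unitVec j : Torus d n)‖ := by
    intro k
    induction k with
    | zero =>
      intro _ x hx
      rw [hu' x (fun h => by have := (mem_innerBox.1 h j).1; omega)]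
      simp
    | succ k ih =>
      intro hk x hx
      set y := x - unitVec j with hy
      have hxy : x = y + unitVec j := by simp [hy]
      have hyk : (y j).val = k := by
        have h1 : x j = y j + 1 := by rw [hxy, add_unitVec_apply]; simp
        rw [h1, val_add_one] at hx
        split_ifs at hx; omega
      have h2 := ih (by omega) y hyk
      have h3 : ‖u x - u y‖ ≤ ‖gradC u y‖ := by
        have h4 := PiLp.norm_apply_le (gradC u y) j
        rw [gradC_apply, ← hxy] at h4
        exact h4
      rw [Finset.sum_range_succ']
      have h5 : ∀ i : ℕ, x - (i + 1 + 1) • unitVec j = (y - (i + 1) • unitVec j : Torus d n) := by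
        intro i; rw [hxy, succ_nsmul _ (i + 1)]; abel
      have h6 : x - (0 + 1) • unitVec j = y := by simp [hy]
      simp only [h5, h6]
      calc ‖u x‖ = ‖u y + (u x - u y)‖ := by congr 1; abel
        _ ≤ _ := (norm_add_le _ _).trans (add_le_add h2 h3)
  have key2 : ∀ x, ‖u x‖ ^ 2 ≤
      l * ∑ i ∈ Finset.range l, ‖gradC u (x - (i + 1) • unitVec j)‖ ^ 2 := by
    intro x
    by_cases hx : x ∈ innerBox d n l
    · have h1 := (mem_innerBox.1 hx j).2
      have h2 := key _ h1 x rfl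
      have h3 : ‖u x‖ ≤ ∑ i ∈ Finset.range l, ‖gradC u (x - (i + 1) • unitVec j)‖ :=
        h2.trans (Finset.sum_le_sum_of_subset_of_nonneg (Finset.range_mono h1)
          fun _ _ _ => norm_nonneg _)
      calc ‖u x‖ ^ 2 ≤ (∑ i ∈ Finset.range l, ‖gradC u (x - (i + 1) • unitVec j)‖) ^ 2 := by
            gcongr
        _ ≤ _ := by
            have := sq_sum_le_card_mul_sum_sq (s := Finset.range l)
              (f := fun i => ‖gradC u (x - (i + 1) • unitVec j)‖)
            rwa [Finset.card_range] at this
    · rw [hu' x hx]; simp; positivity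
  refine le_of_sq_le_sq ?_ (by positivity)
  rw [field_norm_sq]
  calc ∑ x, ‖u x‖ ^ 2
      ≤ ∑ x, l * ∑ i ∈ Finset.range l, ‖gradC u (x - (i + 1) • unitVec j)‖ ^ 2 :=
        Finset.sum_le_sum fun x _ => key2 x
    _ = l * ∑ i ∈ Finset.range l, ∑ x, ‖gradC u (x - (i + 1) • unitVec j)‖ ^ 2 := by
        rw [← Finset.mul_sum, Finset.sum_comm]
    _ = l * ∑ i ∈ Finset.range l, ‖gradC u‖ ^ 2 := by
        congr 1
        refine Finset.sum_congr rfl fun i _ => ?_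
        rw [field_norm_sq]
        exact Equiv.sum_comp (Equiv.subRight ((i + 1) • unitVec j : Torus d n))
          fun x => ‖gradC u x‖ ^ 2
    _ = _ := by simp; ring

end Boxes

/-! ### The averaged Dirichlet Green function -/

section Green

variable {d n l : ℕ} [NeZero n]
variable {H : Type*} [NormedAddCommGroup H] [InnerProductSpace ℂ H] [FiniteDimensional ℂ H]

/-- The elliptic operator on the inner box with zero boundary values, extended by the identity
to the fields vanishing on the inner box. -/
def dirOp (l : ℕ) (B : GradH d H →L[ℂ] GradH d H) : Field2 d n H →L[ℂ] Field2 d n H :=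
  proj l * ellip B * proj l + (1 - proj l)

theorem dirOp_apply (B : GradH d H →L[ℂ] GradH d H) (u : Field2 d n H) :
    dirOp l B u = proj l (ellip B (proj l u)) + (u - proj l u) := rfl

/-- Coercivity on the fields supported in the inner box, from the Poincaré inequality. -/
theorem Coercive.ellip_proj {c : ℝ} (hc : 0 < c) {B : GradH d H →L[ℂ] GradH d H}
    (hB : Coercive c B) (hd : 1 ≤ d) (hl0 : 1 ≤ l) {u : Field2 d n H}
    (hu : proj l u = u) : c / l ^ 2 * ‖u‖ ^ 2 ≤ (inner ℂ (ellip B u) u).re := by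
  rw [inner_ellip]
  refine le_trans ?_ (hB.lift _)
  have h := poincare hd hu
  have hl1 : (0 : ℝ) < l := by exact_mod_cast hl0
  rw [div_mul_eq_mul_div, div_le_iff₀ (by positivity)]
  have : ‖u‖ ^ 2 ≤ (l * ‖gradC u‖) ^ 2 := by gcongr
  nlinarith

theorem Coercive.dirOp {c : ℝ} (hc : 0 < c) {B : GradH d H →L[ℂ] GradH d H}
    (hB : Coercive c B) (hd : 1 ≤ d) (hl0 : 1 ≤ l) :
    Coercive (min (c / l ^ 2) 1) (dirOp l B : Field2 d n H →L[ℂ] Field2 d n H) := by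
  intro u
  have h1 := hB.ellip_proj hc hd hl0 (proj_proj (l := l) u)
  have h2 : (inner ℂ (proj l u) u : ℂ) = ((‖proj l u‖ ^ 2 : ℝ) : ℂ) := by
    rw [← proj_proj, inner_proj_left, proj_proj, inner_self_eq_norm_sq_to_K]; simp
  have h3 : ‖proj l u‖ ≤ ‖u‖ := norm_mulOp_ind_le _ _
  have h4 : (inner ℂ u u : ℂ) = ((‖u‖ ^ 2 : ℝ) : ℂ) := by
    rw [inner_self_eq_norm_sq_to_K]; simp
  rw [dirOp_apply, inner_add_left, inner_sub_left, h2, h4, inner_proj_left, Complex.add_re,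
    Complex.sub_re, Complex.ofReal_re, Complex.ofReal_re]
  have h5 : ‖proj l u‖ ^ 2 ≤ ‖u‖ ^ 2 := by gcongr
  have h6 : min (c / l ^ 2) 1 * ‖proj l u‖ ^ 2 ≤ c / l ^ 2 * ‖proj l u‖ ^ 2 := by
    gcongr; exact min_le_left _ _
  have h7 : min (c / l ^ 2) 1 * (‖u‖ ^ 2 - ‖proj l u‖ ^ 2) ≤ 1 * (‖u‖ ^ 2 - ‖proj l u‖ ^ 2) :=
    mul_le_mul_of_nonneg_right (min_le_right _ _) (by linarith)
  linarith

theorem isUnit_dirOp {c : ℝ} (hc : 0 < c) {B : GradH d H →L[ℂ] GradH d H}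
    (hB : Coercive c B) (hd : 1 ≤ d) (hl0 : 1 ≤ l) :
    IsUnit (dirOp l B : Field2 d n H →L[ℂ] Field2 d n H) :=
  (hB.dirOp hc hd hl0).isUnit (by
    have : (0 : ℝ) < l := by exact_mod_cast hl0
    positivity)

/-- The solution of `∇^* B ∇ u = f` in the inner box with zero boundary values. -/
def dirSol (l : ℕ) (B : GradH d H →L[ℂ] GradH d H) (f : Field2 d n H) : Field2 d n H :=
  Ring.inverse (dirOp l B) (proj l f)

theorem dirOp_dirSol {B : GradH d H →L[ℂ] GradH d H}
    (h : IsUnit (dirOp l B : Field2 d n H →L[ℂ] Field2 d n H)) (f : Field2 d n H) :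
    dirOp l B (dirSol l B f) = proj l f :=
  congrArg (fun S : Field2 d n H →L[ℂ] Field2 d n H => S (proj l f)) (Ring.mul_inverse_cancel _ h)

theorem proj_dirSol {B : GradH d H →L[ℂ] GradH d H}
    (h : IsUnit (dirOp l B : Field2 d n H →L[ℂ] Field2 d n H)) (f : Field2 d n H) :
    proj l (dirSol l B f) = dirSol l B f := by
  have h1 := dirOp_dirSol h f
  have h2 := congrArg (proj l) h1
  rw [proj_proj, ← h1, dirOp_apply, map_add, proj_proj, map_sub, proj_proj, sub_self,
    add_zero] at h2
  have h3 := left_eq_add.1 h2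
  exact (sub_eq_zero.1 h3).symm

/-- The weak formulation of the Dirichlet problem in the inner box. -/
theorem inner_ellip_dirSol {B : GradH d H →L[ℂ] GradH d H}
    (h : IsUnit (dirOp l B : Field2 d n H →L[ℂ] Field2 d n H)) (f : Field2 d n H)
    {w : Field2 d n H} (hw : proj l w = w) :
    inner ℂ (ellip B (dirSol l B f)) w = inner ℂ f w := by
  have h1 := dirOp_dirSol h f
  rw [dirOp_apply, proj_dirSol h, sub_self, add_zero] at h1
  rw [← hw, ← inner_proj_left, h1, inner_proj_left]

/-- The normalization `(l + 2)^d` of the average over translates of the box `{1, …, l}^d`. It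
slightly exceeds the number `(l + 1)^d` of points where a gradient can be nonzero, which makes the
averaged projections strict contractions. -/
def boxNorm (d l : ℕ) : ℝ := ((l : ℝ) + 2) ^ d

theorem boxNorm_pos (d l : ℕ) : 0 < boxNorm d l := by unfold boxNorm; positivity

/-- The Fourier symbol of the Dirichlet Green function of the inner box, averaged over all
translates of the box. -/
def green (l : ℕ) (p : Torus d n) (B : GradH d H →L[ℂ] GradH d H) : H →L[ℂ] H :=
  ((boxNorm d l)⁻¹ : ℂ) • (ContinuousLinearMap.adjoint (wave p) ∘L proj l ∘L
    Ring.inverse (dirOp l B) ∘L proj l ∘L wave p)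

theorem inner_green {B : GradH d H →L[ℂ] GradH d H}
    (h : IsUnit (dirOp l B : Field2 d n H →L[ℂ] Field2 d n H)) (p : Torus d n) (v w : H) :
    inner ℂ (green l p B v) w =
      ((boxNorm d l)⁻¹ : ℂ) * inner ℂ (dirSol l B (wave p v)) (wave p w) := by
  have h1 : green l p B v = ((boxNorm d l)⁻¹ : ℂ) • ContinuousLinearMap.adjoint (wave p)
      (proj l (dirSol l B (wave p v))) := rfl
  rw [h1, proj_dirSol h, inner_smul_left, ContinuousLinearMap.adjoint_inner_left]
  simp

theorem norm_proj_wave_sq_le (hl : l < n) (p : Torus d n) (v : H) :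
    ‖proj l (wave p v)‖ ^ 2 ≤ boxNorm d l * ‖v‖ ^ 2 := by
  rw [proj, norm_mulOp_wave_sq]
  simp only [ind_sq, sum_ind]
  gcongr
  have h1 := Finset.card_le_card (innerBox_subset (d := d) (n := n) (l := l))
  rw [card_closedBox hl] at h1
  calc ((innerBox d n l).card : ℝ) ≤ ((l : ℝ) + 1) ^ d := by exact_mod_cast h1
    _ ≤ _ := by unfold boxNorm; gcongr; norm_num

theorem norm_green_apply_le {c : ℝ} (hc : 0 < c) {B : GradH d H →L[ℂ] GradH d H}
    (hB : Coercive c B) (hd : 1 ≤ d) (hl : l < n) (hl0 : 1 ≤ l) (p : Torus d n) (v : H) :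
    ‖green l p B v‖ ≤ l ^ 2 / c * ‖v‖ := by
  have hU := isUnit_dirOp (n := n) hc hB hd hl0
  have hl1 : (0 : ℝ) < l := by exact_mod_cast hl0
  set u := dirSol l B (wave p v) with hu
  have hPu : proj l u = u := proj_dirSol hU _
  have h1 : ‖u‖ ≤ l ^ 2 / c * ‖proj l (wave p v)‖ := by
    have h2 := hB.ellip_proj hc hd hl0 hPu
    rw [inner_ellip_dirSol hU _ hPu, ← hPu, ← inner_proj_left, hPu] at h2
    have h3 := h2.trans (re_inner_le _ _)
    rcases (norm_nonneg u).eq_or_lt with h0 | h0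
    · rw [← h0]; positivity
    · have h4 : c / l ^ 2 * ‖u‖ ≤ ‖proj l (wave p v)‖ := by
        rw [pow_two ‖u‖, ← mul_assoc] at h3
        exact le_of_mul_le_mul_right h3 h0
      rw [div_mul_eq_mul_div, le_div_iff₀ hc]
      rw [div_mul_eq_mul_div, div_le_iff₀ (by positivity)] at h4
      linarith
  set b : ℝ := boxNorm d l with hb
  have hb0 : 0 < b := boxNorm_pos d l
  have h5 : ‖green l p B v‖ ^ 2 ≤ l ^ 2 / c * ‖v‖ * ‖green l p B v‖ := by
    rw [← inner_self_eq_norm_sq (𝕜 := ℂ), inner_green hU]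
    have e : ((boxNorm d l)⁻¹ : ℂ) = ((b⁻¹ : ℝ) : ℂ) := by simp [hb]
    rw [e, ← hu]
    change (((b⁻¹ : ℝ) : ℂ) * _).re ≤ _
    rw [Complex.re_ofReal_mul, ← hPu, inner_proj_left]
    have h6 := norm_proj_wave_sq_le hl p v
    have h7 := norm_proj_wave_sq_le hl p (green l p B v)
    have h8 : ‖proj l (wave p v)‖ * ‖proj l (wave p (green l p B v))‖ ≤
        b * (‖v‖ * ‖green l p B v‖) := by
      refine le_of_sq_le_sq ?_ (by positivity)
      rw [mul_pow]
      calc _ ≤ (b * ‖v‖ ^ 2) * (b * ‖green l p B v‖ ^ 2) := by gcongr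
        _ = _ := by ring
    calc b⁻¹ * (inner ℂ u (proj l (wave p (green l p B v)))).re
        ≤ b⁻¹ * ((l ^ 2 / c * ‖proj l (wave p v)‖) * ‖proj l (wave p (green l p B v))‖) := by
          gcongr
          refine (re_inner_le _ _).trans ?_
          gcongr
      _ = b⁻¹ * (l ^ 2 / c) * (‖proj l (wave p v)‖ * ‖proj l (wave p (green l p B v))‖) := by
          ring
      _ ≤ b⁻¹ * (l ^ 2 / c) * (b * (‖v‖ * ‖green l p B v‖)) := by gcongr
      _ = _ := by field_simp
  rcases (norm_nonneg (green l p B v)).eq_or_lt with h0 | h0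
  · rw [← h0]; positivity
  · rw [pow_two] at h5
    exact le_of_mul_le_mul_right h5 h0

theorem adjoint_dirOp (B : GradH d H →L[ℂ] GradH d H) :
    ContinuousLinearMap.adjoint (dirOp l B : Field2 d n H →L[ℂ] Field2 d n H) =
      dirOp l (ContinuousLinearMap.adjoint B) := by
  symm
  rw [ContinuousLinearMap.eq_adjoint_iff]
  intro u w
  rw [dirOp_apply, dirOp_apply, inner_add_left, inner_add_right, inner_sub_left, inner_sub_right,
    inner_proj_left, inner_proj_left, ← adjoint_ellip, ContinuousLinearMap.adjoint_inner_left,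
    inner_proj_left]

theorem adjoint_green (p : Torus d n) (B : GradH d H →L[ℂ] GradH d H) :
    ContinuousLinearMap.adjoint (green l p B) = green l p (ContinuousLinearMap.adjoint B) := by
  have h1 : Ring.inverse (dirOp l (ContinuousLinearMap.adjoint B) :
      Field2 d n H →L[ℂ] Field2 d n H) =
      ContinuousLinearMap.adjoint (Ring.inverse (dirOp l B)) := by
    rw [← adjoint_dirOp, ← ContinuousLinearMap.star_eq_adjoint,
      ← ContinuousLinearMap.star_eq_adjoint]
    exact Ring.inverse_star _
  symm
  rw [ContinuousLinearMap.eq_adjoint_iff]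
  intro v w
  simp only [green, smul_apply, ContinuousLinearMap.comp_apply, h1,
    inner_smul_left, inner_smul_right, ContinuousLinearMap.adjoint_inner_left,
    ContinuousLinearMap.adjoint_inner_right, inner_proj_left]
  simp

end Green

/-! ### A cutoff function for boxes -/

section Cutoff

/-- The one-dimensional cutoff, which vanishes at `0` and at `l + 1` and approaches `1` in between
at distance `1 / (1 - κ)` from these points. It vanishes beyond `l + 1` too, because the
subtraction of natural numbers is truncated. -/
def cut (κ : ℝ) (l s : ℕ) : ℝ := (1 - κ ^ s) * (1 - κ ^ (l + 1 - s))

variable {κ : ℝ} {l : ℕ}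

theorem cut_nonneg (h0 : 0 ≤ κ) (h1 : κ ≤ 1) (s : ℕ) : 0 ≤ cut κ l s :=
  mul_nonneg (sub_nonneg.2 (pow_le_one₀ h0 h1)) (sub_nonneg.2 (pow_le_one₀ h0 h1))

theorem cut_le_one (h0 : 0 ≤ κ) (h1 : κ ≤ 1) (s : ℕ) : cut κ l s ≤ 1 := by
  refine mul_le_one₀ ?_ (sub_nonneg.2 (pow_le_one₀ h0 h1)) ?_
  · have := pow_nonneg h0 s; linarith
  · have := pow_nonneg h0 (l + 1 - s); linarith

theorem cut_zero : cut κ l 0 = 0 := by simp [cut]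

theorem cut_of_lt {s : ℕ} (h : l < s) : cut κ l s = 0 := by
  simp [cut, Nat.sub_eq_zero_of_le h]

theorem sum_range_pow_le (h0 : 0 ≤ κ) (h1 : κ < 1) (M : ℕ) :
    ∑ s ∈ Finset.range M, κ ^ s ≤ 1 / (1 - κ) := by
  rw [one_div]
  have := (hasSum_geometric_of_lt_one h0 h1)
  exact sum_le_hasSum _ (fun i _ => pow_nonneg h0 i) this

theorem sum_range_pow_add_pow_sub_le (h0 : 0 ≤ κ) (h1 : κ < 1) (l : ℕ) :
    ∑ s ∈ Finset.range (l + 1), (κ ^ s + κ ^ (l - s)) ≤ 2 / (1 - κ) := by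
  rw [Finset.sum_add_distrib]
  have h := Finset.sum_range_reflect (fun s => κ ^ s) (l + 1)
  have h2 : ∀ s, l + 1 - 1 - s = l - s := fun s => by omega
  simp only [h2] at h
  rw [h]
  have := sum_range_pow_le h0 h1 (l + 1)
  have e : 2 / (1 - κ) = 1 / (1 - κ) + 1 / (1 - κ) := by ring
  linarith

theorem sum_one_sub_cut_le (h0 : 0 ≤ κ) (h1 : κ < 1) :
    ∑ s ∈ Finset.range (l + 1), (1 - cut κ l s) ≤ 2 / (1 - κ) := by
  refine le_trans (Finset.sum_le_sum fun s hs => ?_) (sum_range_pow_add_pow_sub_le h0 h1 l)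
  have hs' : s ≤ l := by simpa [Nat.lt_succ_iff] using hs
  have e : l + 1 - s = (l - s) + 1 := by omega
  have a := pow_nonneg h0 s
  have b := pow_nonneg h0 (l - s)
  have hb : κ ^ (l - s) * κ ≤ κ ^ (l - s) := mul_le_of_le_one_right b h1.le
  rw [cut, e, pow_succ]
  nlinarith [mul_nonneg a (mul_nonneg b h0)]

theorem sum_cut_diff_sq_le (h0 : 0 ≤ κ) (h1 : κ < 1) :
    ∑ s ∈ Finset.range (l + 1), (cut κ l (s + 1) - cut κ l s) ^ 2 ≤ 4 * (1 - κ) := by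
  have key : ∀ s ∈ Finset.range (l + 1), (cut κ l (s + 1) - cut κ l s) ^ 2 ≤
      2 * (1 - κ) ^ 2 * (κ ^ s + κ ^ (l - s)) := by
    intro s hs
    have hs' : s ≤ l := by simpa [Nat.lt_succ_iff] using hs
    have e : l + 1 - s = (l - s) + 1 := by omega
    have e' : l + 1 - (s + 1) = l - s := by omega
    have a0 := pow_nonneg h0 s
    have b0 := pow_nonneg h0 (l - s)
    have a1 : κ ^ s ≤ 1 := pow_le_one₀ h0 h1.le
    have b1 : κ ^ (l - s) ≤ 1 := pow_le_one₀ h0 h1.le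
    have e2 : cut κ l (s + 1) - cut κ l s =
        (1 - κ) * (κ ^ s * (1 - κ ^ (l - s)) - (1 - κ ^ s) * κ ^ (l - s)) := by
      rw [cut, cut, e, e', pow_succ, pow_succ]; ring
    rw [e2]
    generalize κ ^ s = a at *
    generalize κ ^ (l - s) = b at *
    have e3 : ((1 - κ) * (a * (1 - b) - (1 - a) * b)) ^ 2 = (1 - κ) ^ 2 * (a - b) ^ 2 := by ring
    rw [e3, mul_comm 2, mul_assoc]
    refine mul_le_mul_of_nonneg_left ?_ (sq_nonneg _)
    nlinarith
  refine (Finset.sum_le_sum key).trans ?_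
  rw [← Finset.mul_sum]
  have h2 : 0 < 1 - κ := by linarith
  calc _ ≤ 2 * (1 - κ) ^ 2 * (2 / (1 - κ)) := by
        gcongr; exact sum_range_pow_add_pow_sub_le h0 h1 l
    _ = _ := by field_simp; ring

theorem one_sub_prod_le_sum {ι : Type*} (s : Finset ι) {f : ι → ℝ} (h0 : ∀ i, 0 ≤ f i)
    (h1 : ∀ i, f i ≤ 1) : 1 - ∏ i ∈ s, f i ≤ ∑ i ∈ s, (1 - f i) := by
  classical
  induction s using Finset.induction_on with
  | empty => simp
  | insert a s ha ih =>
    rw [Finset.prod_insert ha, Finset.sum_insert ha]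
    have h2 : ∏ i ∈ s, f i ≤ 1 := Finset.prod_le_one (fun i _ => h0 i) fun i _ => h1 i
    nlinarith [h0 a, h1 a]

variable {d n : ℕ}

/-- The cutoff function for the inner box: the product of the one-dimensional cutoffs. -/
def zeta (κ : ℝ) (l : ℕ) (x : Torus d n) : ℝ := ∏ i, cut κ l (x i).val

theorem zeta_nonneg (h0 : 0 ≤ κ) (h1 : κ ≤ 1) (x : Torus d n) : 0 ≤ zeta κ l x :=
  Finset.prod_nonneg fun _ _ => cut_nonneg h0 h1 _

theorem zeta_le_one (h0 : 0 ≤ κ) (h1 : κ ≤ 1) (x : Torus d n) : zeta κ l x ≤ 1 :=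
  Finset.prod_le_one (fun _ _ => cut_nonneg h0 h1 _) fun _ _ => cut_le_one h0 h1 _

variable [NeZero n]

theorem zeta_eq_zero {x : Torus d n} (hx : x ∉ innerBox d n l) : zeta κ l x = 0 := by
  rw [mem_innerBox] at hx
  push Not at hx
  obtain ⟨i, hi⟩ := hx
  refine Finset.prod_eq_zero (Finset.mem_univ i) ?_
  rcases Nat.eq_zero_or_pos (x i).val with h | h
  · rw [h, cut_zero]
  · exact cut_of_lt (hi h)

/-- A difference of the cutoff in direction `j` only changes the `j`-th factor of the product. -/
theorem zeta_diff_sq_le (h0 : 0 ≤ κ) (h1 : κ ≤ 1) (hl : l < n) (x : Torus d n) (j : Fin d) :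
    (zeta κ l (x + unitVec j) - zeta κ l x) ^ 2 ≤
      (cut κ l ((x j).val + 1) - cut κ l (x j).val) ^ 2 := by
  have e1 : zeta κ l (x + unitVec j) =
      cut κ l ((x j).val + 1) * ∏ i ∈ Finset.univ.erase j, cut κ l (x i).val := by
    rw [zeta, ← Finset.mul_prod_erase _ _ (Finset.mem_univ j)]
    congr 1
    · rw [add_unitVec_apply, if_pos rfl, val_add_one]
      split_ifs with h
      · rw [cut_zero, cut_of_lt (by omega)]
      · rfl
    · refine Finset.prod_congr rfl fun i hi => ?_
      rw [add_unitVec_apply, if_neg (Finset.ne_of_mem_erase hi)]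
  have e2 : zeta κ l x =
      cut κ l (x j).val * ∏ i ∈ Finset.univ.erase j, cut κ l (x i).val := by
    rw [zeta, ← Finset.mul_prod_erase _ _ (Finset.mem_univ j)]
  rw [e1, e2, ← sub_mul, mul_pow]
  have h2 : 0 ≤ ∏ i ∈ Finset.univ.erase j, cut κ l (x i).val :=
    Finset.prod_nonneg fun _ _ => cut_nonneg h0 h1 _
  have h3 : ∏ i ∈ Finset.univ.erase j, cut κ l (x i).val ≤ 1 :=
    Finset.prod_le_one (fun _ _ => cut_nonneg h0 h1 _) fun _ _ => cut_le_one h0 h1 _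
  exact mul_le_of_le_one_right (sq_nonneg _) (pow_le_one₀ h2 h3)

theorem sum_one_sub_zeta_le (h0 : 0 ≤ κ) (h1 : κ < 1) (hl : l < n) :
    ∑ x ∈ closedBox d n l, (1 - zeta κ l x) ≤ d * ((l : ℝ) + 1) ^ (d - 1) * (2 / (1 - κ)) := by
  calc ∑ x ∈ closedBox d n l, (1 - zeta κ l x)
      ≤ ∑ x ∈ closedBox d n l, ∑ i, (1 - cut κ l (x i).val) :=
        Finset.sum_le_sum fun x _ => one_sub_prod_le_sum _
          (fun i => cut_nonneg h0 h1.le _) fun i => cut_le_one h0 h1.le _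
    _ = ∑ i : Fin d, ((l : ℝ) + 1) ^ (d - 1) *
          ∑ k ∈ Finset.range (l + 1), (1 - cut κ l k) := by
        rw [Finset.sum_comm]
        exact Finset.sum_congr rfl fun i _ => sum_closedBox_apply hl (fun k => 1 - cut κ l k) i
    _ ≤ ∑ i : Fin d, ((l : ℝ) + 1) ^ (d - 1) * (2 / (1 - κ)) := by
        gcongr; exact sum_one_sub_cut_le h0 h1
    _ = _ := by simp; ring

theorem sum_zeta_diff_sq_le (h0 : 0 ≤ κ) (h1 : κ < 1) (hl : l < n) (j : Fin d) :
    ∑ x ∈ closedBox d n l, (zeta κ l (x + unitVec j) - zeta κ l x) ^ 2 ≤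
      ((l : ℝ) + 1) ^ (d - 1) * (4 * (1 - κ)) := by
  refine (Finset.sum_le_sum fun x _ => zeta_diff_sq_le h0 h1.le hl x j).trans ?_
  rw [sum_closedBox_apply hl (fun k => (cut κ l (k + 1) - cut κ l k) ^ 2) j]
  gcongr
  exact sum_cut_diff_sq_le h0 h1

theorem sum_zeta_le (h0 : 0 ≤ κ) (h1 : κ ≤ 1) (hl : l < n) :
    ∑ x : Torus d n, zeta κ l x ≤ ((l : ℝ) + 1) ^ d := by
  have h2 : ∑ x : Torus d n, zeta κ l x = ∑ x ∈ closedBox d n l, zeta κ l x :=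
    (Finset.sum_subset (Finset.subset_univ _) fun x _ hx =>
      zeta_eq_zero fun h => hx (innerBox_subset h)).symm
  rw [h2]
  calc _ ≤ ∑ x ∈ closedBox d n l, (1 : ℝ) := Finset.sum_le_sum fun x _ => zeta_le_one h0 h1 x
    _ = _ := by simp [card_closedBox hl]

theorem le_sum_zeta (h0 : 0 ≤ κ) (h1 : κ < 1) (hl : l < n) :
    ((l : ℝ) + 1) ^ d - d * ((l : ℝ) + 1) ^ (d - 1) * (2 / (1 - κ)) ≤
      ∑ x : Torus d n, zeta κ l x := by
  have h2 : ∑ x : Torus d n, zeta κ l x = ∑ x ∈ closedBox d n l, zeta κ l x :=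
    (Finset.sum_subset (Finset.subset_univ _) fun x _ hx =>
      zeta_eq_zero fun h => hx (innerBox_subset h)).symm
  have h3 := sum_one_sub_zeta_le (d := d) (n := n) h0 h1 hl
  rw [Finset.sum_sub_distrib, ← h2] at h3
  simp only [Finset.sum_const, nsmul_eq_mul, mul_one, card_closedBox hl] at h3
  push_cast at h3
  linarith

/-- The energy in the closed box of the plane wave times `1 - ζ`. The discrete product rule gives
a term with the mass of `1 - ζ` and a term with the differences of `ζ`. -/
theorem norm_grad_cutoff_wave_sq_le {H : Type*} [NormedAddCommGroup H] [InnerProductSpace ℂ H]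
    [FiniteDimensional ℂ H] (h0 : 0 ≤ κ) (h1 : κ < 1) (hl : l < n) (p : Torus d n) (v : H) :
    ‖mulOp (ind (closedBox d n l))
        (gradC (mulOp (fun x => 1 - zeta κ l x) (wave p v)))‖ ^ 2 ≤
      ((l : ℝ) + 1) ^ (d - 1) * d * (4 * symbNorm p ^ 2 / (1 - κ) + 8 * (1 - κ)) * ‖v‖ ^ 2 := by
  have hpt : ∀ x : Torus d n,
      ‖gradC (mulOp (fun x => 1 - zeta κ l x) (wave p v)) x‖ ^ 2 ≤
        ∑ j, (2 * ‖symb p j‖ ^ 2 * (1 - zeta κ l x) +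
          2 * (zeta κ l (x + unitVec j) - zeta κ l x) ^ 2) * ‖v‖ ^ 2 := by
    intro x
    rw [norm_gradC_apply_sq]
    refine Finset.sum_le_sum fun j _ => ?_
    have hz0 := zeta_nonneg (l := l) h0 h1.le x
    have hz1 := zeta_le_one (l := l) h0 h1.le x
    have e : mulOp (fun x => 1 - zeta κ l x) (wave p v) (x + unitVec j) -
        mulOp (fun x => 1 - zeta κ l x) (wave p v) x =
        (((1 - zeta κ l x : ℝ) : ℂ) * symb p j * chr p x) • v +
          (((zeta κ l x - zeta κ l (x + unitVec j) : ℝ) : ℂ) * chr p (x + unitVec j)) • v := by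
      simp only [mulOp_apply, wave_apply, smul_smul, ← sub_smul, ← add_smul]
      congr 1
      have := chr_add_unitVec p x j
      push_cast
      linear_combination (1 - (zeta κ l x : ℂ)) * this
    rw [e]
    have hn : ‖(((1 - zeta κ l x : ℝ) : ℂ) * symb p j * chr p x) • v +
          (((zeta κ l x - zeta κ l (x + unitVec j) : ℝ) : ℂ) * chr p (x + unitVec j)) • v‖ ≤
        ((1 - zeta κ l x) * ‖symb p j‖ + |zeta κ l (x + unitVec j) - zeta κ l x|) * ‖v‖ := by
      refine (norm_add_le _ _).trans (le_of_eq ?_)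
      rw [norm_smul, norm_smul, norm_mul, norm_mul, norm_mul, norm_chr, norm_chr,
        Complex.norm_real, Complex.norm_real, Real.norm_eq_abs, Real.norm_eq_abs,
        abs_of_nonneg (by linarith : 0 ≤ 1 - zeta κ l x), abs_sub_comm]
      ring
    calc _ ≤ (((1 - zeta κ l x) * ‖symb p j‖ +
          |zeta κ l (x + unitVec j) - zeta κ l x|) * ‖v‖) ^ 2 := by gcongr
      _ = ((1 - zeta κ l x) * ‖symb p j‖ +
          |zeta κ l (x + unitVec j) - zeta κ l x|) ^ 2 * ‖v‖ ^ 2 := by ring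
      _ ≤ _ := by
        refine mul_le_mul_of_nonneg_right ?_ (by positivity)
        rw [← sq_abs (zeta κ l (x + unitVec j) - zeta κ l x)]
        have h3 : (1 - zeta κ l x) ^ 2 ≤ 1 - zeta κ l x := by nlinarith
        have h4 := mul_le_mul_of_nonneg_right h3 (sq_nonneg ‖symb p j‖)
        nlinarith [sq_nonneg ((1 - zeta κ l x) * ‖symb p j‖ -
          |zeta κ l (x + unitVec j) - zeta κ l x|)]
  rw [field_norm_sq]
  have e1 : ∑ x, ‖mulOp (ind (closedBox d n l))
        (gradC (mulOp (fun x => 1 - zeta κ l x) (wave p v))) x‖ ^ 2 =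
      ∑ x ∈ closedBox d n l, ‖gradC (mulOp (fun x => 1 - zeta κ l x) (wave p v)) x‖ ^ 2 := by
    rw [← Finset.sum_subset (Finset.subset_univ (closedBox d n l))]
    · exact Finset.sum_congr rfl fun x hx => by simp [ind, hx]
    · intro x _ hx; simp [ind, hx]
  rw [e1]
  refine (Finset.sum_le_sum fun x _ => hpt x).trans ?_
  rw [Finset.sum_comm]
  have hκ : 0 < 1 - κ := by linarith
  have hj : ∀ j : Fin d, ∑ x ∈ closedBox d n l, (2 * ‖symb p j‖ ^ 2 * (1 - zeta κ l x) +
          2 * (zeta κ l (x + unitVec j) - zeta κ l x) ^ 2) * ‖v‖ ^ 2 ≤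
      (2 * ‖symb p j‖ ^ 2 * (d * ((l : ℝ) + 1) ^ (d - 1) * (2 / (1 - κ))) +
        2 * (((l : ℝ) + 1) ^ (d - 1) * (4 * (1 - κ)))) * ‖v‖ ^ 2 := by
    intro j
    rw [← Finset.sum_mul, Finset.sum_add_distrib, ← Finset.mul_sum, ← Finset.mul_sum]
    gcongr
    · exact sum_one_sub_zeta_le h0 h1 hl
    · exact sum_zeta_diff_sq_le h0 h1 hl j
  refine (Finset.sum_le_sum fun j _ => hj j).trans (le_of_eq ?_)
  rw [← Finset.sum_mul, Finset.sum_add_distrib, ← Finset.sum_mul, ← Finset.mul_sum,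
    ← symbNorm_sq]
  simp only [Finset.sum_const, Finset.card_univ, Fintype.card_fin, nsmul_eq_mul]
  ring

end Cutoff

/-! ### Decay of the averaged harmonic extension -/

section Decay

variable {d n l : ℕ} [NeZero n]
variable {H : Type*} [NormedAddCommGroup H] [InnerProductSpace ℂ H] [FiniteDimensional ℂ H]

theorem ahat_inverse_apply {p : Torus d n} (hp : p ≠ 0) {c : ℝ} (hc : 0 < c)
    {B : GradH d H →L[ℂ] GradH d H} (hB : Coercive c B) (w : H) :
    ahat p B (Ring.inverse (ahat p B) w) = w := by
  have h0 := symbNorm_pos hp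
  have := Ring.mul_inverse_cancel _ ((hB.ahat p).isUnit (by positivity))
  exact congrArg (fun S : H →L[ℂ] H => S w) this

theorem norm_ahat_inverse_apply_le {p : Torus d n} (hp : p ≠ 0) {c : ℝ} (hc : 0 < c)
    {B : GradH d H →L[ℂ] GradH d H} (hB : Coercive c B) (w : H) :
    ‖Ring.inverse (ahat p B) w‖ ≤ (c * symbNorm p ^ 2)⁻¹ * ‖w‖ := by
  have h0 := symbNorm_pos hp
  exact (hB.ahat p).norm_inverse_apply_le (by positivity) w

/-- Pairing a field supported in the inner box with a plane wave: since a plane wave is the image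
under the adjoint elliptic operator of a plane wave with amplitude of order `|q|^{-2}`, the pairing
gains a factor `|q|^{-1}` over the energy norm. -/
theorem norm_inner_wave_le {c Λ : ℝ} (hc : 0 < c) {B : GradH d H →L[ℂ] GradH d H}
    (hB : Coercive c B) (hΛ : ‖B‖ ≤ Λ) (hl : l < n) {p : Torus d n} (hp : p ≠ 0)
    {u : Field2 d n H} (hu : proj l u = u) (w : H) :
    ‖(inner ℂ u (wave p w) : ℂ)‖ ≤
      Λ / c * (‖gradC u‖ * √(((l : ℝ) + 1) ^ d) / symbNorm p) * ‖w‖ := by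
  have h0 := symbNorm_pos hp
  set w' := Ring.inverse (ahat p (ContinuousLinearMap.adjoint B)) w with hw'
  have h1 : ahat p (ContinuousLinearMap.adjoint B) w' = w :=
    ahat_inverse_apply hp hc hB.adjoint w
  have h2 : ‖w'‖ ≤ (c * symbNorm p ^ 2)⁻¹ * ‖w‖ := norm_ahat_inverse_apply_le hp hc hB.adjoint w
  have h3 : (inner ℂ u (wave p w) : ℂ) = inner ℂ (lift B (gradC u))
      (mulOp (ind (closedBox d n l)) (wave p (tens (symb p) w'))) := by
    rw [← inner_mulOp_left, ← lift_mulOp, gradC_supported hu, ← gradC_wave, ← inner_ellip,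
      ← ContinuousLinearMap.adjoint_inner_right, adjoint_ellip, ellip_wave, h1]
  have h4 : ‖mulOp (ind (closedBox d n l)) (wave p (tens (symb p) w'))‖ =
      √(((l : ℝ) + 1) ^ d) * (symbNorm p * ‖w'‖) := by
    rw [← Real.sqrt_sq (norm_nonneg (mulOp _ _)), norm_mulOp_wave_sq]
    simp only [ind_sq, sum_ind, card_closedBox hl]
    rw [Real.sqrt_mul (by positivity), Real.sqrt_sq (norm_nonneg _), norm_tens_symb]
    push_cast; rfl
  have hΛ0 : 0 ≤ Λ := (norm_nonneg B).trans hΛ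
  rw [h3]
  refine (norm_inner_le_norm _ _).trans ?_
  rw [h4]
  calc _ ≤ (Λ * ‖gradC u‖) *
        (√(((l : ℝ) + 1) ^ d) * (symbNorm p * ((c * symbNorm p ^ 2)⁻¹ * ‖w‖))) := by
        gcongr
        exact (norm_lift_le _ _).trans (by gcongr)
    _ = _ := by field_simp

/-- The difference between the local solution and the plane wave cut off near the boundary has
small energy: it only sees the gradient of the plane wave in a boundary layer of width `1 / |q|`. -/
theorem norm_gradC_dirSol_sub_le {c Λ : ℝ} (hc : 0 < c) {B : GradH d H →L[ℂ] GradH d H}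
    (hB : Coercive c B) (hΛ : ‖B‖ ≤ Λ)
    (hU : IsUnit (dirOp l B : Field2 d n H →L[ℂ] Field2 d n H)) (p : Torus d n) (v : H)
    {θ : Torus d n → ℝ} (hθ : ∀ x ∉ innerBox d n l, θ x = 0) :
    ‖gradC (dirSol l B (wave p (ahat p B v)) - mulOp θ (wave p v))‖ ≤
      Λ / c * ‖mulOp (ind (closedBox d n l))
        (gradC (mulOp (fun x => 1 - θ x) (wave p v)))‖ := by
  set δ := dirSol l B (wave p (ahat p B v)) - mulOp θ (wave p v) with hδ
  have hθp : proj l (mulOp θ (wave p v)) = mulOp θ (wave p v) := by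
    rw [proj, mulOp_ind_eq_self]
    intro x hx; simp [hθ x hx]
  have hδp : proj l δ = δ := by rw [hδ, map_sub, proj_dirSol hU, hθp]
  have hΛ0 : 0 ≤ Λ := (norm_nonneg B).trans hΛ
  have e1 : mulOp (fun x => 1 - θ x) (wave p v) = wave p v - mulOp θ (wave p v) := by
    apply PiLp.ext; intro x
    simp only [mulOp_apply, PiLp.sub_apply, wave_apply]
    push_cast
    rw [sub_smul, one_smul]
  set g := mulOp (ind (closedBox d n l)) (gradC (mulOp (fun x => 1 - θ x) (wave p v))) with hg
  have e2 : (inner ℂ (ellip B δ) δ : ℂ) = inner ℂ (lift B g) (gradC δ) := by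
    have e3 : ellip B δ = ellip B (dirSol l B (wave p (ahat p B v))) -
        ellip B (mulOp θ (wave p v)) := map_sub _ _ _
    rw [hg, lift_mulOp, inner_mulOp_left, gradC_supported hδp, ← inner_ellip, e1, map_sub (ellip B)
      (wave p v), inner_sub_left, ellip_wave, e3, inner_sub_left, inner_ellip_dirSol hU _ hδp]
  have h1 : c * ‖gradC δ‖ ^ 2 ≤ Λ * ‖g‖ * ‖gradC δ‖ := by
    calc c * ‖gradC δ‖ ^ 2 ≤ (inner ℂ (ellip B δ) δ).re := by
          rw [inner_ellip]; exact hB.lift _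
      _ ≤ ‖lift B g‖ * ‖gradC δ‖ := by rw [e2]; exact re_inner_le _ _
      _ ≤ _ := by
          gcongr
          exact (norm_lift_le _ _).trans (by gcongr)
  rcases (norm_nonneg (gradC δ)).eq_or_lt with h0 | h0
  · rw [← h0]; positivity
  · rw [pow_two, ← mul_assoc] at h1
    have h2 := le_of_mul_le_mul_right h1 h0
    rw [div_mul_eq_mul_div, le_div_iff₀ hc]
    linarith

theorem pow_add_two_sub_le (d l : ℕ) :
    ((l : ℝ) + 2) ^ d - ((l : ℝ) + 1) ^ d ≤ d * ((l : ℝ) + 2) ^ d / (l + 2) := by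
  have h := one_add_mul_le_pow (a := -(1 / ((l : ℝ) + 2))) (by
    have : 1 / ((l : ℝ) + 2) ≤ 1 := by
      rw [div_le_one (by positivity)]; have : (0 : ℝ) ≤ l := by positivity
      linarith
    linarith) d
  have e : 1 + -(1 / ((l : ℝ) + 2)) = (l + 1) / (l + 2) := by field_simp; ring
  rw [e, div_pow, le_div_iff₀ (by positivity)] at h
  have e2 : d * ((l : ℝ) + 2) ^ d / (l + 2) = d * (1 / ((l : ℝ) + 2)) * (l + 2) ^ d := by ring
  rw [e2]
  linarith

/-- The constant in the decay estimate `norm_sub_green_ahat_mul_sqrt_le`. -/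
def decayConst (d : ℕ) (K : ℝ) : ℝ := 6 * d ^ 2 + 4 * d * K ^ 2 + K + 1

/-- Division of a quadratic inequality by the unknown `W`. -/
theorem mul_le_of_sq_le_add {W V s A E a e D : ℝ} (hW : 0 ≤ W) (hV : 0 ≤ V) (hs : 0 ≤ s)
    (h : W ^ 2 ≤ A * (V * W) + E) (hA : A * s ≤ a) (hE : E * s ≤ e * V * W)
    (hD : a + e ≤ D ∧ 0 ≤ D) : W * s ≤ D * V := by
  have h2 : (W * s) * W ≤ (D * V) * W := by
    calc (W * s) * W = W ^ 2 * s := by ring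
      _ ≤ (A * (V * W) + E) * s := by gcongr
      _ = (A * s) * (V * W) + E * s := by ring
      _ ≤ a * (V * W) + e * V * W := by gcongr
      _ = (a + e) * (V * W) := by ring
      _ ≤ D * (V * W) := by gcongr; exact hD.1
      _ = _ := by ring
  rcases hW.eq_or_lt with h0 | h0
  · rw [← h0, zero_mul]; exact mul_nonneg hD.2 hV
  · exact le_of_mul_le_mul_right h2 h0

/-- The averaged harmonic extension `1 - Ĝ Â` is of order `(l |q|)^{-1/2}`. -/
theorem norm_sub_green_ahat_mul_sqrt_le {c Λ : ℝ} (hc : 0 < c) {B : GradH d H →L[ℂ] GradH d H}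
    (hB : Coercive c B) (hΛ : ‖B‖ ≤ Λ) (hd : 1 ≤ d) (hl : l < n) (hl0 : 1 ≤ l)
    {p : Torus d n} (hp : p ≠ 0) (v : H) :
    ‖v - green l p B (ahat p B v)‖ * √(l * symbNorm p) ≤ decayConst d (Λ / c) * ‖v‖ := by
  have hq := symbNorm_pos hp
  have hΛ0 : 0 ≤ Λ := (norm_nonneg B).trans hΛ
  have hl1 : (1 : ℝ) ≤ l := by exact_mod_cast hl0
  have hd1 : (1 : ℝ) ≤ d := by exact_mod_cast hd
  set X := l * symbNorm p with hX
  have hX0 : 0 < X := by positivity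
  set K := Λ / c with hK
  have hK0 : 0 ≤ K := by positivity
  rcases le_or_gt X 1 with hX1 | hX1
  -- for `l |q| ≤ 1` the crude bound `|Ĝ Â| ≤ K (l |q|)²` suffices
  · have h1 : ‖v - green l p B (ahat p B v)‖ ≤ (1 + K) * ‖v‖ := by
      have h2 := norm_green_apply_le hc hB hd hl hl0 p (ahat p B v)
      have h3 := norm_ahat_apply_le p B v
      calc _ ≤ ‖v‖ + ‖green l p B (ahat p B v)‖ := norm_sub_le _ _
        _ ≤ ‖v‖ + l ^ 2 / c * (Λ * symbNorm p ^ 2 * ‖v‖) := by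
            gcongr
            refine h2.trans ?_
            gcongr
            exact h3.trans (by gcongr)
        _ = (1 + K * X ^ 2) * ‖v‖ := by rw [hK, hX]; field_simp
        _ ≤ (1 + K * 1) * ‖v‖ := by gcongr; exact pow_le_one₀ hX0.le hX1
        _ = _ := by ring
    have h2 : √X ≤ 1 := by
      rw [Real.sqrt_le_iff]; exact ⟨zero_le_one, by simpa using hX1⟩
    calc _ ≤ ((1 + K) * ‖v‖) * 1 := by gcongr
      _ ≤ _ := by
        rw [mul_one]
        refine mul_le_mul_of_nonneg_right ?_ (norm_nonneg v)
        unfold decayConst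
        nlinarith [sq_nonneg (d : ℝ), mul_nonneg (by linarith : (0 : ℝ) ≤ d) (sq_nonneg K)]
  · have hU := isUnit_dirOp (n := n) hc hB hd hl0
    -- the boundary layer has width of order one wavelength; `2 d` makes `ρ ≤ 1`
    set ρ := symbNorm p / (2 * d) with hρ
    have hρ0 : 0 < ρ := by positivity
    have hρ1 : ρ ≤ 1 := by rw [hρ, div_le_one (by positivity)]; exact symbNorm_le hd p
    have hκ0 : 0 ≤ 1 - ρ := by linarith
    have hκ1 : 1 - ρ < 1 := by linarith
    set ζ : Torus d n → ℝ := zeta (1 - ρ) l with hζ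
    set δ := dirSol l B (wave p (ahat p B v)) - mulOp ζ (wave p v) with hδ
    set b := boxNorm d l with hb
    have hb0 : 0 < b := boxNorm_pos d l
    set M := ((l : ℝ) + 1) ^ d with hM
    have hM0 : 0 < M := by positivity
    have hMM : ((l : ℝ) + 1) ^ (d - 1) * (l + 1) = M := by
      rw [hM, ← pow_succ, Nat.sub_add_cancel hd]
    have hMb : M ≤ b := by rw [hM, hb]; unfold boxNorm; gcongr; norm_num
    have hζ0 : ∀ x ∉ innerBox d n l, ζ x = 0 := fun x hx => zeta_eq_zero hx
    have hδp : proj l δ = δ := by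
      rw [hδ, map_sub, proj_dirSol hU]
      congr 1
      rw [proj, mulOp_ind_eq_self]
      intro x hx; simp [hζ0 x hx]
    set w := v - green l p B (ahat p B v) with hw
    set g := ‖mulOp (ind (closedBox d n l))
        (gradC (mulOp (fun x => 1 - ζ x) (wave p v)))‖ with hg
    -- the energy of the wave in the boundary layer
    have hg2 : g ^ 2 * (l + 1) ≤ 12 * d ^ 2 * M * symbNorm p * ‖v‖ ^ 2 := by
      have h1 := norm_grad_cutoff_wave_sq_le hκ0 hκ1 hl p v
      rw [sub_sub_cancel] at h1
      have e : 4 * symbNorm p ^ 2 / ρ + 8 * ρ = (8 * d + 4 / d) * symbNorm p := by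
        rw [hρ]; field_simp; ring
      rw [e] at h1
      have h2 : (d : ℝ) * (8 * d + 4 / d) ≤ 12 * d ^ 2 := by
        have : (d : ℝ) * (8 * d + 4 / d) = 8 * d ^ 2 + 4 := by field_simp
        rw [this]; nlinarith
      calc g ^ 2 * (l + 1) ≤ (((l : ℝ) + 1) ^ (d - 1) * d * ((8 * d + 4 / d) * symbNorm p) *
            ‖v‖ ^ 2) * (l + 1) := by gcongr
        _ = (d * (8 * d + 4 / d)) * (((l : ℝ) + 1) ^ (d - 1) * (l + 1)) * symbNorm p *
            ‖v‖ ^ 2 := by ring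
        _ ≤ _ := by rw [hMM]; gcongr
    have hδg : ‖gradC δ‖ ≤ K * g := norm_gradC_dirSol_sub_le hc hB hΛ hU p v hζ0
    have hδw := norm_inner_wave_le hc hB hΛ hl hp hδp w
    have hgX : g * √M / symbNorm p * √X ≤ 4 * d * b * ‖v‖ := by
      refine le_of_sq_le_sq ?_ (by positivity)
      rw [mul_pow, div_pow, mul_pow, Real.sq_sqrt hM0.le, Real.sq_sqrt hX0.le]
      rw [div_mul_eq_mul_div, div_le_iff₀ (by positivity)]
      calc g ^ 2 * M * X = g ^ 2 * l * (M * symbNorm p) := by rw [hX]; ring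
        _ ≤ g ^ 2 * (l + 1) * (M * symbNorm p) := by gcongr; linarith
        _ ≤ 12 * d ^ 2 * M * symbNorm p * ‖v‖ ^ 2 * (M * symbNorm p) := by gcongr
        _ ≤ 16 * d ^ 2 * b * symbNorm p * ‖v‖ ^ 2 * (b * symbNorm p) := by gcongr; norm_num
        _ = _ := by ring
    have hpair : b⁻¹ * ‖(inner ℂ δ (wave p w) : ℂ)‖ * √X ≤ 4 * d * K ^ 2 * ‖v‖ * ‖w‖ := by
      calc _ ≤ b⁻¹ * (K * (K * g * √M / symbNorm p) * ‖w‖) * √X := by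
            gcongr
            exact hδw.trans (by gcongr)
        _ = b⁻¹ * K ^ 2 * ‖w‖ * (g * √M / symbNorm p * √X) := by ring
        _ ≤ b⁻¹ * K ^ 2 * ‖w‖ * (4 * d * b * ‖v‖) := by gcongr
        _ = _ := by field_simp
    -- the mass missing from the cutoff
    set m := b⁻¹ * ∑ x, ζ x with hm
    have hm1 : m ≤ 1 := by
      rw [hm, inv_mul_le_iff₀ hb0, mul_one]
      exact (sum_zeta_le hκ0 hκ1.le hl).trans hMb
    have hm2 : (1 - m) * X ≤ 6 * d ^ 2 := by
      have h1 := le_sum_zeta (d := d) (n := n) hκ0 hκ1 hl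
      rw [sub_sub_cancel] at h1
      have h2 := pow_add_two_sub_le d l
      have e : (1 - m) = b⁻¹ * (b - ∑ x, ζ x) := by rw [hm]; field_simp
      have h3 : d * ((l : ℝ) + 1) ^ (d - 1) * (2 / ρ) * X ≤ 4 * d ^ 2 * b := by
        have : d * ((l : ℝ) + 1) ^ (d - 1) * (2 / ρ) * X =
            4 * d ^ 2 * (((l : ℝ) + 1) ^ (d - 1) * l) := by
          rw [hρ, hX]; field_simp; ring
        rw [this]
        have h4 : ((l : ℝ) + 1) ^ (d - 1) * l ≤ ((l : ℝ) + 1) ^ (d - 1) * (l + 1) := by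
          gcongr; linarith
        rw [hMM] at h4
        gcongr
        linarith
      have h5 : d * b / (l + 2) * X ≤ 2 * d ^ 2 * b := by
        have h6 : X ≤ (l + 2) * (2 * d) := by
          rw [hX]
          have := symbNorm_le hd p
          gcongr
          linarith
        calc d * b / (l + 2) * X ≤ d * b / (l + 2) * ((l + 2) * (2 * d)) := by gcongr
          _ = _ := by field_simp
      have h7 : b - ∑ x, ζ x ≤
          d * b / (l + 2) + d * ((l : ℝ) + 1) ^ (d - 1) * (2 / ρ) := by
        have e3 : b = ((l : ℝ) + 2) ^ d := rfl
        rw [← e3] at h2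
        linarith
      rw [e, mul_assoc, inv_mul_le_iff₀ hb0]
      calc (b - ∑ x, ζ x) * X ≤
            (d * b / (l + 2) + d * ((l : ℝ) + 1) ^ (d - 1) * (2 / ρ)) * X := by gcongr
        _ ≤ _ := by rw [add_mul]; linarith
    have hm3 : (1 - m) * √X ≤ 6 * d ^ 2 := by
      refine le_trans ?_ hm2
      have : √X ≤ X := by
        rw [Real.sqrt_le_iff]; exact ⟨hX0.le, by nlinarith⟩
      have h0 : 0 ≤ 1 - m := by linarith
      gcongr
    -- `|w|²` is the sum of the contribution of the missing mass and the pairing of `δ` with a wave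
    have e1 : (inner ℂ w w : ℂ) = ((1 - m : ℝ) : ℂ) * inner ℂ v w -
        ((b⁻¹ : ℝ) : ℂ) * inner ℂ δ (wave p w) := by
      have h1 : (inner ℂ (mulOp ζ (wave p v)) (wave p w) : ℂ) =
          ((∑ x, ζ x : ℝ) : ℂ) * inner ℂ v w := by
        rw [PiLp.inner_apply]
        push_cast
        rw [Finset.sum_mul]
        refine Finset.sum_congr rfl fun x _ => ?_
        have h2 : (starRingEnd ℂ) (chr p x) * chr p x = 1 := by
          rw [Complex.conj_mul']; simp
        simp only [mulOp_apply, wave_apply, inner_smul_left, inner_smul_right, Complex.conj_ofReal]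
        linear_combination (ζ x : ℂ) * inner ℂ v w * h2
      have h3 : (inner ℂ (dirSol l B (wave p (ahat p B v))) (wave p w) : ℂ) =
          inner ℂ δ (wave p w) + ((∑ x, ζ x : ℝ) : ℂ) * inner ℂ v w := by
        rw [← h1, ← inner_add_left, hδ, sub_add_cancel]
      conv_lhs => rw [hw, inner_sub_left, inner_green hU, h3]
      rw [hm, ← hb]
      push_cast
      ring
    have h1 : ‖w‖ ^ 2 ≤ (1 - m) * (‖v‖ * ‖w‖) + b⁻¹ * ‖(inner ℂ δ (wave p w) : ℂ)‖ := by
      have h2 : ‖(inner ℂ w w : ℂ)‖ = ‖w‖ ^ 2 := by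
        rw [inner_self_eq_norm_sq_to_K]; simp
      rw [← h2, e1]
      refine (norm_sub_le _ _).trans ?_
      rw [norm_mul, norm_mul, Complex.norm_real, Complex.norm_real, Real.norm_eq_abs,
        Real.norm_eq_abs, abs_of_nonneg (by linarith : 0 ≤ 1 - m),
        abs_of_pos (by positivity : 0 < b⁻¹)]
      have h3 : ‖(inner ℂ v w : ℂ)‖ ≤ ‖v‖ * ‖w‖ := norm_inner_le_norm _ _
      have h4 : 0 ≤ 1 - m := by linarith
      gcongr
    refine mul_le_of_sq_le_add (norm_nonneg w) (norm_nonneg v) (Real.sqrt_nonneg X) h1 hm3 hpair ?_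
    unfold decayConst
    constructor
    · linarith
    · positivity

end Decay

/-! ### The symbols of the decomposition -/

section Symbols

variable {d n : ℕ} [NeZero n]
variable {H : Type*} [NormedAddCommGroup H] [InnerProductSpace ℂ H] [FiniteDimensional ℂ H]

/-- The symbol of the averaged harmonic extension at scale `l`. -/
def harm (l : ℕ) (p : Torus d n) (B : GradH d H →L[ℂ] GradH d H) : H →L[ℂ] H :=
  1 - green l p B * ahat p B

/-- The symbol of the dual of the averaged harmonic extension at scale `l`. -/
def harmDual (l : ℕ) (p : Torus d n) (B : GradH d H →L[ℂ] GradH d H) : H →L[ℂ] H :=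
  1 - ahat p B * green l p B

/-- The product of the averaged harmonic extensions at the scales `L^0, …, L^{j-1}`. -/
def harmProd (L : ℕ) (p : Torus d n) (B : GradH d H →L[ℂ] GradH d H) : ℕ → H →L[ℂ] H
  | 0 => 1
  | j + 1 => harmProd L p B j * harm (L ^ j) p B

/-- The dual of `harmProd`, with the factors in reverse order. -/
def harmProdDual (L : ℕ) (p : Torus d n) (B : GradH d H →L[ℂ] GradH d H) : ℕ → H →L[ℂ] H
  | 0 => 1
  | j + 1 => harmDual (L ^ j) p B * harmProdDual L p B j

/-- The factor in the middle of a symbol: `Â⁻¹ - R Â⁻¹ R' = 2 Ĝ - Ĝ Â Ĝ` at the scale `L^j` for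
`j < N`, with `R = 1 - Ĝ Â` and `R' = 1 - Â Ĝ`, and `Â⁻¹` for the last scale. -/
def midSymb (L N : ℕ) (p : Torus d n) (B : GradH d H →L[ℂ] GradH d H) (j : ℕ) : H →L[ℂ] H :=
  if j < N then green (L ^ j) p B + green (L ^ j) p B -
    green (L ^ j) p B * ahat p B * green (L ^ j) p B
  else Ring.inverse (ahat p B)

/-- The symbol of the `j`-th operator of the decomposition, `j = 0, …, N`. -/
def covSymb (L N : ℕ) (p : Torus d n) (B : GradH d H →L[ℂ] GradH d H) (j : ℕ) : H →L[ℂ] H :=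
  harmProd L p B j * midSymb L N p B j * harmProdDual L p B j

/-- The sum telescopes: with the products `S_j`, `S_j'` of the averaged harmonic extensions, the
`j`-th symbol is `S_j Â⁻¹ S_j' - S_{j+1} Â⁻¹ S_{j+1}'` for `j < N`, and `S_N Â⁻¹ S_N'` for
`j = N`. -/
theorem sum_covSymb (L N : ℕ) {p : Torus d n} {B : GradH d H →L[ℂ] GradH d H}
    (hU : IsUnit (ahat p B)) :
    ∑ j ∈ Finset.range (N + 1), covSymb L N p B j = Ring.inverse (ahat p B) := by
  have key : ∀ M ≤ N, ∑ j ∈ Finset.range M, covSymb L N p B j =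
      Ring.inverse (ahat p B) -
        harmProd L p B M * Ring.inverse (ahat p B) * harmProdDual L p B M := by
    intro M
    induction M with
    | zero => intro _; simp [harmProd, harmProdDual]
    | succ M ih =>
      intro hM
      rw [Finset.sum_range_succ, ih (by omega), covSymb, midSymb, if_pos (by omega), harmProd,
        harmProdDual, harm, harmDual]
      have h1 : ahat p B * Ring.inverse (ahat p B) = 1 := Ring.mul_inverse_cancel _ hU
      have h2 : Ring.inverse (ahat p B) * ahat p B = 1 := Ring.inverse_mul_cancel _ hU
      generalize Ring.inverse (ahat p B) = X at *
      generalize ahat p B = Y at *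
      generalize green (L ^ M) p B = G at *
      have h3 : (1 - G * Y) * X * (1 - Y * G) = X - (G + G - G * Y * G) := by
        calc (1 - G * Y) * X * (1 - Y * G)
            = X - (X * Y) * G - G * (Y * X) + G * (Y * X) * Y * G := by noncomm_ring
          _ = _ := by rw [h1, h2]; noncomm_ring
      calc _ = X - harmProd L p B M * (X - (G + G - G * Y * G)) * harmProdDual L p B M := by
            noncomm_ring
        _ = _ := by rw [← h3]; simp only [mul_assoc]
  rw [Finset.sum_range_succ, key N le_rfl, covSymb, midSymb, if_neg (lt_irrefl N)]
  abel

theorem adjoint_mul (S T : H →L[ℂ] H) :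
    ContinuousLinearMap.adjoint (S * T) =
      ContinuousLinearMap.adjoint T * ContinuousLinearMap.adjoint S := by
  simp only [← ContinuousLinearMap.star_eq_adjoint, star_mul]

theorem adjoint_harm (l : ℕ) (p : Torus d n) (B : GradH d H →L[ℂ] GradH d H) :
    ContinuousLinearMap.adjoint (harm l p B) =
      harmDual l p (ContinuousLinearMap.adjoint B) := by
  rw [harm, harmDual, map_sub, adjoint_mul, adjoint_green, adjoint_ahat]
  congr 1
  simp only [← ContinuousLinearMap.star_eq_adjoint, star_one]

/-! ### Norm bounds for the symbols -/

/-- The factor bounding the averaged harmonic extension with `z = l |q|`. -/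
def harmBound (d : ℕ) (K z : ℝ) : ℝ := min (1 + K * z ^ 2) (decayConst d K / √z)

theorem harmBound_nonneg {K z : ℝ} (hK : 0 ≤ K) : 0 ≤ harmBound d K z := by
  unfold harmBound decayConst
  positivity

theorem norm_harm_le {l : ℕ} {c Λ : ℝ} (hc : 0 < c) {B : GradH d H →L[ℂ] GradH d H}
    (hB : Coercive c B) (hΛ : ‖B‖ ≤ Λ) (hd : 1 ≤ d) (hl : l < n) (hl0 : 1 ≤ l)
    {p : Torus d n} (hp : p ≠ 0) :
    ‖harm l p B‖ ≤ harmBound d (Λ / c) (l * symbNorm p) := by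
  have hΛ0 : 0 ≤ Λ := (norm_nonneg B).trans hΛ
  have hl1 : (1 : ℝ) ≤ l := by exact_mod_cast hl0
  have hq := symbNorm_pos hp
  refine ContinuousLinearMap.opNorm_le_bound _ (harmBound_nonneg (by positivity)) fun v => ?_
  have e : harm l p B v = v - green l p B (ahat p B v) := rfl
  rw [harmBound, min_mul_of_nonneg _ _ (norm_nonneg v), e]
  refine le_min ?_ ?_
  · have h2 := norm_green_apply_le hc hB hd hl hl0 p (ahat p B v)
    have h3 := norm_ahat_apply_le p B v
    calc _ ≤ ‖v‖ + ‖green l p B (ahat p B v)‖ := norm_sub_le _ _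
      _ ≤ ‖v‖ + l ^ 2 / c * (Λ * symbNorm p ^ 2 * ‖v‖) := by
          gcongr
          refine h2.trans ?_
          gcongr
          exact h3.trans (by gcongr)
      _ = _ := by field_simp
  · have h := norm_sub_green_ahat_mul_sqrt_le hc hB hΛ hd hl hl0 hp v
    rw [div_mul_eq_mul_div, le_div_iff₀ (by positivity)]
    exact h

theorem norm_harmDual_le {l : ℕ} {c Λ : ℝ} (hc : 0 < c) {B : GradH d H →L[ℂ] GradH d H}
    (hB : Coercive c B) (hΛ : ‖B‖ ≤ Λ) (hd : 1 ≤ d) (hl : l < n) (hl0 : 1 ≤ l)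
    {p : Torus d n} (hp : p ≠ 0) :
    ‖harmDual l p B‖ ≤ harmBound d (Λ / c) (l * symbNorm p) := by
  have h := norm_harm_le (Λ := Λ) hc hB.adjoint (by rw [LinearIsometryEquiv.norm_map]; exact hΛ)
    hd hl hl0 hp
  rw [← LinearIsometryEquiv.norm_map ContinuousLinearMap.adjoint, adjoint_harm,
    ContinuousLinearMap.adjoint_adjoint] at h
  exact h

variable {L N : ℕ}

theorem norm_harmProd_le {c Λ : ℝ} (hc : 0 < c) {B : GradH d H →L[ℂ] GradH d H}
    (hB : Coercive c B) (hΛ : ‖B‖ ≤ Λ) (hd : 1 ≤ d) (hL : 2 ≤ L) (hn : n = L ^ N)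
    {p : Torus d n} (hp : p ≠ 0) {j : ℕ} (hj : j ≤ N) :
    ‖harmProd L p B j‖ ≤
        ∏ i ∈ Finset.range j, harmBound d (Λ / c) ((L : ℝ) ^ i * symbNorm p) ∧
      ‖harmProdDual L p B j‖ ≤
        ∏ i ∈ Finset.range j, harmBound d (Λ / c) ((L : ℝ) ^ i * symbNorm p) := by
  have hΛ0 : 0 ≤ Λ := (norm_nonneg B).trans hΛ
  induction j with
  | zero =>
    have h : ‖(1 : H →L[ℂ] H)‖ ≤ 1 := ContinuousLinearMap.norm_id_le
    simpa [harmProd, harmProdDual] using h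
  | succ j ih =>
    obtain ⟨h1, h2⟩ := ih (by omega)
    have hl : L ^ j < n := by rw [hn]; exact Nat.pow_lt_pow_right (by omega) (by omega)
    have hl0 : 1 ≤ L ^ j := Nat.one_le_pow _ _ (by omega)
    have h3 := norm_harm_le hc hB hΛ hd hl hl0 hp
    have h4 := norm_harmDual_le hc hB hΛ hd hl hl0 hp
    push_cast at h3 h4
    have h5 : 0 ≤ ∏ i ∈ Finset.range j, harmBound d (Λ / c) ((L : ℝ) ^ i * symbNorm p) :=
      Finset.prod_nonneg fun _ _ => harmBound_nonneg (by positivity)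
    rw [Finset.prod_range_succ, harmProd, harmProdDual]
    constructor
    · exact (norm_mul_le _ _).trans (mul_le_mul h1 h3 (norm_nonneg _) h5)
    · rw [mul_comm]
      exact (norm_mul_le _ _).trans (mul_le_mul h4 h2 (norm_nonneg _)
        (harmBound_nonneg (by positivity)))

theorem le_decayConst {K : ℝ} : K + 1 ≤ decayConst d K := by
  unfold decayConst
  have : 0 ≤ 6 * (d : ℝ) ^ 2 + 4 * d * K ^ 2 := by positivity
  linarith

theorem decayConst_pos {K : ℝ} (hK : 0 ≤ K) : 0 < decayConst d K := by
  unfold decayConst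
  positivity

/-- The factor in the middle is of order `L^{2j}`. At the last scale `Â⁻¹` is of this order because
`|q| ≥ 1 / n = L^{-N}` for nonzero frequencies. -/
theorem norm_midSymb_le {c Λ : ℝ} (hc : 0 < c) {B : GradH d H →L[ℂ] GradH d H}
    (hB : Coercive c B) (hΛ : ‖B‖ ≤ Λ) (hd : 1 ≤ d) (hL : 2 ≤ L) (hn : n = L ^ N)
    {p : Torus d n} (hp : p ≠ 0) {j : ℕ} (hj : j ≤ N) :
    ‖midSymb L N p B j‖ ≤ (4 + decayConst d (Λ / c)) / c * ((L : ℝ) ^ j) ^ 2 := by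
  have hΛ0 : 0 ≤ Λ := (norm_nonneg B).trans hΛ
  have hL0 : (0 : ℝ) < L := by exact_mod_cast (by omega : 0 < L)
  have hK : 0 ≤ Λ / c := by positivity
  have hD := le_decayConst (d := d) (K := Λ / c)
  have hD0 := decayConst_pos (d := d) hK
  have hq := symbNorm_pos hp
  rw [midSymb]
  split_ifs with h
  · have hl : L ^ j < n := by rw [hn]; exact Nat.pow_lt_pow_right (by omega) h
    have hl0 : 1 ≤ L ^ j := Nat.one_le_pow _ _ (by omega)
    have hG : ‖green (L ^ j) p B‖ ≤ ((L : ℝ) ^ j) ^ 2 / c := by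
      refine ContinuousLinearMap.opNorm_le_bound _ (by positivity) fun v => ?_
      have := norm_green_apply_le hc hB hd hl hl0 p v
      push_cast at this
      exact this
    have hR : ‖harm (L ^ j) p B‖ ≤ 1 + decayConst d (Λ / c) := by
      refine (norm_harm_le hc hB hΛ hd hl hl0 hp).trans ?_
      set z := ((L ^ j : ℕ) : ℝ) * symbNorm p with hz
      have hz0 : 0 ≤ z := by positivity
      rcases le_or_gt z 1 with h1 | h1
      · refine (min_le_left _ _).trans ?_
        have : z ^ 2 ≤ 1 := pow_le_one₀ hz0 h1
        nlinarith
      · refine (min_le_right _ _).trans ?_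
        have : 1 ≤ √z := Real.one_le_sqrt.2 h1.le
        have := div_le_self (by linarith : 0 ≤ decayConst d (Λ / c)) this
        linarith
    have hGA : ‖green (L ^ j) p B * ahat p B‖ ≤ 2 + decayConst d (Λ / c) := by
      have e : green (L ^ j) p B * ahat p B = 1 - harm (L ^ j) p B := by rw [harm]; abel
      rw [e]
      have : ‖(1 : H →L[ℂ] H)‖ ≤ 1 := ContinuousLinearMap.norm_id_le
      exact (norm_sub_le _ _).trans (by linarith)
    calc _ ≤ ‖green (L ^ j) p B‖ + ‖green (L ^ j) p B‖ +
          ‖green (L ^ j) p B * ahat p B‖ * ‖green (L ^ j) p B‖ :=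
          (norm_sub_le _ _).trans (add_le_add (norm_add_le _ _) (norm_mul_le _ _))
      _ ≤ ((L : ℝ) ^ j) ^ 2 / c + ((L : ℝ) ^ j) ^ 2 / c +
          (2 + decayConst d (Λ / c)) * (((L : ℝ) ^ j) ^ 2 / c) := by
          gcongr
      _ = _ := by ring
  · have hjN : j = N := by omega
    refine ContinuousLinearMap.opNorm_le_bound _ (by positivity) fun v => ?_
    refine (norm_ahat_inverse_apply_le hp hc hB v).trans ?_
    gcongr
    have h1 := le_symbNorm hp
    have h2 : (n : ℝ) = (L : ℝ) ^ j := by rw [hn, hjN]; push_cast; rfl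
    rw [h2, div_le_iff₀ (by positivity)] at h1
    rw [inv_le_iff_one_le_mul₀ (by positivity)]
    have h3 : (1 : ℝ) ≤ (symbNorm p * (L : ℝ) ^ j) ^ 2 := one_le_pow₀ h1
    have e : (4 + decayConst d (Λ / c)) / c * ((L : ℝ) ^ j) ^ 2 * (c * symbNorm p ^ 2) =
        (4 + decayConst d (Λ / c)) * (symbNorm p * (L : ℝ) ^ j) ^ 2 := by field_simp
    rw [e]
    nlinarith

/-- The constant in `norm_covSymb_mul_pow_le`. -/
def symbConst (d : ℕ) (c K : ℝ) (M : ℕ) : ℝ :=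
  (4 + decayConst d K) / c *
    (Real.exp (decayConst d K * (2 * (decayConst d K ^ 2) ^ 2)) *
      (2 * (1 + 2 * d) * decayConst d K ^ 2) ^ M) ^ 2

/-- The decay of the symbols: `|Ĉ_j(p)| ≤ C L^{2j} L^{4M²} (1 + L^j |q|)^{-2M}`. -/
theorem norm_covSymb_mul_pow_le {c Λ : ℝ} (hc : 0 < c) {B : GradH d H →L[ℂ] GradH d H}
    (hB : Coercive c B) (hΛ : ‖B‖ ≤ Λ) (hd : 1 ≤ d) (hL : 2 ≤ L) (hn : n = L ^ N)
    {p : Torus d n} (hp : p ≠ 0) {j : ℕ} (hj : j ≤ N) (M : ℕ) :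
    ‖covSymb L N p B j‖ * ((1 + (L : ℝ) ^ j * symbNorm p) ^ M) ^ 2 ≤
      symbConst d c (Λ / c) M * ((L : ℝ) ^ j) ^ 2 * ((L : ℝ) ^ (2 * M * M)) ^ 2 := by
  have hΛ0 : 0 ≤ Λ := (norm_nonneg B).trans hΛ
  have hK : 0 ≤ Λ / c := by positivity
  have hD := le_decayConst (d := d) (K := Λ / c)
  have hD0 := decayConst_pos (d := d) hK
  have hq := symbNorm_pos hp
  have hL2 : (2 : ℝ) ≤ L := by exact_mod_cast hL
  obtain ⟨h1, h2⟩ := norm_harmProd_le hc hB hΛ hd hL hn hp hj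
  have h3 := norm_midSymb_le hc hB hΛ hd hL hn hp hj
  have h4 := prod_mul_pow_le (C := decayConst d (Λ / c)) (X := 2 * d) (by linarith)
    (by positivity) hL2 hq (symbNorm_le hd p)
    (r := fun i => harmBound d (Λ / c) ((L : ℝ) ^ i * symbNorm p)) j
    (fun i => harmBound_nonneg hK) (fun i => by
      refine (min_le_left _ _).trans ?_
      gcongr; linarith) (fun i => by
      have h0 : 0 < √((L : ℝ) ^ i * symbNorm p) := Real.sqrt_pos.2 (by positivity)
      rw [← le_div_iff₀ h0]
      exact min_le_right _ _) M
  set P := ∏ i ∈ Finset.range j, harmBound d (Λ / c) ((L : ℝ) ^ i * symbNorm p) with hP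
  have hP0 : 0 ≤ P := Finset.prod_nonneg fun _ _ => harmBound_nonneg hK
  set y := 1 + (L : ℝ) ^ j * symbNorm p with hy
  have hy0 : 0 < y := by positivity
  calc ‖covSymb L N p B j‖ * (y ^ M) ^ 2
      ≤ (P * ((4 + decayConst d (Λ / c)) / c * ((L : ℝ) ^ j) ^ 2) * P) * (y ^ M) ^ 2 := by
        gcongr
        refine (norm_mul_le _ _).trans (mul_le_mul ((norm_mul_le _ _).trans
          (mul_le_mul h1 h3 (norm_nonneg _) hP0)) h2 (norm_nonneg _) ?_)
        positivity
    _ = ((4 + decayConst d (Λ / c)) / c * ((L : ℝ) ^ j) ^ 2) * (P * y ^ M) ^ 2 := by ring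
    _ ≤ ((4 + decayConst d (Λ / c)) / c * ((L : ℝ) ^ j) ^ 2) *
        (Real.exp (decayConst d (Λ / c) * (2 * (decayConst d (Λ / c) ^ 2) ^ 2)) *
          (2 * (1 + 2 * d) * decayConst d (Λ / c) ^ 2) ^ M * (L : ℝ) ^ (2 * M * M)) ^ 2 := by
        gcongr
    _ = _ := by unfold symbConst; ring

/-- The bound for the Fourier sums: with `a = |α|`, the sum of `|q^α| |Ĉ_j(p)|` over the
frequencies is of order `L^{-j(d - 2 + a)}`, up to a power of `L` that depends on `d` and `a`
only. -/
theorem sum_norm_covSymb_le {c Λ : ℝ} (hc : 0 < c) {B : GradH d H →L[ℂ] GradH d H}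
    (hB : Coercive c B) (hΛ : ‖B‖ ≤ Λ) (hd : 1 ≤ d) (hL : 2 ≤ L) (hn : n = L ^ N)
    {j : ℕ} (hj : j ≤ N) (a : ℕ) :
    ((n : ℝ) ^ d)⁻¹ * ∑ p ∈ (Finset.univ : Finset (Torus d n)).erase 0,
        symbNorm p ^ a * ‖covSymb L N p B j‖ ≤
      2 ^ d * symbConst d c (Λ / c) (a + d) * ((L : ℝ) ^ (2 * (a + d) * (a + d))) ^ 2 *
        ((L : ℝ) ^ j) ^ 2 * (((L : ℝ) ^ j) ^ (a + d))⁻¹ := by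
  have hΛ0 : 0 ≤ Λ := (norm_nonneg B).trans hΛ
  have hK : 0 ≤ Λ / c := by positivity
  have hD := le_decayConst (d := d) (K := Λ / c)
  have hD0 := decayConst_pos (d := d) hK
  have hL0 : (0 : ℝ) < L := by exact_mod_cast (by omega : 0 < L)
  have hS : 0 ≤ symbConst d c (Λ / c) (a + d) := by unfold symbConst; positivity
  set lam := (L : ℝ) ^ j with hlam
  have hlam0 : 0 < lam := by positivity
  set E := symbConst d c (Λ / c) (a + d) * lam ^ 2 *
    ((L : ℝ) ^ (2 * (a + d) * (a + d))) ^ 2 with hE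
  have hE0 : 0 ≤ E := by positivity
  have key : ∀ p ∈ (Finset.univ : Finset (Torus d n)).erase 0,
      symbNorm p ^ a * ‖covSymb L N p B j‖ ≤
        E * (lam ^ a)⁻¹ * ((1 + (lam * symbNorm p) ^ 2) ^ d)⁻¹ := by
    intro p hp
    have hp0 : p ≠ 0 := Finset.ne_of_mem_erase hp
    have hq := symbNorm_pos hp0
    have h1 := norm_covSymb_mul_pow_le hc hB hΛ hd hL hn hp0 hj (a + d)
    rw [← hlam, ← hE] at h1
    set z := lam * symbNorm p with hz
    have hz0 : 0 < z := by positivity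
    have h2 : z ^ a * (1 + z ^ 2) ^ d ≤ ((1 + z) ^ (a + d)) ^ 2 := by
      have h3 : z ^ a ≤ ((1 + z) ^ a) ^ 2 := by
        have h4 : z ^ a ≤ (1 + z) ^ a := by gcongr; linarith
        have h5 : 1 ≤ (1 + z) ^ a := one_le_pow₀ (by linarith)
        nlinarith
      have h4 : (1 + z ^ 2) ^ d ≤ ((1 + z) ^ d) ^ 2 := by
        rw [← pow_mul, mul_comm d 2, pow_mul]
        gcongr
        nlinarith
      calc _ ≤ ((1 + z) ^ a) ^ 2 * ((1 + z) ^ d) ^ 2 := by gcongr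
        _ = _ := by rw [pow_add, mul_pow]
    have e : symbNorm p ^ a = z ^ a * (lam ^ a)⁻¹ := by rw [hz, mul_pow]; field_simp
    rw [e, le_mul_inv_iff₀ (by positivity)]
    calc _ = ‖covSymb L N p B j‖ * (z ^ a * (1 + z ^ 2) ^ d) * (lam ^ a)⁻¹ := by ring
      _ ≤ ‖covSymb L N p B j‖ * ((1 + z) ^ (a + d)) ^ 2 * (lam ^ a)⁻¹ := by gcongr
      _ ≤ _ := by gcongr
  have hlamn : lam ≤ n := by
    rw [hn, hlam]; push_cast
    exact pow_le_pow_right₀ (by exact_mod_cast (by omega : 1 ≤ L)) hj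
  calc _ ≤ ((n : ℝ) ^ d)⁻¹ * ∑ p ∈ (Finset.univ : Finset (Torus d n)).erase 0,
        E * (lam ^ a)⁻¹ * ((1 + (lam * symbNorm p) ^ 2) ^ d)⁻¹ := by
        refine mul_le_mul_of_nonneg_left (Finset.sum_le_sum key) (by positivity)
    _ ≤ ((n : ℝ) ^ d)⁻¹ * ∑ p : Torus d n,
        E * (lam ^ a)⁻¹ * ((1 + (lam * symbNorm p) ^ 2) ^ d)⁻¹ := by
        refine mul_le_mul_of_nonneg_left (Finset.sum_le_sum_of_subset_of_nonneg
          (Finset.erase_subset _ _) fun p _ _ => by positivity) (by positivity)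
    _ = E * (lam ^ a)⁻¹ * (((n : ℝ) ^ d)⁻¹ *
          ∑ p : Torus d n, ((1 + (lam * symbNorm p) ^ 2) ^ d)⁻¹) := by
        rw [← Finset.mul_sum]; ring
    _ ≤ E * (lam ^ a)⁻¹ * (2 ^ d * (lam ^ d)⁻¹) := by
        exact mul_le_mul_of_nonneg_left (sum_inv_one_add_symbNorm_le hlam0 hlamn)
          (by positivity)
    _ = _ := by rw [hE, pow_add, mul_inv]; ring

end Symbols

/-! ### Positivity of the symbols -/

section Positivity

variable {d n l : ℕ} [NeZero n]
variable {H : Type*} [NormedAddCommGroup H] [InnerProductSpace ℂ H] [FiniteDimensional ℂ H]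

omit [FiniteDimensional ℂ H] in
theorem re_inner_comm (x y : H) : (inner ℂ x y).re = (inner ℂ y x).re := by
  rw [← inner_conj_symm, Complex.conj_re]

/-- The form of the averaged Green function is the energy of the local solution. -/
theorem boxNorm_mul_re_inner_green {B : GradH d H →L[ℂ] GradH d H}
    (hU : IsUnit (dirOp l B : Field2 d n H →L[ℂ] Field2 d n H)) (p : Torus d n) (v : H) :
    boxNorm d l * (inner ℂ (green l p B v) v).re =
      (inner ℂ (ellip B (dirSol l B (wave p v))) (dirSol l B (wave p v))).re := by
  rw [inner_ellip_dirSol hU _ (proj_dirSol hU _), inner_green hU, re_inner_comm (wave p v)]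
  have e : ((boxNorm d l)⁻¹ : ℂ) = ((((boxNorm d l)⁻¹ : ℝ)) : ℂ) := by push_cast; rfl
  rw [e, Complex.re_ofReal_mul, mul_inv_cancel_left₀ (boxNorm_pos d l).ne']

theorem re_inner_green_pos {c : ℝ} (hc : 0 < c) {B : GradH d H →L[ℂ] GradH d H}
    (hB : Coercive c B) (hd : 1 ≤ d) (hl : l < n) (hl0 : 1 ≤ l) (p : Torus d n) {v : H}
    (hv : v ≠ 0) : 0 < (inner ℂ (green l p B v) v).re := by
  have hU := isUnit_dirOp (n := n) hc hB hd hl0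
  have h1 := boxNorm_mul_re_inner_green hU p v
  have h2 := hB.ellip_proj hc hd hl0 (proj_dirSol hU (wave p v))
  rw [← h1] at h2
  have hl1 : (0 : ℝ) < l := by exact_mod_cast hl0
  have hu : dirSol l B (wave p v) ≠ 0 := by
    intro h0
    have h3 := dirOp_dirSol hU (wave p v)
    rw [h0, map_zero] at h3
    -- evaluate at the point `(1, …, 1)` of the inner box
    have h4 := congrArg (fun u : Field2 d n H => u fun _ => 1) h3
    have hmem : (fun _ => 1 : Torus d n) ∈ innerBox d n l := by
      rw [mem_innerBox]
      intro i
      have : (1 : ZMod n).val = 1 := ZMod.val_one'' (by omega)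
      omega
    have h5 : chr p (fun _ => 1) • v = 0 := by simpa [proj, ind, hmem] using h4.symm
    rcases smul_eq_zero.1 h5 with h6 | h6
    · have := norm_chr p fun _ => 1
      rw [h6] at this; simp at this
    · exact hv h6
  have h3 : 0 < c / l ^ 2 * ‖dirSol l B (wave p v)‖ ^ 2 := by
    have := norm_pos_iff.2 hu
    positivity
  exact pos_of_mul_pos_right (h3.trans_le h2) (boxNorm_pos d l).le

/-- Jensen's inequality for the averaged projection: `Ĝ Â Ĝ ≤ θ Ĝ` with
`θ = ((l + 1) / (l + 2))^d`. The gradient of the average is an average over the closed box, and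
the convexity of the form of `B` gives the factor. -/
theorem re_inner_ahat_green_le {c : ℝ} (hc : 0 < c) {B : GradH d H →L[ℂ] GradH d H}
    (hB : Coercive c B) (hs : ContinuousLinearMap.adjoint B = B) (hd : 1 ≤ d) (hl : l < n)
    (hl0 : 1 ≤ l) (p : Torus d n) (v : H) :
    (inner ℂ (ahat p B (green l p B v)) (green l p B v)).re ≤
      ((l : ℝ) + 1) ^ d / boxNorm d l * (inner ℂ (green l p B v) v).re := by
  have hU := isUnit_dirOp (n := n) hc hB hd hl0
  have h1 := boxNorm_mul_re_inner_green hU p v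
  have hb := boxNorm_pos d l
  set b := boxNorm d l with hbdef
  set M := ((l : ℝ) + 1) ^ d with hM
  have hM0 : 0 < M := by positivity
  set u := dirSol l B (wave p v) with hu
  have hPu : proj l u = u := proj_dirSol hU _
  set w := green l p B v with hw
  set y0 : GradH d H := tens (symb p) w with hy0
  set e := (inner ℂ (B y0) y0).re with he
  set y : Field2 d n (GradH d H) := gradC u with hy
  set z : Field2 d n (GradH d H) := mulOp (ind (closedBox d n l)) (wave p y0) with hz
  have hadj : ContinuousLinearMap.adjoint (wave p) y = (b : ℂ) • y0 := by
    rw [hy, adjoint_wave_gradC, hy0, ← map_smul]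
    congr 1
    refine ext_inner_right ℂ fun w' => ?_
    rw [ContinuousLinearMap.adjoint_inner_left, inner_smul_left, hw, inner_green hU, ← hu,
      Complex.conj_ofReal, ← hbdef, mul_inv_cancel_left₀ (by exact_mod_cast hb.ne')]
  have hmy : mulOp (ind (closedBox d n l)) y = y := gradC_supported hPu
  have hyz : (inner ℂ (lift B y) z).re = b * e := by
    rw [hz, ← inner_mulOp_left, ← lift_mulOp, hmy, ← ContinuousLinearMap.adjoint_inner_right,
      adjoint_lift, hs, lift_wave, ← ContinuousLinearMap.adjoint_inner_left, hadj,
      inner_smul_left, Complex.conj_ofReal, Complex.re_ofReal_mul, re_inner_comm]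
  have hzy : (inner ℂ (lift B z) y).re = b * e := by
    rw [← ContinuousLinearMap.adjoint_inner_right, adjoint_lift, hs, re_inner_comm, hyz]
  have hzz : (inner ℂ (lift B z) z).re = M * e := by
    have h2 : ∀ x, (inner ℂ (lift B z x) (z x) : ℂ) =
        ((ind (closedBox d n l) x : ℝ) : ℂ) * inner ℂ (B y0) y0 := by
      intro x
      have h3 : (starRingEnd ℂ) (chr p x) * chr p x = 1 := by
        rw [Complex.conj_mul']; simp
      have h4 : ((ind (closedBox d n l) x : ℝ) : ℂ) ^ 2 = (ind (closedBox d n l) x : ℝ) := by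
        rw [← Complex.ofReal_pow, ind_sq]
      rw [hz, lift_mulOp, lift_wave]
      simp only [mulOp_apply, wave_apply, inner_smul_left, inner_smul_right, Complex.conj_ofReal]
      linear_combination ((ind (closedBox d n l) x : ℝ) : ℂ) ^ 2 * inner ℂ (B y0) y0 * h3 +
        inner ℂ (B y0) y0 * h4
    rw [PiLp.inner_apply]
    simp only [h2]
    rw [← Finset.sum_mul, ← Complex.ofReal_sum, sum_ind, card_closedBox hl, Complex.re_ofReal_mul]
    push_cast
    rfl
  have hyy : (inner ℂ (lift B y) y).re = b * (inner ℂ w v).re := by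
    rw [h1, inner_ellip]
  -- expand the form of `B` at `y - t z` with the optimal `t = b / M`
  set t := b / M with ht
  have h0 : 0 ≤ (inner ℂ (lift B (y - (t : ℂ) • z)) (y - (t : ℂ) • z)).re :=
    le_trans (by positivity) (hB.lift (y - (t : ℂ) • z))
  have hexp : (inner ℂ (lift B (y - (t : ℂ) • z)) (y - (t : ℂ) • z)).re =
      b * (inner ℂ w v).re - t * (b * e) - t * (b * e) + t * t * (M * e) := by
    rw [map_sub, map_smul, inner_sub_left, inner_sub_right, inner_sub_right, inner_smul_left,
      inner_smul_left, inner_smul_right, inner_smul_right, Complex.conj_ofReal, Complex.sub_re,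
      Complex.sub_re, Complex.sub_re, Complex.re_ofReal_mul, Complex.re_ofReal_mul,
      Complex.re_ofReal_mul, Complex.re_ofReal_mul, hyz, hzy, hzz, hyy]
    ring
  rw [hexp] at h0
  have h5 : b * (inner ℂ w v).re - t * (b * e) - t * (b * e) + t * t * (M * e) =
      b * ((inner ℂ w v).re - b / M * e) := by rw [ht]; field_simp; ring
  rw [h5] at h0
  have h6 := nonneg_of_mul_nonneg_right h0 hb
  rw [inner_ahat]
  change e ≤ _
  rw [sub_nonneg, div_mul_eq_mul_div, div_le_iff₀ hM0] at h6
  rw [div_mul_eq_mul_div, le_div_iff₀ hb]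
  linarith

/-- The averaged projections are strict contractions in the energy norm; together with the symmetry
of `B` this makes `2 Ĝ - Ĝ Â Ĝ` positive definite. -/
theorem re_inner_ahat_green_lt {c : ℝ} (hc : 0 < c) {B : GradH d H →L[ℂ] GradH d H}
    (hB : Coercive c B) (hs : ContinuousLinearMap.adjoint B = B) (hd : 1 ≤ d) (hl : l < n)
    (hl0 : 1 ≤ l) (p : Torus d n) {v : H} (hv : v ≠ 0) :
    (inner ℂ (ahat p B (green l p B v)) (green l p B v)).re <
      (inner ℂ (green l p B v) v).re := by
  refine (re_inner_ahat_green_le hc hB hs hd hl hl0 p v).trans_lt ?_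
  refine mul_lt_of_lt_one_left (re_inner_green_pos hc hB hd hl hl0 p hv) ?_
  rw [div_lt_one (boxNorm_pos d l), boxNorm]
  exact pow_lt_pow_left₀ (by linarith) (by positivity) (by omega)

theorem harmDual_apply_ne_zero {c : ℝ} (hc : 0 < c) {B : GradH d H →L[ℂ] GradH d H}
    (hB : Coercive c B) (hs : ContinuousLinearMap.adjoint B = B) (hd : 1 ≤ d) (hl : l < n)
    (hl0 : 1 ≤ l) (p : Torus d n) {v : H} (hv : v ≠ 0) : harmDual l p B v ≠ 0 := by
  intro h
  have h1 : ahat p B (green l p B v) = v := by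
    have : harmDual l p B v = v - ahat p B (green l p B v) := rfl
    rw [this, sub_eq_zero] at h
    exact h.symm
  have h2 := re_inner_ahat_green_lt hc hB hs hd hl hl0 p hv
  rw [h1, re_inner_comm] at h2
  exact lt_irrefl _ h2

variable {L N : ℕ}

theorem adjoint_harmProd (p : Torus d n) {B : GradH d H →L[ℂ] GradH d H}
    (hs : ContinuousLinearMap.adjoint B = B) (j : ℕ) :
    ContinuousLinearMap.adjoint (harmProd L p B j) = harmProdDual L p B j := by
  induction j with
  | zero =>
    rw [harmProd, harmProdDual, ← ContinuousLinearMap.star_eq_adjoint, star_one]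
  | succ j ih => rw [harmProd, harmProdDual, adjoint_mul, adjoint_harm, hs, ih]

theorem adjoint_harmProdDual (p : Torus d n) {B : GradH d H →L[ℂ] GradH d H}
    (hs : ContinuousLinearMap.adjoint B = B) (j : ℕ) :
    ContinuousLinearMap.adjoint (harmProdDual L p B j) = harmProd L p B j := by
  rw [← adjoint_harmProd p hs, ContinuousLinearMap.adjoint_adjoint]

theorem adjoint_midSymb (p : Torus d n) {B : GradH d H →L[ℂ] GradH d H}
    (hs : ContinuousLinearMap.adjoint B = B) (j : ℕ) :
    ContinuousLinearMap.adjoint (midSymb L N p B j) = midSymb L N p B j := by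
  rw [midSymb]
  split_ifs
  · rw [map_sub, map_add, adjoint_mul, adjoint_mul, adjoint_green, adjoint_ahat, hs, mul_assoc]
  · rw [← ContinuousLinearMap.star_eq_adjoint]
    refine (Ring.inverse_star _).symm.trans ?_
    rw [ContinuousLinearMap.star_eq_adjoint, adjoint_ahat, hs]

theorem adjoint_covSymb (p : Torus d n) {B : GradH d H →L[ℂ] GradH d H}
    (hs : ContinuousLinearMap.adjoint B = B) (j : ℕ) :
    ContinuousLinearMap.adjoint (covSymb L N p B j) = covSymb L N p B j := by
  rw [covSymb, adjoint_mul, adjoint_mul, adjoint_harmProd p hs, adjoint_harmProdDual p hs,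
    adjoint_midSymb p hs, mul_assoc]

/-- The symbols are positive definite: they are congruent, by the injective product of the dual
harmonic extensions, to their positive definite factors in the middle. -/
theorem re_inner_covSymb_pos {c : ℝ} (hc : 0 < c) {B : GradH d H →L[ℂ] GradH d H}
    (hB : Coercive c B) (hs : ContinuousLinearMap.adjoint B = B) (hd : 1 ≤ d) (hL : 2 ≤ L)
    (hn : n = L ^ N) {p : Torus d n} (hp : p ≠ 0) {j : ℕ} (hj : j ≤ N) {v : H} (hv : v ≠ 0) :
    0 < (inner ℂ (covSymb L N p B j v) v).re := by
  have hl : ∀ i < N, L ^ i < n := fun i hi => by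
    rw [hn]; exact Nat.pow_lt_pow_right (by omega) hi
  have hl0 : ∀ i, 1 ≤ L ^ i := fun i => Nat.one_le_pow _ _ (by omega)
  have h1 : ∀ i ≤ N, harmProdDual L p B i v ≠ 0 := by
    intro i
    induction i with
    | zero => intro _; exact hv
    | succ i ih =>
      intro hi
      exact harmDual_apply_ne_zero hc hB hs hd (hl i (by omega)) (hl0 i) p (ih (by omega))
  have h2 : (inner ℂ (covSymb L N p B j v) v : ℂ) =
      inner ℂ (midSymb L N p B j (harmProdDual L p B j v)) (harmProdDual L p B j v) := by
    conv_rhs => rw [← adjoint_harmProd p hs, ContinuousLinearMap.adjoint_inner_right]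
    rw [adjoint_harmProd p hs]; rfl
  rw [h2]
  have hw := h1 j hj
  generalize harmProdDual L p B j v = w at hw
  rw [midSymb]
  split_ifs with h
  · have e : (green (L ^ j) p B + green (L ^ j) p B -
        green (L ^ j) p B * ahat p B * green (L ^ j) p B) w =
        green (L ^ j) p B w + green (L ^ j) p B w -
          green (L ^ j) p B (ahat p B (green (L ^ j) p B w)) := rfl
    have e2 : (inner ℂ (green (L ^ j) p B (ahat p B (green (L ^ j) p B w))) w : ℂ) =
        inner ℂ (ahat p B (green (L ^ j) p B w)) (green (L ^ j) p B w) := by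
      rw [← ContinuousLinearMap.adjoint_inner_right, adjoint_green, hs]
    rw [e, inner_sub_left, inner_add_left, e2, Complex.sub_re, Complex.add_re]
    have h3 := re_inner_green_pos hc hB hd (hl j h) (hl0 j) p hw
    have h4 := re_inner_ahat_green_lt hc hB hs hd (hl j h) (hl0 j) p hw
    linarith
  · have h3 := ahat_inverse_apply hp hc hB w
    set w' := Ring.inverse (ahat p B) w with hw'
    have hw0 : w' ≠ 0 := by
      intro h0; rw [h0, map_zero] at h3; exact hw h3.symm
    have h4 := hB.ahat p w'
    rw [h3, re_inner_comm] at h4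
    refine lt_of_lt_of_le ?_ h4
    have := symbNorm_pos hp
    have := norm_pos_iff.2 hw0
    positivity

end Positivity

/-! ### Analyticity of the symbols -/

section Analyticity

variable {d n l : ℕ} [NeZero n]
variable {H : Type*} [NormedAddCommGroup H] [InnerProductSpace ℂ H] [FiniteDimensional ℂ H]

theorem analyticAt_of_linear {E F : Type*} [NormedAddCommGroup E] [NormedSpace ℂ E]
    [FiniteDimensional ℂ E] [NormedAddCommGroup F] [NormedSpace ℂ F] (f : E →ₗ[ℂ] F) (x : E) :
    AnalyticAt ℂ f x :=
  (LinearMap.toContinuousLinearMap f).analyticAt x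

theorem analyticAt_ahat (p : Torus d n) (B : GradH d H →L[ℂ] GradH d H) :
    AnalyticAt ℂ (ahat p : (GradH d H →L[ℂ] GradH d H) → (H →L[ℂ] H)) B :=
  analyticAt_of_linear
    { toFun := ahat p
      map_add' := fun B B' => by simp [ahat]
      map_smul' := fun c B => by simp [ahat] } B

theorem analyticAt_dirOp (B : GradH d H →L[ℂ] GradH d H) :
    AnalyticAt ℂ (dirOp l : (GradH d H →L[ℂ] GradH d H) →
      (Field2 d n H →L[ℂ] Field2 d n H)) B := by
  have h := analyticAt_of_linear (E := GradH d H →L[ℂ] GradH d H)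
    (F := Field2 d n H →L[ℂ] Field2 d n H)
    { toFun := fun B => proj l * ellip B * proj l
      map_add' := fun B B' => by
        simp [ellip, mul_add, add_mul]
      map_smul' := fun c B => by simp [ellip, mul_smul_comm, smul_mul_assoc] } B
  exact h.add analyticAt_const

theorem analyticAt_green {B : GradH d H →L[ℂ] GradH d H} (p : Torus d n)
    (hU : IsUnit (dirOp l B : Field2 d n H →L[ℂ] Field2 d n H)) :
    AnalyticAt ℂ (green l p : (GradH d H →L[ℂ] GradH d H) → (H →L[ℂ] H)) B := by
  have h1 : AnalyticAt ℂ (fun B : GradH d H →L[ℂ] GradH d H =>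
      Ring.inverse (dirOp l B : Field2 d n H →L[ℂ] Field2 d n H)) B :=
    (analyticOnNhd_inverse _ hU).comp (analyticAt_dirOp B)
  have h2 := analyticAt_of_linear (E := Field2 d n H →L[ℂ] Field2 d n H) (F := H →L[ℂ] H)
    { toFun := fun S => ((boxNorm d l)⁻¹ : ℂ) • (ContinuousLinearMap.adjoint (wave p) ∘L proj l ∘L
        S ∘L proj l ∘L wave p)
      map_add' := fun S S' => by simp
      map_smul' := fun c S => by simp only [ContinuousLinearMap.comp_smul,
        ContinuousLinearMap.smul_comp, RingHom.id_apply]; rw [smul_comm] }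
    (Ring.inverse (dirOp l B : Field2 d n H →L[ℂ] Field2 d n H))
  exact h2.comp_of_eq h1 rfl

/-- The symbols are analytic at every coercive operator. -/
theorem analyticAt_covSymb {L N : ℕ} {c : ℝ} (hc : 0 < c) {B : GradH d H →L[ℂ] GradH d H}
    (hB : Coercive c B) (hd : 1 ≤ d) (hL : 2 ≤ L) {p : Torus d n} (hp : p ≠ 0) (j : ℕ) :
    AnalyticAt ℂ (fun B => covSymb L N p B j : (GradH d H →L[ℂ] GradH d H) → (H →L[ℂ] H)) B := by
  have hG : ∀ i, AnalyticAt ℂ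
      (green (L ^ i) p : (GradH d H →L[ℂ] GradH d H) → (H →L[ℂ] H)) B := fun i =>
    analyticAt_green p (isUnit_dirOp hc hB hd (Nat.one_le_pow _ _ (by omega)))
  have hA := analyticAt_ahat p B
  have h1 : ∀ i, AnalyticAt ℂ
      (fun B => harmProd L p B i : (GradH d H →L[ℂ] GradH d H) → (H →L[ℂ] H)) B := by
    intro i
    induction i with
    | zero => exact analyticAt_const
    | succ i ih => exact ih.mul (analyticAt_const.sub ((hG i).mul hA))
  have h2 : ∀ i, AnalyticAt ℂ
      (fun B => harmProdDual L p B i : (GradH d H →L[ℂ] GradH d H) → (H →L[ℂ] H)) B := by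
    intro i
    induction i with
    | zero => exact analyticAt_const
    | succ i ih => exact (analyticAt_const.sub (hA.mul (hG i))).mul ih
  have h3 : AnalyticAt ℂ
      (fun B => midSymb L N p B j : (GradH d H →L[ℂ] GradH d H) → (H →L[ℂ] H)) B := by
    simp only [midSymb]
    split_ifs
    · exact ((hG j).add (hG j)).sub (((hG j).mul hA).mul (hG j))
    · have h0 := symbNorm_pos hp
      exact (analyticOnNhd_inverse _ ((hB.ahat p).isUnit (by positivity))).comp hA
  exact ((h1 j).mul h3).mul (h2 j)

end Analyticity

/-! ### Trigonometric polynomials and finite range -/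

section Range

theorem natAbs_valMinAbs_le_val {n : ℕ} [NeZero n] (a : ZMod n) : a.valMinAbs.natAbs ≤ a.val := by
  rw [ZMod.valMinAbs_natAbs_eq_min]; exact min_le_left _ _

theorem natAbs_valMinAbs_natCast_le {n : ℕ} [NeZero n] (k : ℕ) :
    (k : ZMod n).valMinAbs.natAbs ≤ k :=
  (natAbs_valMinAbs_le_val _).trans (by rw [ZMod.val_natCast]; exact Nat.mod_le _ _)

theorem natAbs_valMinAbs_sub_le {n l : ℕ} [NeZero n] {a b : ZMod n} (ha : a.val ≤ l)
    (hb : b.val ≤ l) : (a - b).valMinAbs.natAbs ≤ l := by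
  rcases le_total b.val a.val with h | h
  · have e : a - b = ((a.val - b.val : ℕ) : ZMod n) := by rw [Nat.cast_sub h]; simp
    rw [e]
    exact (natAbs_valMinAbs_natCast_le _).trans (by omega)
  · have e : a - b = -((b.val - a.val : ℕ) : ZMod n) := by rw [Nat.cast_sub h]; simp
    rw [e, ZMod.natAbs_valMinAbs_neg]
    exact (natAbs_valMinAbs_natCast_le _).trans (by omega)

variable {d n : ℕ}

theorem rhoInf_le_iff {x : Torus d n} {r : ℕ} :
    rhoInf x ≤ r ↔ ∀ i, (x i).valMinAbs.natAbs ≤ r := by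
  simp [rhoInf]

theorem rhoInf_add_le (x y : Torus d n) : rhoInf (x + y) ≤ rhoInf x + rhoInf y := by
  rw [rhoInf_le_iff]
  intro i
  have hx := rhoInf_le_iff.1 (le_refl (rhoInf x)) i
  have hy := rhoInf_le_iff.1 (le_refl (rhoInf y)) i
  exact (ZMod.natAbs_valMinAbs_add_le _ _).trans ((Int.natAbs_add_le _ _).trans (by omega))

theorem rhoInf_zero : rhoInf (0 : Torus d n) = 0 := by simp [rhoInf]

theorem rhoInf_neg (x : Torus d n) : rhoInf (-x) = rhoInf x := by
  simp [rhoInf, ZMod.natAbs_valMinAbs_neg]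

variable [NeZero n]

theorem rhoInf_unitVec_le (j : Fin d) : rhoInf (unitVec j : Torus d n) ≤ 1 := by
  rw [rhoInf_le_iff]
  intro i
  by_cases h : i = j
  · subst h
    have := natAbs_valMinAbs_natCast_le (n := n) 1
    simpa [unitVec] using this
  · simp [unitVec, h]

variable {H : Type*} [NormedAddCommGroup H] [InnerProductSpace ℂ H]

/-- An operator-valued function of the frequency is a trigonometric polynomial of range at most
`r`: it is the Fourier transform of a kernel supported in the `ℓ^∞` ball of radius `r`. -/
def TrigRange (r : ℕ) (f : Torus d n → H →L[ℂ] H) : Prop :=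
  ∃ a : Torus d n → H →L[ℂ] H, (∀ x, r < rhoInf x → a x = 0) ∧
    ∀ p, f p = ∑ x, (starRingEnd ℂ) (chr p x) • a x

namespace TrigRange

variable {r s : ℕ} {f g : Torus d n → H →L[ℂ] H}

theorem mono (h : TrigRange r f) (hrs : r ≤ s) : TrigRange s f := by
  obtain ⟨a, ha, hf⟩ := h
  exact ⟨a, fun x hx => ha x (by omega), hf⟩

theorem add (hf : TrigRange r f) (hg : TrigRange r g) : TrigRange r fun p => f p + g p := by
  obtain ⟨a, ha, hf⟩ := hf
  obtain ⟨b, hb, hg⟩ := hg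
  refine ⟨fun x => a x + b x, fun x hx => by simp only [ha x hx, hb x hx, add_zero], fun p => ?_⟩
  simp only [hf, hg, smul_add, Finset.sum_add_distrib]

theorem sub (hf : TrigRange r f) (hg : TrigRange r g) : TrigRange r fun p => f p - g p := by
  obtain ⟨a, ha, hf⟩ := hf
  obtain ⟨b, hb, hg⟩ := hg
  refine ⟨fun x => a x - b x, fun x hx => by simp only [ha x hx, hb x hx, sub_zero], fun p => ?_⟩
  simp only [hf, hg, smul_sub, Finset.sum_sub_distrib]

theorem sum {ι : Type*} (t : Finset ι) {F : ι → Torus d n → H →L[ℂ] H}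
    (h : ∀ i, TrigRange r (F i)) : TrigRange r fun p => ∑ i ∈ t, F i p := by
  choose a ha hF using h
  refine ⟨fun x => ∑ i ∈ t, a i x, fun x hx => Finset.sum_eq_zero fun i _ => ha i x hx,
    fun p => ?_⟩
  simp only [hF, Finset.smul_sum]
  exact Finset.sum_comm

theorem monomial (x : Torus d n) (T : H →L[ℂ] H) :
    TrigRange (rhoInf x) fun p => (starRingEnd ℂ) (chr p x) • T := by
  classical
  refine ⟨fun y => if y = x then T else 0, fun y hy => ?_, fun p => ?_⟩
  · beta_reduce; rw [if_neg]; rintro rfl; exact lt_irrefl _ hy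
  · simp

theorem const (T : H →L[ℂ] H) : TrigRange 0 fun _ : Torus d n => T := by
  have := monomial (n := n) (d := d) 0 T
  simpa [rhoInf_zero] using this

theorem mul (hf : TrigRange r f) (hg : TrigRange s g) :
    TrigRange (r + s) fun p => f p * g p := by
  obtain ⟨a, ha, hf⟩ := hf
  obtain ⟨b, hb, hg⟩ := hg
  refine ⟨fun z => ∑ y, a (z - y) * b y, fun z hz => ?_, fun p => ?_⟩
  · refine Finset.sum_eq_zero fun y _ => ?_
    by_cases h1 : r < rhoInf (z - y)
    · rw [ha _ h1, zero_mul]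
    · have h2 := rhoInf_add_le (z - y) y
      rw [sub_add_cancel] at h2
      rw [hb y (by omega), mul_zero]
  · beta_reduce
    rw [hf, hg, Finset.sum_mul_sum]
    simp only [Finset.smul_sum]
    rw [Finset.sum_comm]
    conv_rhs => rw [Finset.sum_comm]
    refine Finset.sum_congr rfl fun y _ => ?_
    symm
    rw [← Equiv.sum_comp (Equiv.addRight y)]
    refine Finset.sum_congr rfl fun x _ => ?_
    simp only [Equiv.coe_addRight, add_sub_cancel_right, chr_add, map_mul]
    rw [smul_mul_smul_comm]

end TrigRange

variable [FiniteDimensional ℂ H]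

/-- The field that equals `v` at the point `y` and vanishes elsewhere. -/
def pointField (y : Torus d n) : H →L[ℂ] Field2 d n H := mulOp (ind {y}) ∘L wave 0

theorem wave_eq_sum (p : Torus d n) :
    (wave p : H →L[ℂ] Field2 d n H) = ∑ y, chr p y • pointField y := by
  ext v : 1
  apply PiLp.ext; intro x
  simp only [sum_apply, smul_apply, WithLp.ofLp_sum, Finset.sum_apply, PiLp.smul_apply,
    pointField, ContinuousLinearMap.comp_apply, mulOp_apply, wave_apply, chr_zero_left, ind]
  simp

theorem proj_pointField {l : ℕ} {y : Torus d n} (hy : y ∉ innerBox d n l) (v : H) :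
    proj l (pointField y v) = 0 := by
  apply PiLp.ext; intro x
  simp only [proj, pointField, ContinuousLinearMap.comp_apply, mulOp_apply, ind]
  by_cases hx : x = y
  · subst hx; simp [hy]
  · simp [hx]

/-- The averaged Dirichlet Green function has range at most the side of the box. -/
theorem trigRange_green (l : ℕ) (B : GradH d H →L[ℂ] GradH d H) :
    TrigRange l fun p : Torus d n => green l p B := by
  set T : Field2 d n H →L[ℂ] Field2 d n H :=
    proj l ∘L Ring.inverse (dirOp l B) ∘L proj l with hT
  set Mx : Torus d n → Torus d n → H →L[ℂ] H := fun x y =>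
    ContinuousLinearMap.adjoint (pointField x) ∘L T ∘L pointField y with hMx
  have h0 : ∀ x y, ¬ (x ∈ innerBox d n l ∧ y ∈ innerBox d n l) → Mx x y = 0 := by
    intro x y hxy
    ext v : 1
    refine ext_inner_right ℂ fun w => ?_
    have e : (inner ℂ (Mx x y v) w : ℂ) = inner ℂ (Ring.inverse (dirOp l B)
        (proj l (pointField y v))) (proj l (pointField x w)) := by
      simp only [hMx, hT, ContinuousLinearMap.comp_apply]
      rw [ContinuousLinearMap.adjoint_inner_left, inner_proj_left]
    rw [e]
    by_cases hx : x ∈ innerBox d n l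
    · have hy : y ∉ innerBox d n l := fun h => hxy ⟨hx, h⟩
      rw [proj_pointField hy, map_zero]; simp
    · rw [proj_pointField hx]; simp
  refine ⟨fun z => ((boxNorm d l)⁻¹ : ℂ) • ∑ y, Mx (z + y) y, fun z hz => ?_, fun p => ?_⟩
  · beta_reduce
    rw [Finset.sum_eq_zero, smul_zero]
    intro y _
    refine h0 _ _ fun hxy => ?_
    refine absurd hz (not_lt.2 (rhoInf_le_iff.2 fun i => ?_))
    have h1 := natAbs_valMinAbs_sub_le (mem_innerBox.1 hxy.1 i).2 (mem_innerBox.1 hxy.2 i).2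
    simpa using h1
  · have e1 : green l p B = ((boxNorm d l)⁻¹ : ℂ) •
        (ContinuousLinearMap.adjoint (wave p) ∘L T ∘L wave p) := rfl
    have e2 : ContinuousLinearMap.adjoint (wave p) ∘L T ∘L wave p =
        ∑ y, ∑ x, ((starRingEnd ℂ) (chr p x) * chr p y) • Mx x y := by
      conv_lhs => rw [wave_eq_sum]
      rw [map_sum]
      ext v : 1
      simp only [map_smulₛₗ, ContinuousLinearMap.comp_apply, sum_apply, smul_apply, map_sum,
        Finset.smul_sum, hMx, smul_smul, RingHom.id_apply]
      refine Finset.sum_congr rfl fun y _ => Finset.sum_congr rfl fun x _ => ?_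
      rw [mul_comm]
    beta_reduce
    rw [e1, e2, Finset.smul_sum]
    simp only [Finset.smul_sum]
    rw [Finset.sum_comm (s := Finset.univ (α := Torus d n)) (f := fun x y =>
      (starRingEnd ℂ) (chr p x) • ((boxNorm d l)⁻¹ : ℂ) • Mx (x + y) y)]
    refine Finset.sum_congr rfl fun y _ => ?_
    rw [← Equiv.sum_comp (Equiv.addRight y)]
    refine Finset.sum_congr rfl fun x _ => ?_
    have h3 : (starRingEnd ℂ) (chr p y) * chr p y = 1 := by
      rw [Complex.conj_mul']; simp
    simp only [Equiv.coe_addRight, chr_add, map_mul]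
    rw [mul_assoc, h3, mul_one, smul_comm]

theorem tens_symb_eq_sum (p : Torus d n) :
    (tens (symb p) : H →L[ℂ] GradH d H) = ∑ j, symb p j • tens (Pi.single j 1) := by
  ext v : 1
  apply PiLp.ext; intro i
  simp [Pi.single_apply]

omit [FiniteDimensional ℂ H] in
theorem trigRange_conj_symb (i : Fin d) :
    TrigRange 1 fun p : Torus d n => (starRingEnd ℂ) (symb p i) • (1 : H →L[ℂ] H) := by
  have h := ((TrigRange.monomial (unitVec i : Torus d n) (1 : H →L[ℂ] H)).mono
    (rhoInf_unitVec_le i)).sub ((TrigRange.const 1).mono zero_le_one)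
  have e : ∀ p : Torus d n, (starRingEnd ℂ) (chr p (unitVec i)) • (1 : H →L[ℂ] H) - 1 =
      (starRingEnd ℂ) (symb p i) • (1 : H →L[ℂ] H) := by
    intro p; rw [symb, map_sub, map_one, sub_smul, one_smul]
  simpa only [e] using h

omit [FiniteDimensional ℂ H] in
theorem trigRange_symb (j : Fin d) :
    TrigRange 1 fun p : Torus d n => symb p j • (1 : H →L[ℂ] H) := by
  have h := ((TrigRange.monomial (-unitVec j : Torus d n) (1 : H →L[ℂ] H)).mono
    (by rw [rhoInf_neg]; exact rhoInf_unitVec_le j)).sub ((TrigRange.const 1).mono zero_le_one)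
  have e : ∀ p : Torus d n, (starRingEnd ℂ) (chr p (-unitVec j)) • (1 : H →L[ℂ] H) - 1 =
      symb p j • (1 : H →L[ℂ] H) := by
    intro p; rw [symb, chr_neg, Complex.conj_conj, sub_smul, one_smul]
  simpa only [e] using h

theorem ahat_eq_sum (p : Torus d n) (B : GradH d H →L[ℂ] GradH d H) :
    ahat p B = ∑ i, ∑ j, ((starRingEnd ℂ) (symb p i) • (1 : H →L[ℂ] H)) *
      (symb p j • (1 : H →L[ℂ] H)) *
      (ContinuousLinearMap.adjoint (tens (Pi.single i 1)) ∘L B ∘L tens (Pi.single j 1)) := by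
  refine ContinuousLinearMap.ext fun v => ext_inner_right ℂ fun w => ?_
  rw [inner_ahat, tens_symb_eq_sum]
  simp only [sum_apply, smul_apply, map_sum, map_smul, sum_inner, inner_sum, inner_smul_left,
    inner_smul_right, Finset.mul_sum]
  refine Finset.sum_congr rfl fun i _ => Finset.sum_congr rfl fun j _ => ?_
  change _ = inner ℂ ((starRingEnd ℂ) (symb p i) • symb p j •
    ContinuousLinearMap.adjoint (tens (Pi.single i 1)) (B (tens (Pi.single j 1) v))) w
  rw [inner_smul_left, inner_smul_left, ContinuousLinearMap.adjoint_inner_left,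
    Complex.conj_conj]

/-- The elliptic operator has range `2`: one for the gradient and one for its adjoint. -/
theorem trigRange_ahat (B : GradH d H →L[ℂ] GradH d H) :
    TrigRange 2 fun p : Torus d n => ahat p B := by
  simp only [ahat_eq_sum]
  exact TrigRange.sum _ fun i => TrigRange.sum _ fun j =>
    (((trigRange_conj_symb i).mul (trigRange_symb j)).mul (TrigRange.const _)).mono le_rfl

/-- The symbols except the last one are trigonometric polynomials: their kernels have finite
range. -/
theorem trigRange_covSymb (L N : ℕ) (B : GradH d H →L[ℂ] GradH d H) {j : ℕ} (hj : j < N) :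
    TrigRange (2 * ∑ i ∈ Finset.range (j + 1), (L ^ i + 2))
      fun p : Torus d n => covSymb L N p B j := by
  have hA := trigRange_ahat (d := d) (n := n) B
  have hG := fun i => trigRange_green (d := d) (n := n) (L ^ i) B
  have h1 : ∀ i, TrigRange (∑ i ∈ Finset.range i, (L ^ i + 2))
      fun p : Torus d n => harmProd L p B i := by
    intro i
    induction i with
    | zero => exact TrigRange.const 1
    | succ i ih =>
      rw [Finset.sum_range_succ]
      exact ih.mul (((TrigRange.const 1).mono (Nat.zero_le _)).sub ((hG i).mul hA))
  have h2 : ∀ i, TrigRange (∑ i ∈ Finset.range i, (L ^ i + 2))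
      fun p : Torus d n => harmProdDual L p B i := by
    intro i
    induction i with
    | zero => exact TrigRange.const 1
    | succ i ih =>
      rw [Finset.sum_range_succ, add_comm, add_comm (L ^ i)]
      exact (((TrigRange.const 1).mono (Nat.zero_le _)).sub (hA.mul (hG i))).mul ih
  have h3 : TrigRange (L ^ j + 2 + L ^ j) fun p : Torus d n => midSymb L N p B j := by
    simp only [midSymb, if_pos hj]
    exact (((hG j).add (hG j)).mono (by omega)).sub (((hG j).mul hA).mul (hG j))
  refine (((h1 j).mul h3).mul (h2 j)).mono ?_
  rw [Finset.sum_range_succ]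
  omega

end Range

/-! ### Complexification -/

section Complexification

variable {m d n : ℕ}

/-- The complexification `ℂ^m` of the target space. -/
abbrev CVec (m : ℕ) : Type := EuclideanSpace ℂ (Fin m)

/-- The inclusion of `ℝ^m` in `ℂ^m`. -/
def ofR (v : Vec m) : CVec m := WithLp.toLp 2 fun r => (v r : ℂ)

/-- The real part of a complex vector. -/
def reC : CVec m →ₗ[ℝ] Vec m where
  toFun u := WithLp.toLp 2 fun r => (u r).re
  map_add' u w := by ext r; simp
  map_smul' c u := by ext r; simp

@[simp] theorem ofR_apply (v : Vec m) (r : Fin m) : ofR v r = (v r : ℂ) := rfl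

@[simp] theorem reC_apply (u : CVec m) (r : Fin m) : reC u r = (u r).re := rfl

theorem ofR_add (v w : Vec m) : ofR (v + w) = ofR v + ofR w := by ext r; simp

theorem ofR_smul (c : ℝ) (v : Vec m) : ofR (c • v) = (c : ℂ) • ofR v := by ext r; simp

theorem reC_ofR (v : Vec m) : reC (ofR v) = v := by ext r; simp

theorem norm_ofR (v : Vec m) : ‖ofR v‖ = ‖v‖ := by
  simp [EuclideanSpace.norm_eq]

theorem norm_reC_le (u : CVec m) : ‖reC u‖ ≤ ‖u‖ := by
  rw [EuclideanSpace.norm_eq, EuclideanSpace.norm_eq]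
  refine Real.sqrt_le_sqrt (Finset.sum_le_sum fun r _ => ?_)
  gcongr
  exact Complex.abs_re_le_norm _

theorem inner_reC (u : CVec m) (w : Vec m) :
    inner ℝ (reC u) w = (inner ℂ u (ofR w)).re := by
  simp [PiLp.inner_apply]

/-- The real part `v ↦ Re (T v)` of a complex operator, as an operator on `ℝ^m`. -/
def realPart : (CVec m →L[ℂ] CVec m) →L[ℝ] Mat m :=
  LinearMap.toContinuousLinearMap
    { toFun := fun T => LinearMap.toContinuousLinearMap
        { toFun := fun v => reC (T (ofR v))
          map_add' := fun v w => by simp [ofR_add]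
          map_smul' := fun c v => by
            rw [ofR_smul, map_smul, RingHom.id_apply]
            ext r
            simp }
      map_add' := fun T S => by ext v : 1; simp
      map_smul' := fun c T => by ext v : 1; simp }

theorem realPart_apply (T : CVec m →L[ℂ] CVec m) (v : Vec m) :
    realPart T v = reC (T (ofR v)) := rfl

theorem norm_realPart_le (T : CVec m →L[ℂ] CVec m) : ‖realPart T‖ ≤ ‖T‖ := by
  refine ContinuousLinearMap.opNorm_le_bound _ (norm_nonneg _) fun v => ?_
  rw [realPart_apply, ← norm_ofR v]
  exact (norm_reC_le _).trans (T.le_opNorm _)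

/-- The real part of a complex gradient. -/
def gre (u : GradH d (CVec m)) : Grad m d := WithLp.toLp 2 fun rj => (u rj.2 rj.1).re

/-- The imaginary part of a complex gradient. -/
def gim (u : GradH d (CVec m)) : Grad m d := WithLp.toLp 2 fun rj => (u rj.2 rj.1).im

@[simp] theorem gre_apply (u : GradH d (CVec m)) (rj : Fin m × Fin d) :
    gre u rj = (u rj.2 rj.1).re := rfl

@[simp] theorem gim_apply (u : GradH d (CVec m)) (rj : Fin m × Fin d) :
    gim u rj = (u rj.2 rj.1).im := rfl

theorem re_inner_eq (u w : GradH d (CVec m)) :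
    (inner ℂ u w).re = inner ℝ (gre u) (gre w) + inner ℝ (gim u) (gim w) := by
  simp only [PiLp.inner_apply, Complex.re_sum, gre_apply, gim_apply, Fintype.sum_prod_type,
    ← Finset.sum_add_distrib]
  rw [Finset.sum_comm]
  simp

theorem im_inner_eq (u w : GradH d (CVec m)) :
    (inner ℂ u w).im = inner ℝ (gre u) (gim w) - inner ℝ (gim u) (gre w) := by
  simp only [PiLp.inner_apply, Complex.im_sum, gre_apply, gim_apply, Fintype.sum_prod_type,
    ← Finset.sum_sub_distrib]
  rw [Finset.sum_comm]
  refine Finset.sum_congr rfl fun r _ => Finset.sum_congr rfl fun j _ => ?_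
  simp; ring

theorem norm_sq_eq_gre_add_gim (u : GradH d (CVec m)) :
    ‖u‖ ^ 2 = ‖gre u‖ ^ 2 + ‖gim u‖ ^ 2 := by
  have h := re_inner_eq u u
  rw [real_inner_self_eq_norm_sq, real_inner_self_eq_norm_sq] at h
  rw [← h]
  exact (inner_self_eq_norm_sq (𝕜 := ℂ) u).symm

/-- The complex gradient with given real and imaginary parts. -/
def mkGrad (F G : Grad m d) : GradH d (CVec m) :=
  WithLp.toLp 2 fun j => WithLp.toLp 2 fun r => ⟨F (r, j), G (r, j)⟩

@[simp] theorem gre_mkGrad (F G : Grad m d) : gre (mkGrad F G) = F := rfl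

@[simp] theorem gim_mkGrad (F G : Grad m d) : gim (mkGrad F G) = G := rfl

theorem gradH_ext {u w : GradH d (CVec m)} (h1 : gre u = gre w) (h2 : gim u = gim w) : u = w := by
  apply PiLp.ext; intro j; apply PiLp.ext; intro r
  exact Complex.ext (congrArg (fun F : Grad m d => F (r, j)) h1)
    (congrArg (fun F : Grad m d => F (r, j)) h2)

theorem gre_add (u w : GradH d (CVec m)) : gre (u + w) = gre u + gre w := by ext rj; simp

theorem gim_add (u w : GradH d (CVec m)) : gim (u + w) = gim u + gim w := by ext rj; simp

theorem gre_smul (c : ℂ) (u : GradH d (CVec m)) :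
    gre (c • u) = c.re • gre u - c.im • gim u := by ext rj; simp

theorem gim_smul (c : ℂ) (u : GradH d (CVec m)) :
    gim (c • u) = c.re • gim u + c.im • gre u := by ext rj; simp

theorem norm_mkGrad_le (A : Grad m d →L[ℝ] Grad m d) (u : GradH d (CVec m)) :
    ‖mkGrad (A (gre u)) (A (gim u))‖ ≤ ‖A‖ * ‖u‖ := by
  refine le_of_sq_le_sq ?_ (by positivity)
  rw [norm_sq_eq_gre_add_gim, mul_pow, norm_sq_eq_gre_add_gim u, mul_add, ← mul_pow, ← mul_pow]
  gcongr
  · exact A.le_opNorm _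
  · exact A.le_opNorm _

/-- The complex linear extension of a real operator on gradients. It acts on real and imaginary
parts separately. -/
def cplxFun (A : Grad m d →L[ℝ] Grad m d) : GradH d (CVec m) →L[ℂ] GradH d (CVec m) :=
  LinearMap.mkContinuous
    { toFun := fun u => mkGrad (A (gre u)) (A (gim u))
      map_add' := fun u w => gradH_ext
        (by rw [gre_add, gre_mkGrad, gre_add, gre_mkGrad, gre_mkGrad, map_add])
        (by rw [gim_add, gim_mkGrad, gim_add, gim_mkGrad, gim_mkGrad, map_add])
      map_smul' := fun c u => gradH_ext
        (by rw [RingHom.id_apply, gre_smul, gre_mkGrad, gre_smul, gre_mkGrad, gim_mkGrad, map_sub,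
          map_smul, map_smul])
        (by rw [RingHom.id_apply, gim_smul, gim_mkGrad, gim_smul, gim_mkGrad, gre_mkGrad, map_add,
          map_smul, map_smul]) }
    ‖A‖ (norm_mkGrad_le A)

theorem gre_cplxFun (A : Grad m d →L[ℝ] Grad m d) (u : GradH d (CVec m)) :
    gre (cplxFun A u) = A (gre u) := rfl

theorem gim_cplxFun (A : Grad m d →L[ℝ] Grad m d) (u : GradH d (CVec m)) :
    gim (cplxFun A u) = A (gim u) := rfl

/-- Complexification, as a real linear map on the symmetric operators. -/
def cplx : LSym m d →L[ℝ] (GradH d (CVec m) →L[ℂ] GradH d (CVec m)) :=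
  LinearMap.toContinuousLinearMap (E := LSym m d)
    { toFun := fun A => cplxFun A.1
      map_add' := fun A A' => by
        ext u : 1
        apply gradH_ext <;> simp [gre_add, gim_add, gre_cplxFun, gim_cplxFun]
      map_smul' := fun c A => by
        ext u : 1
        have h : (c • cplxFun A.1) u = (c : ℂ) • cplxFun A.1 u := rfl
        rw [RingHom.id_apply, h]
        apply gradH_ext
        · rw [gre_smul, gre_cplxFun, gre_cplxFun, Complex.ofReal_re, Complex.ofReal_im, zero_smul,
            sub_zero]; rfl
        · rw [gim_smul, gim_cplxFun, gim_cplxFun, Complex.ofReal_re, Complex.ofReal_im, zero_smul,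
            add_zero]; rfl }

theorem cplx_apply (A : LSym m d) : cplx A = cplxFun A.1 := rfl

theorem norm_cplx_le (A : LSym m d) : ‖cplx A‖ ≤ ‖A‖ :=
  LinearMap.mkContinuous_norm_le _ (norm_nonneg A.1) (norm_mkGrad_le A.1)

theorem coercive_cplx {A : LSym m d} {c : ℝ}
    (hA : ∀ F : Grad m d, c * ‖F‖ ^ 2 ≤ inner ℝ (A.1 F) F) : Coercive c (cplx A) := by
  intro u
  rw [re_inner_eq, norm_sq_eq_gre_add_gim, mul_add]
  exact add_le_add (hA _) (hA _)

theorem adjoint_cplx (A : LSym m d) : ContinuousLinearMap.adjoint (cplx A) = cplx A := by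
  have hA : ∀ F G : Grad m d, inner ℝ (A.1 F) G = inner ℝ F (A.1 G) := by
    intro F G
    have h : ContinuousLinearMap.adjoint A.1 = A.1 := A.2
    rw [← ContinuousLinearMap.adjoint_inner_left, h]
  symm
  rw [ContinuousLinearMap.eq_adjoint_iff]
  intro u w
  apply Complex.ext
  · rw [re_inner_eq, re_inner_eq]
    simp only [cplx_apply, gre_cplxFun, gim_cplxFun, hA]
  · rw [im_inner_eq, im_inner_eq]
    simp only [cplx_apply, gre_cplxFun, gim_cplxFun, hA]

/-- A positive definite map is uniformly coercive, by compactness of the unit sphere. -/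
theorem exists_coercive {A : LSym m d} (hA : A ∈ posDefCone m d) :
    ∃ c > 0, ∀ F : Grad m d, c * ‖F‖ ^ 2 ≤ inner ℝ (A.1 F) F := by
  rcases (Metric.sphere (0 : Grad m d) 1).eq_empty_or_nonempty with he | hne
  · refine ⟨1, one_pos, fun F => ?_⟩
    rcases eq_or_ne F 0 with rfl | hF
    · simp
    · exfalso
      have : ‖F‖⁻¹ • F ∈ Metric.sphere (0 : Grad m d) 1 := by
        have := norm_pos_iff.2 hF
        rw [mem_sphere_zero_iff_norm, norm_smul, norm_inv, norm_norm]
        field_simp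
      rw [he] at this
      exact this
  · obtain ⟨G, hG, hmin⟩ := (isCompact_sphere (0 : Grad m d) 1).exists_isMinOn hne
      (f := fun F => inner ℝ (A.1 F) F) (by fun_prop)
    have hG0 : G ≠ 0 := by
      rintro rfl
      simp at hG
    refine ⟨inner ℝ (A.1 G) G, hA G hG0, fun F => ?_⟩
    rcases eq_or_ne F 0 with rfl | hF
    · simp
    · have hp := norm_pos_iff.2 hF
      have hm : ‖F‖⁻¹ • F ∈ Metric.sphere (0 : Grad m d) 1 := by
        rw [mem_sphere_zero_iff_norm, norm_smul, norm_inv, norm_norm]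
        field_simp
      have h := hmin hm
      simp only [Set.mem_ofPred_eq, map_smul, inner_smul_left, inner_smul_right,
        conj_trivial] at h
      calc _ ≤ ‖F‖⁻¹ * (‖F‖⁻¹ * inner ℝ (A.1 F) F) * ‖F‖ ^ 2 := by gcongr
        _ = _ := by field_simp

/-- The complex field with the values of a real field. -/
def cfield (φ : Torus d n → Vec m) : Field2 d n (CVec m) := WithLp.toLp 2 fun x => ofR (φ x)

@[simp] theorem cfield_apply (φ : Torus d n → Vec m) (x : Torus d n) :
    cfield φ x = ofR (φ x) := rfl

variable [NeZero n]

theorem gre_gradC (u : Field2 d n (CVec m)) (x : Torus d n) :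
    gre (gradC u x) = grad (fun y => reC (u y)) x := by
  ext rj; simp [grad, nabla]

theorem gim_gradC_cfield (φ : Torus d n → Vec m) (x : Torus d n) :
    gim (gradC (cfield φ) x) = 0 := by
  ext rj; simp

theorem fieldInner_reC (u : Field2 d n (CVec m)) (ψ : Torus d n → Vec m) :
    fieldInner (fun x => reC (u x)) ψ = (inner ℂ u (cfield ψ)).re := by
  rw [fieldInner, PiLp.inner_apply, Complex.re_sum]
  exact Finset.sum_congr rfl fun x _ => inner_reC _ _

/-- The real elliptic operator is the real part of its complexification. -/
theorem gradStar_reC (A : LSym m d) (u : Field2 d n (CVec m)) :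
    gradStar (fun x => A.1 (grad (fun y => reC (u y)) x)) =
      fun x => reC (ellip (cplx A) u x) := by
  have h : ∀ ψ, fieldInner (gradStar (fun x => A.1 (grad (fun y => reC (u y)) x))) ψ =
      fieldInner (fun x => reC (ellip (cplx A) u x)) ψ := by
    intro ψ
    rw [fieldInner_gradStar, fieldInner_reC, inner_ellip, PiLp.inner_apply, Complex.re_sum]
    refine Finset.sum_congr rfl fun x _ => ?_
    rw [re_inner_eq, gim_gradC_cfield, inner_zero_right, add_zero, gre_gradC, lift_apply,
      cplx_apply, gre_cplxFun, gre_gradC]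
    simp only [cfield_apply, reC_ofR]
  generalize gradStar (fun x => A.1 (grad (fun y => reC (u y)) x)) = f at h
  generalize (fun x => reC (ellip (cplx A) u x)) = g at h
  have h2 := h (f - g)
  have h3 : ∑ x, ‖(f - g) x‖ ^ 2 = 0 := by
    rw [← sub_eq_zero] at h2
    rw [← h2, fieldInner, fieldInner, ← Finset.sum_sub_distrib]
    refine Finset.sum_congr rfl fun x _ => ?_
    rw [← inner_sub_left, ← real_inner_self_eq_norm_sq]; rfl
  have h4 := (Finset.sum_eq_zero_iff_of_nonneg fun x _ => by positivity).1 h3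
  funext x
  have := h4 x (Finset.mem_univ x)
  simpa [sub_eq_zero] using this

end Complexification

/-! ### Derivatives along a line -/

/-- If a real analytic `f` agrees along the real line through `x` in direction `v`, up to linear
maps, with a holomorphic function `g`, then so do the derivatives: both have the same power series
along the line. -/
theorem map_iteratedFDeriv_eq_map_iteratedDeriv {E F G W : Type*} [NormedAddCommGroup E]
    [NormedSpace ℝ E] [NormedAddCommGroup F] [NormedSpace ℝ F] [CompleteSpace F]
    [NormedAddCommGroup G] [NormedSpace ℝ G] [NormedAddCommGroup W] [NormedSpace ℂ W]
    [CompleteSpace W] [NormedSpace ℝ W] [IsScalarTower ℝ ℂ W]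
    {f : E → F} {x v : E} (hf : AnalyticAt ℝ f x) {g : ℂ → W} (hg : AnalyticAt ℂ g 0)
    (ℓ : F →L[ℝ] G) (Φ : W →L[ℝ] G)
    (h : ∀ᶠ t : ℝ in nhds 0, ℓ (f (x + t • v)) = Φ (g (t : ℂ))) (i : ℕ) :
    ℓ (iteratedFDeriv ℝ i f x fun _ => v) = Φ (iteratedDeriv i g 0) := by
  obtain ⟨p, r, hp⟩ := hf
  obtain ⟨q, s, hq⟩ := hg
  have h1 := hp.factorial_smul v i
  have h2 := hq.factorial_smul 1 i
  rw [iteratedDeriv_eq_iteratedFDeriv, ← h1, ← h2, map_nsmul, map_nsmul]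
  congr 1
  let u : ℝ →L[ℝ] E := ContinuousLinearMap.toSpanSingleton ℝ v
  have h3 : HasFPowerSeriesAt (fun y => f (y - -x)) p (u 0) := by
    have := hp.hasFPowerSeriesAt.comp_sub (-x)
    simpa [u] using this
  obtain ⟨r', h3'⟩ := h3.compContinuousLinearMap
  have h4 := (ℓ.comp_hasFPowerSeriesOnBall h3').hasFPowerSeriesAt
  have h5 : HasFPowerSeriesAt g (q.restrictScalars ℝ) (Complex.ofRealCLM 0) := by
    simpa using hq.hasFPowerSeriesAt.restrictScalars (𝕜 := ℝ)
  obtain ⟨s', h5'⟩ := h5.compContinuousLinearMap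
  have h6 := (Φ.comp_hasFPowerSeriesOnBall h5').hasFPowerSeriesAt
  have h7 := h4.eq_formalMultilinearSeries_of_eventually h6 (by
    filter_upwards [h] with t ht
    simpa [u, add_comm] using ht)
  have h8 := congrArg (fun P : FormalMultilinearSeries ℝ ℝ G => P i fun _ => 1) h7
  simp only [ContinuousLinearMap.compFormalMultilinearSeries_apply,
    ContinuousLinearMap.compContinuousMultilinearMap_coe, Function.comp_apply,
    FormalMultilinearSeries.compContinuousLinearMap_apply, u,
    FormalMultilinearSeries.restrictScalars, ContinuousMultilinearMap.coe_restrictScalars] at h8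
  simpa [Function.comp_def, -FormalMultilinearSeries.apply_eq_prod_smul_coeff] using h8

/-! ### Kernels of Fourier multipliers -/

section Kernels

variable {m d n : ℕ} [NeZero n]

theorem chr_comm (p x : Torus d n) : chr p x = chr x p := by
  simp only [chr, mul_comm]

theorem sum_chr_right {p : Torus d n} (hp : p ≠ 0) : ∑ x, chr p x = 0 := by
  simp only [chr_comm p, sum_chr, hp, if_false]

/-- The Fourier multiplier with symbol `f` on complex fields; the frequency `0` is omitted. -/
def fourierMul (f : Torus d n → CVec m →L[ℂ] CVec m) :
    Field2 d n (CVec m) →L[ℂ] Field2 d n (CVec m) :=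
  ((n : ℂ) ^ d)⁻¹ • ∑ p ∈ Finset.univ.erase 0,
    wave p ∘L f p ∘L ContinuousLinearMap.adjoint (wave p)

/-- The real part of the kernel of the Fourier multiplier with symbol `f`. -/
def fourierKer (f : Torus d n → CVec m →L[ℂ] CVec m) (x : Torus d n) : Mat m :=
  ((n : ℝ) ^ d)⁻¹ • ∑ p ∈ Finset.univ.erase 0, realPart (chr p x • f p)

theorem fourierMul_apply (f : Torus d n → CVec m →L[ℂ] CVec m) (u : Field2 d n (CVec m)) :
    fourierMul f u = ((n : ℂ) ^ d)⁻¹ • ∑ p ∈ Finset.univ.erase 0,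
      wave p (f p (ContinuousLinearMap.adjoint (wave p) u)) := by
  simp [fourierMul]

theorem inner_fourierMul (f : Torus d n → CVec m →L[ℂ] CVec m) (u w : Field2 d n (CVec m)) :
    (inner ℂ (fourierMul f u) w).re = ((n : ℝ) ^ d)⁻¹ * ∑ p ∈ Finset.univ.erase 0,
      (inner ℂ (f p (ContinuousLinearMap.adjoint (wave p) u))
        (ContinuousLinearMap.adjoint (wave p) w)).re := by
  have h : ((n : ℂ) ^ d)⁻¹ = ((((n : ℝ) ^ d)⁻¹ : ℝ) : ℂ) := by push_cast; rfl
  rw [fourierMul_apply, inner_smul_left, h, Complex.conj_ofReal, Complex.re_ofReal_mul, sum_inner,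
    Complex.re_sum]
  simp only [ContinuousLinearMap.adjoint_inner_right]

/-- The operator with the real kernel is the real part of the Fourier multiplier. -/
theorem kernelOp_fourierKer (f : Torus d n → CVec m →L[ℂ] CVec m) (φ : zeroSum m d n) :
    (kernelOp (fourierKer f) φ).1 = fun x => reC (fourierMul f (cfield φ.1) x) := by
  funext x
  have h : ((n : ℂ) ^ d)⁻¹ = ((((n : ℝ) ^ d)⁻¹ : ℝ) : ℂ) := by push_cast; rfl
  have h2 : ∀ w : CVec m, reC (((((n : ℝ) ^ d)⁻¹ : ℝ) : ℂ) • w) = ((n : ℝ) ^ d)⁻¹ • reC w := by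
    intro w; ext r; rw [reC_apply, PiLp.smul_apply, smul_eq_mul, Complex.re_ofReal_mul]; rfl
  change ∑ y, fourierKer f (x - y) (φ.1 y) = _
  rw [fourierMul_apply, h, PiLp.smul_apply, h2, WithLp.ofLp_sum, Finset.sum_apply, map_sum,
    Finset.smul_sum]
  simp only [fourierKer, smul_apply, sum_apply, Finset.smul_sum, realPart_apply]
  rw [Finset.sum_comm]
  refine Finset.sum_congr rfl fun p _ => ?_
  rw [wave_apply, adjoint_wave_apply, ← Finset.smul_sum, map_sum, Finset.smul_sum (r := chr p x),
    map_sum]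
  congr 1
  refine Finset.sum_congr rfl fun y _ => ?_
  rw [chr_sub, mul_smul, (f p).map_smul, cfield_apply]

theorem sum_fourierKer (f : Torus d n → CVec m →L[ℂ] CVec m) : ∑ x, fourierKer f x = 0 := by
  simp only [fourierKer]
  rw [← Finset.smul_sum, Finset.sum_comm]
  rw [Finset.sum_eq_zero, smul_zero]
  intro p hp
  rw [← map_sum, ← Finset.sum_smul, sum_chr_right (Finset.ne_of_mem_erase hp), zero_smul, map_zero]

theorem fourierKer_sum {ι : Type*} (s : Finset ι) (f : ι → Torus d n → CVec m →L[ℂ] CVec m)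
    (x : Torus d n) :
    fourierKer (fun p => ∑ i ∈ s, f i p) x = ∑ i ∈ s, fourierKer (f i) x := by
  simp only [fourierKer, Finset.smul_sum, map_sum]
  rw [Finset.sum_comm]

theorem kernelOp_sum {ι : Type*} (s : Finset ι) (K : ι → Torus d n → Mat m) :
    kernelOp (fun x => ∑ i ∈ s, K i x) = ∑ i ∈ s, kernelOp (K i) := by
  refine LinearMap.ext fun φ => Subtype.ext ?_
  rw [LinearMap.sum_apply, AddSubmonoidClass.coe_finsetSum]
  funext x
  rw [Finset.sum_apply]
  change ∑ y, (∑ i ∈ s, K i (x - y)) (φ.1 y) = ∑ i ∈ s, ∑ y, K i (x - y) (φ.1 y)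
  simp only [sum_apply]
  rw [Finset.sum_comm]

/-- Fourier inversion. -/
theorem sum_wave_adjoint_wave (u : Field2 d n (CVec m)) :
    ∑ p, wave p (ContinuousLinearMap.adjoint (wave p) u) = ((n : ℂ) ^ d) • u := by
  apply PiLp.ext; intro x
  simp only [WithLp.ofLp_sum, Finset.sum_apply, wave_apply, adjoint_wave_apply, Finset.smul_sum,
    smul_smul, ← chr_sub, PiLp.smul_apply]
  rw [Finset.sum_comm]
  simp only [← Finset.sum_smul, sum_chr, sub_eq_zero, ite_smul, zero_smul, Finset.sum_ite_eq,
    Finset.mem_univ, if_true]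

theorem adjoint_wave_zero_cfield (φ : zeroSum m d n) :
    ContinuousLinearMap.adjoint (wave 0) (cfield φ.1) = 0 := by
  have h : ∑ x, φ.1 x = 0 := φ.2
  simp only [adjoint_wave_apply, chr_zero_left, map_one, one_smul, cfield_apply]
  ext r
  have h2 := congrArg (fun v : Vec m => ((v r : ℝ) : ℂ)) h
  simpa using h2

theorem sum_erase_wave_adjoint_wave (φ : zeroSum m d n) :
    ∑ p ∈ Finset.univ.erase 0, wave p (ContinuousLinearMap.adjoint (wave p) (cfield φ.1)) =
      ((n : ℂ) ^ d) • cfield φ.1 := by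
  rw [← sum_wave_adjoint_wave, ← Finset.add_sum_erase _ _ (Finset.mem_univ (0 : Torus d n)),
    adjoint_wave_zero_cfield, map_zero, zero_add]

theorem natCast_pow_ne_zero : ((n : ℂ) ^ d) ≠ 0 := pow_ne_zero _ (Nat.cast_ne_zero.2 (NeZero.ne n))

/-- Positivity of the symbols at the nonzero frequencies suffices, because the Fourier coefficient
of a field with zero sum vanishes at the frequency `0`. -/
theorem isPosDefOp_fourierKer {f : Torus d n → CVec m →L[ℂ] CVec m}
    (hs : ∀ p, p ≠ 0 → ContinuousLinearMap.adjoint (f p) = f p)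
    (hpos : ∀ p, p ≠ 0 → ∀ v, v ≠ 0 → 0 < (inner ℂ (f p v) v).re) :
    IsPosDefOp (kernelOp (fourierKer f)) := by
  have hn : (0 : ℝ) < ((n : ℝ) ^ d)⁻¹ := by
    have : (0 : ℝ) < n := Nat.cast_pos.2 (Nat.pos_of_ne_zero (NeZero.ne n))
    positivity
  constructor
  · intro φ ψ
    have hc : fieldInner φ.1 (kernelOp (fourierKer f) ψ).1 =
        fieldInner (kernelOp (fourierKer f) ψ).1 φ.1 := by
      simp only [fieldInner]
      exact Finset.sum_congr rfl fun x _ => real_inner_comm _ _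
    rw [hc, kernelOp_fourierKer, kernelOp_fourierKer, fieldInner_reC, fieldInner_reC,
      inner_fourierMul, inner_fourierMul]
    congr 1
    refine Finset.sum_congr rfl fun p hp => ?_
    rw [re_inner_comm, ← hs p (Finset.ne_of_mem_erase hp), ContinuousLinearMap.adjoint_inner_right,
      hs p (Finset.ne_of_mem_erase hp)]
  · intro φ hφ
    rw [kernelOp_fourierKer, fieldInner_reC, inner_fourierMul]
    refine mul_pos hn ?_
    have hnn : ∀ p ∈ (Finset.univ : Finset (Torus d n)).erase 0,
        0 ≤ (inner ℂ (f p (ContinuousLinearMap.adjoint (wave p) (cfield φ.1)))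
          (ContinuousLinearMap.adjoint (wave p) (cfield φ.1))).re := by
      intro p hp
      rcases eq_or_ne (ContinuousLinearMap.adjoint (wave p) (cfield φ.1)) 0 with h | h
      · rw [h]; simp
      · exact (hpos p (Finset.ne_of_mem_erase hp) _ h).le
    refine (Finset.sum_nonneg hnn).lt_of_ne fun h0 => hφ ?_
    have h1 := (Finset.sum_eq_zero_iff_of_nonneg hnn).1 h0.symm
    have h2 := sum_erase_wave_adjoint_wave φ
    rw [Finset.sum_eq_zero] at h2
    · have h3 := (smul_eq_zero.1 h2.symm).resolve_left natCast_pow_ne_zero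
      ext x : 2
      have h4 := congrArg (fun u : Field2 d n (CVec m) => reC (u x)) h3
      simpa [reC_ofR] using h4
    · intro p hp
      by_cases h : ContinuousLinearMap.adjoint (wave p) (cfield φ.1) = 0
      · rw [h, map_zero]
      · exact absurd (h1 p hp) (hpos p (Finset.ne_of_mem_erase hp) _ h).ne'

/-- On fields with zero sum, `∇^* A ∇` is diagonal in Fourier space, with the symbols `Â(p)`. -/
theorem greenOp_eq_kernelOp {A : LSym m d} (hA : A ∈ posDefCone m d) :
    greenOp m d n A.1 =
      kernelOp (fourierKer fun p : Torus d n => Ring.inverse (ahat p (cplx A))) := by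
  obtain ⟨c, hc, hcA⟩ := exists_coercive hA
  have hB := coercive_cplx hcA
  have h : ellipticOp m d n A.1 *
      kernelOp (fourierKer fun p : Torus d n => Ring.inverse (ahat p (cplx A))) = 1 := by
    refine LinearMap.ext fun φ => Subtype.ext ?_
    change gradStar (fun x => A.1 (grad (kernelOp _ φ).1 x)) = φ.1
    rw [kernelOp_fourierKer, gradStar_reC, fourierMul_apply, map_smul, map_sum]
    have e : ∀ p ∈ (Finset.univ : Finset (Torus d n)).erase 0,
        ellip (cplx A) (wave p (Ring.inverse (ahat p (cplx A))
          (ContinuousLinearMap.adjoint (wave p) (cfield φ.1)))) =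
        wave p (ContinuousLinearMap.adjoint (wave p) (cfield φ.1)) := by
      intro p hp
      rw [ellip_wave, ahat_inverse_apply (Finset.ne_of_mem_erase hp) hc hB]
    rw [Finset.sum_congr rfl e, sum_erase_wave_adjoint_wave, smul_smul,
      inv_mul_cancel₀ natCast_pow_ne_zero, one_smul]
    funext x
    rw [cfield_apply, reC_ofR]
  have h2 := Ring.inverse_mul_cancel _ (isUnit_ellipticOp (n := n) A hA)
  rw [greenOp]
  calc _ = Ring.inverse (ellipticOp m d n A.1) * (ellipticOp m d n A.1 *
      kernelOp (fourierKer fun p : Torus d n => Ring.inverse (ahat p (cplx A)))) := by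
        rw [h, mul_one]
    _ = _ := by rw [← mul_assoc, h2, one_mul]

/-- If the symbol is a trigonometric polynomial, then the kernel is constant away from `0`: the
omitted frequency `0` only adds a constant. -/
theorem TrigRange.exists_fourierKer_eq {r : ℕ} {f : Torus d n → CVec m →L[ℂ] CVec m}
    (hf : TrigRange r f) : ∃ M : Mat m, ∀ x, r < rhoInf x → fourierKer f x = M := by
  obtain ⟨a, ha, hfa⟩ := hf
  refine ⟨-(((n : ℝ) ^ d)⁻¹ • realPart (f 0)), fun x hx => ?_⟩
  have h : ∑ p, chr p x • f p = 0 := by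
    simp only [hfa, Finset.smul_sum, smul_smul, ← chr_sub]
    rw [Finset.sum_comm]
    simp only [← Finset.sum_smul, sum_chr, sub_eq_zero, ite_smul, zero_smul, Finset.sum_ite_eq,
      Finset.mem_univ, if_true, ha x hx, smul_zero]
  rw [← Finset.add_sum_erase _ _ (Finset.mem_univ (0 : Torus d n)), chr_zero_left, one_smul,
    add_comm] at h
  rw [fourierKer, ← map_sum, eq_neg_of_add_eq_zero_left h, map_neg, smul_neg]

/-- The range `2 ∑_{i ≤ j} (L^i + 2)` of the `j`-th kernel is less than `L^{j+1} / 2`. -/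
theorem four_mul_sum_lt {L : ℕ} (hL : 16 ≤ L) (j : ℕ) :
    4 * ∑ i ∈ Finset.range (j + 1), (L ^ i + 2) < L ^ (j + 1) := by
  induction j with
  | zero => simp; omega
  | succ j ih =>
    rw [Finset.sum_range_succ, mul_add]
    have h1 : 16 * L ^ (j + 1) ≤ L ^ (j + 1) * L := by rw [mul_comm]; gcongr
    have h2 : L ^ 1 ≤ L ^ (j + 1) := Nat.pow_le_pow_right (by omega) (by omega)
    rw [pow_succ L (j + 1)]
    omega

theorem rhoInf_le_half (x : Torus d n) : rhoInf x ≤ n / 2 :=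
  rhoInf_le_iff.2 fun i => ZMod.natAbs_valMinAbs_le (x i)

end Kernels

/-! ### Differences of kernels -/

section Differences

variable {m d n : ℕ}

/-- The difference `∇_i` as a linear map. -/
def nablaLin (V : Type*) [AddCommGroup V] [Module ℝ V] (i : Fin d) :
    Module.End ℝ (Torus d n → V) where
  toFun := nabla i
  map_add' f g := by funext x; simp only [nabla, Pi.add_apply]; abel
  map_smul' c f := by funext x; simp only [nabla, Pi.smul_apply, smul_sub, RingHom.id_apply]

theorem foldr_nabla_eq {V : Type*} [AddCommGroup V] [Module ℝ V] (α : Fin d → ℕ)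
    (l : List (Fin d)) (f : Torus d n → V) :
    l.foldr (fun i g => (nabla i)^[α i] g) f = (l.map fun i => nablaLin V i ^ α i).prod f := by
  induction l with
  | nil => rfl
  | cons i l ih =>
    rw [List.foldr_cons, ih, List.map_cons, List.prod_cons, Module.End.mul_apply,
      Module.End.pow_apply]
    rfl

variable [NeZero n]

/-- The value of `∇^α f` at `x`, as a continuous linear function of `f`. -/
def nablaPowAt (V : Type*) [NormedAddCommGroup V] [NormedSpace ℝ V] [FiniteDimensional ℝ V]
    (α : Fin d → ℕ) (x : Torus d n) : (Torus d n → V) →L[ℝ] V :=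
  LinearMap.toContinuousLinearMap
    (LinearMap.proj x ∘ₗ ((List.finRange d).map fun i => nablaLin V i ^ α i).prod)

theorem nablaPowAt_apply {V : Type*} [NormedAddCommGroup V] [NormedSpace ℝ V]
    [FiniteDimensional ℝ V] (α : Fin d → ℕ) (x : Torus d n) (f : Torus d n → V) :
    nablaPowAt V α x f = nablaPow α f x := by
  rw [nablaPow, foldr_nabla_eq]; rfl

theorem nabla_fourierKer (f : Torus d n → CVec m →L[ℂ] CVec m) (i : Fin d) :
    nabla i (fourierKer f) = fourierKer fun p => symb p i • f p := by
  funext x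
  refine (smul_sub _ _ _).symm.trans (congrArg _ ?_)
  refine (Finset.sum_sub_distrib _ _).symm.trans (Finset.sum_congr rfl fun p _ => ?_)
  have e : chr p (x + unitVec i) • f p - chr p x • f p = chr p x • symb p i • f p := by
    ext v : 1
    change chr p (x + unitVec i) • f p v - chr p x • f p v = chr p x • symb p i • f p v
    rw [← sub_smul, chr_add_unitVec, smul_smul, mul_comm]
  exact (map_sub realPart _ _).symm.trans (congrArg realPart e)

theorem nabla_iterate_fourierKer (f : Torus d n → CVec m →L[ℂ] CVec m) (i : Fin d) (k : ℕ) :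
    (nabla i)^[k] (fourierKer f) = fourierKer fun p => symb p i ^ k • f p := by
  induction k with
  | zero => simp
  | succ k ih =>
    rw [Function.iterate_succ_apply', ih, nabla_fourierKer]
    simp only [smul_smul, pow_succ']

theorem nablaPow_fourierKer (α : Fin d → ℕ) (f : Torus d n → CVec m →L[ℂ] CVec m) :
    nablaPow α (fourierKer f) = fourierKer fun p => (∏ i, symb p i ^ α i) • f p := by
  have h : ∀ l : List (Fin d), l.foldr (fun i g => (nabla i)^[α i] g) (fourierKer f) =
      fourierKer fun p => (l.map fun i => symb p i ^ α i).prod • f p := by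
    intro l
    induction l with
    | nil => simp
    | cons i l ih =>
      rw [List.foldr_cons, ih, nabla_iterate_fourierKer]
      simp only [smul_smul, List.map_cons, List.prod_cons]
  rw [nablaPow, h]
  simp only [← List.ofFn_eq_map, List.prod_ofFn]

theorem norm_prod_symb_le (α : Fin d → ℕ) (p : Torus d n) :
    ‖∏ i, symb p i ^ α i‖ ≤ symbNorm p ^ ∑ i, α i := by
  rw [norm_prod, ← Finset.prod_pow_eq_pow_sum]
  refine Finset.prod_le_prod (fun _ _ => norm_nonneg _) fun i _ => ?_
  rw [norm_pow]
  exact pow_le_pow_left₀ (norm_nonneg _) (norm_symb_le_symbNorm p i) _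

end Differences

/-! ### The finite range decomposition -/

section Decomposition

variable {m d n L N : ℕ} [NeZero n]

/-- The kernels of the decomposition, indexed by the scale `j = 0, …, N`. -/
def covKer (L N j : ℕ) (A : LSym m d) : Torus d n → Mat m :=
  fourierKer fun p => covSymb L N p (cplx A) j

theorem greenOp_eq_sum {A : LSym m d} (hA : A ∈ posDefCone m d) :
    greenOp m d n A.1 = ∑ j ∈ Finset.range (N + 1), kernelOp (covKer L N j A) := by
  obtain ⟨c, hc, hcA⟩ := exists_coercive hA
  have hB := coercive_cplx hcA
  rw [greenOp_eq_kernelOp hA, ← kernelOp_sum]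
  congr 1
  funext x
  simp only [covKer]
  rw [← fourierKer_sum, fourierKer, fourierKer]
  congr 1
  refine Finset.sum_congr rfl fun p hp => ?_
  have h0 := symbNorm_pos (Finset.ne_of_mem_erase hp)
  rw [sum_covSymb L N ((hB.ahat p).isUnit (by positivity))]

theorem isPosDefOp_covKer {A : LSym m d} (hA : A ∈ posDefCone m d) (hd : 1 ≤ d) (hL : 2 ≤ L)
    (hn : n = L ^ N) {j : ℕ} (hj : j ≤ N) :
    IsPosDefOp (kernelOp (covKer L N j A : Torus d n → Mat m)) := by
  obtain ⟨c, hc, hcA⟩ := exists_coercive hA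
  have hB := coercive_cplx hcA
  exact isPosDefOp_fourierKer (fun p _ => adjoint_covSymb p (adjoint_cplx A) j)
    fun p hp v hv => re_inner_covSymb_pos hc hB (adjoint_cplx A) hd hL hn hp hj hv

theorem analyticAt_covKer {A : LSym m d} {c : ℝ} (hc : 0 < c) (hB : Coercive c (cplx A))
    (hd : 1 ≤ d) (hL : 2 ≤ L) (j : ℕ) :
    AnalyticAt ℝ (covKer L N j : LSym m d → Torus d n → Mat m) A := by
  rw [analyticAt_pi_iff]
  intro x
  have h1 : ∀ p ∈ (Finset.univ : Finset (Torus d n)).erase 0, AnalyticAt ℝ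
      (fun A : LSym m d => realPart (chr p x • covSymb L N p (cplx A) j)) A := by
    intro p hp
    have h2 := analyticAt_covSymb (N := N) hc hB hd hL (Finset.ne_of_mem_erase hp) j
    have h3 := (h2.const_smul (c := chr p x)).restrictScalars (𝕜 := ℝ)
    have h4 : AnalyticAt ℝ
        (cplx : LSym m d → (GradH d (CVec m) →L[ℂ] GradH d (CVec m))) A := by
      apply ContinuousLinearMap.analyticAt
    have h5 := h3.comp h4
    exact (ContinuousLinearMap.analyticAt (realPart (m := m)) _).comp h5
  exact (Finset.analyticAt_fun_sum _ h1).const_smul (c := ((n : ℝ) ^ d)⁻¹)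

/-- Scales below the last one have finite range; at the last scale the condition is void, because
the torus is too small. -/
theorem exists_covKer_eq (A : LSym m d) (hL : 16 ≤ L) (hn : n = L ^ N) {j : ℕ} (hj : j ≤ N) :
    ∃ M : Mat m, ∀ x : Torus d n, (L : ℝ) ^ (j + 1) / 2 ≤ (rhoInf x : ℝ) →
      covKer L N j A x = M := by
  rcases hj.lt_or_eq with h | rfl
  · obtain ⟨M, hM⟩ := (trigRange_covSymb (n := n) L N (cplx A) h).exists_fourierKer_eq
    refine ⟨M, fun x hx => hM x ?_⟩
    have h1 : (L : ℝ) ^ (j + 1) ≤ 2 * rhoInf x := by linarith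
    have h2 : L ^ (j + 1) ≤ 2 * rhoInf x := by exact_mod_cast h1
    have := four_mul_sum_lt hL j
    omega
  · refine ⟨0, fun x hx => ?_⟩
    have h1 : (L : ℝ) ^ (j + 1) ≤ 2 * rhoInf x := by linarith
    have h2 : L ^ (j + 1) ≤ 2 * rhoInf x := by exact_mod_cast h1
    have h3 := rhoInf_le_half x
    have h4 : L ^ j * 2 ≤ L ^ (j + 1) := by rw [pow_succ]; gcongr; omega
    have h5 : 0 < L ^ j := by positivity
    omega

end Decomposition

/-! ### Bounds for the derivatives of the kernels -/

section DerivativeBounds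

variable {m d n L N : ℕ} [NeZero n]

theorem Coercive.add_smul {H : Type*} [NormedAddCommGroup H] [InnerProductSpace ℂ H] {c r : ℝ}
    {B B' : H →L[ℂ] H} (hB : Coercive c B) (hB' : ‖B'‖ ≤ 1) {z : ℂ} (hz : ‖z‖ ≤ r) :
    Coercive (c - r) (B + z • B') := by
  intro v
  have h1 := hB v
  have h2 : -(r * ‖v‖ ^ 2) ≤ (inner ℂ ((z • B') v) v).re := by
    have h3 : |(inner ℂ ((z • B') v) v).re| ≤ r * ‖v‖ ^ 2 := by
      refine (Complex.abs_re_le_norm _).trans ((norm_inner_le_norm _ _).trans ?_)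
      have h4 : ‖(z • B') v‖ ≤ r * (1 * ‖v‖) := by
        change ‖z • B' v‖ ≤ _
        rw [norm_smul]
        have := B'.le_of_opNorm_le hB' v
        gcongr
        exact (norm_nonneg z).trans hz
      calc _ ≤ r * (1 * ‖v‖) * ‖v‖ := by gcongr
        _ = _ := by ring
    exact neg_le_of_abs_le h3
  have h5 : (inner ℂ ((B + z • B') v) v : ℂ) = inner ℂ (B v) v + inner ℂ ((z • B') v) v := by
    rw [← inner_add_left]; rfl
  rw [h5, Complex.add_re, sub_mul]
  linarith

/-- Cauchy's estimate on the disc of radius `c / 2`: there the complexified operators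
`A₀ + z A'` are still coercive, with constant `c / 2`. -/
theorem norm_nablaPow_iteratedFDeriv_covKer_le {c Λ : ℝ} (hc : 0 < c) {A₀ A' : LSym m d}
    (hA : ∀ F : Grad m d, c * ‖F‖ ^ 2 ≤ inner ℝ (A₀.1 F) F) (hΛ : ‖A₀‖ ≤ Λ) (hA' : ‖A'‖ ≤ 1)
    (hd : 1 ≤ d) (hL : 2 ≤ L) (hn : n = L ^ N) {j : ℕ} (hj : j ≤ N) (α : Fin d → ℕ) (i : ℕ)
    (x : Torus d n) :
    ‖nablaPow α (iteratedFDeriv ℝ i (covKer L N j : LSym m d → Torus d n → Mat m) A₀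
        fun _ => A') x‖ ≤
      i.factorial * (2 ^ d * symbConst d (c / 2) ((Λ + c / 2) / (c / 2)) (∑ i, α i + d) *
        ((L : ℝ) ^ (2 * (∑ i, α i + d) * (∑ i, α i + d))) ^ 2 * ((L : ℝ) ^ j) ^ 2 *
        (((L : ℝ) ^ j) ^ (∑ i, α i + d))⁻¹) / (c / 2) ^ i := by
  set M := 2 ^ d * symbConst d (c / 2) ((Λ + c / 2) / (c / 2)) (∑ i, α i + d) *
        ((L : ℝ) ^ (2 * (∑ i, α i + d) * (∑ i, α i + d))) ^ 2 * ((L : ℝ) ^ j) ^ 2 *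
        (((L : ℝ) ^ j) ^ (∑ i, α i + d))⁻¹ with hM
  have hn0 : (0 : ℝ) < (n : ℝ) ^ d := by
    have : (0 : ℝ) < n := Nat.cast_pos.2 (Nat.pos_of_ne_zero (NeZero.ne n))
    positivity
  have hB := coercive_cplx hA
  have hBz : ∀ z : ℂ, ‖z‖ ≤ c / 2 → Coercive (c / 2) (cplx A₀ + z • cplx A') := by
    intro z hz
    have := hB.add_smul ((norm_cplx_le A').trans hA') hz
    rwa [sub_half] at this
  have hNz : ∀ z : ℂ, ‖z‖ ≤ c / 2 → ‖cplx A₀ + z • cplx A'‖ ≤ Λ + c / 2 := by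
    intro z hz
    refine (norm_add_le _ _).trans (add_le_add ((norm_cplx_le A₀).trans hΛ) ?_)
    rw [norm_smul]
    calc _ ≤ c / 2 * 1 := by
          gcongr
          exact (norm_cplx_le A').trans hA'
      _ = _ := mul_one _
  let g : ℂ → (CVec m →L[ℂ] CVec m) := fun z => ∑ p ∈ (Finset.univ : Finset (Torus d n)).erase 0,
    chr p x • (∏ i, symb p i ^ α i) • covSymb L N p (cplx A₀ + z • cplx A') j
  have hg : ∀ z : ℂ, ‖z‖ ≤ c / 2 → AnalyticAt ℂ g z := by
    intro z hz
    refine Finset.analyticAt_fun_sum _ fun p hp => ?_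
    have h1 := analyticAt_covSymb (N := N) (half_pos hc) (hBz z hz) hd hL
      (Finset.ne_of_mem_erase hp) j
    have h2 : AnalyticAt ℂ (fun z : ℂ => cplx A₀ + z • cplx A') z :=
      analyticAt_const.add (analyticAt_id.smul analyticAt_const)
    have h3 : AnalyticAt ℂ (fun z : ℂ => covSymb L N p (cplx A₀ + z • cplx A') j) z :=
      h1.comp_of_eq h2 rfl
    exact ((h3.const_smul (c := ∏ i, symb p i ^ α i))).const_smul (c := chr p x)
  have hgb : ∀ z : ℂ, ‖z‖ ≤ c / 2 → ‖g z‖ ≤ (n : ℝ) ^ d * M := by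
    intro z hz
    have h1 := sum_norm_covSymb_le (half_pos hc) (hBz z hz) (hNz z hz) hd hL hn hj (∑ i, α i)
    rw [inv_mul_le_iff₀ hn0] at h1
    refine le_trans ((norm_sum_le _ _).trans (Finset.sum_le_sum fun p _ => ?_)) h1
    rw [norm_smul, norm_smul, norm_chr, one_mul]
    gcongr
    exact norm_prod_symb_le α p
  have hcauchy : ‖iteratedDeriv i g 0‖ ≤ i.factorial * ((n : ℝ) ^ d * M) / (c / 2) ^ i := by
    refine Complex.norm_iteratedDeriv_le_of_forall_mem_sphere_norm_le i (half_pos hc) ?_ ?_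
    · refine DifferentiableOn.diffContOnCl_ball (U := Metric.closedBall 0 (c / 2)) ?_ subset_rfl
      intro z hz
      exact (hg z (mem_closedBall_zero_iff.1 hz)).differentiableAt.differentiableWithinAt
    · intro z hz
      exact hgb z (mem_sphere_zero_iff_norm.1 hz).le
  have hline : ∀ t : ℝ, nablaPowAt (Mat m) α x (covKer L N j (A₀ + t • A')) =
      (((n : ℝ) ^ d)⁻¹ • realPart) (g (t : ℂ)) := by
    intro t
    have h1 : cplx (A₀ + t • A') = cplx A₀ + (t : ℂ) • cplx A' := by
      rw [map_add, map_smul]; rfl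
    rw [nablaPowAt_apply, covKer, nablaPow_fourierKer, fourierKer, h1, smul_apply, map_sum]
  have hkey := map_iteratedFDeriv_eq_map_iteratedDeriv (v := A')
    (analyticAt_covKer (n := n) (N := N) hc hB hd hL j)
    (hg 0 (by rw [norm_zero]; positivity)) (nablaPowAt (Mat m) α x)
    (((n : ℝ) ^ d)⁻¹ • realPart) (Filter.Eventually.of_forall hline) i
  rw [← nablaPowAt_apply, hkey, smul_apply, norm_smul, norm_inv, Real.norm_of_nonneg hn0.le,
    inv_mul_le_iff₀ hn0]
  refine (norm_realPart_le _).trans (hcauchy.trans (le_of_eq ?_))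
  ring

end DerivativeBounds

end FRD

theorem theorem2p2 (d : ℕ) (hd : 2 ≤ d) :
    ∃ (C : (Fin d → ℕ) → ℝ → ℝ → ℝ) (η : (Fin d → ℕ) → ℝ),
      ∀ (m N L : ℕ) [NeZero L], 1 ≤ N → Odd L → 16 ≤ L →
        ∃ K : ℕ → FRD.LSym m d → FRD.Torus d (L ^ N) → FRD.Mat m,
          -- real-analytic maps from the cone to the kernels of zero mean
          (∀ k ∈ Finset.Icc 1 (N + 1),
            AnalyticOnNhd ℝ (K k) (FRD.posDefCone m d) ∧
              ∀ A ∈ FRD.posDefCone m d, ∑ x, K k A x = 0) ∧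
          -- the induced operators are positive definite and decompose the Green operator
          (∀ A ∈ FRD.posDefCone m d,
            (∀ k ∈ Finset.Icc 1 (N + 1), FRD.IsPosDefOp (FRD.kernelOp (K k A))) ∧
              FRD.greenOp m d (L ^ N) A.1 =
                ∑ k ∈ Finset.Icc 1 (N + 1), FRD.kernelOp (K k A)) ∧
          -- finite range
          (∀ A ∈ FRD.posDefCone m d, ∀ k ∈ Finset.Icc 1 (N + 1),
            ∃ M : FRD.Mat m, ∀ x : FRD.Torus d (L ^ N),
              (L : ℝ) ^ k / 2 ≤ (FRD.rhoInf x : ℝ) → K k A x = M) ∧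
          -- bounds for all derivatives
          (∀ (α : Fin d → ℕ) (c₀ Λ : ℝ), 0 < c₀ → ∀ A₀ : FRD.LSym m d,
            (∀ F : FRD.Grad m d, c₀ * ‖F‖ ^ 2 ≤ inner ℝ (A₀.1 F) F) → ‖A₀‖ ≤ Λ →
              ∀ k ∈ Finset.Icc 1 (N + 1), ∀ (j : ℕ) (x : FRD.Torus d (L ^ N))
                (A' : FRD.LSym m d), ‖A'‖ ≤ 1 →
                ‖FRD.nablaPow α (iteratedFDeriv ℝ j (K k) A₀ fun _ => A') x‖ ≤
                  C α c₀ Λ * (2 / c₀) ^ j * (j.factorial : ℝ) *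
                    (L : ℝ) ^ (-(((k : ℝ) - 1) * ((d : ℝ) - 2 + ((∑ i, α i : ℕ) : ℝ)))) *
                    (L : ℝ) ^ η α) := by
  refine ⟨fun α c Λ => 2 ^ d * FRD.symbConst d (c / 2) ((Λ + c / 2) / (c / 2)) (∑ i, α i + d),
    fun α => ((2 * (∑ i, α i + d) * (∑ i, α i + d) * 2 : ℕ) : ℝ), ?_⟩
  intro m N L _ hN hodd hL
  refine ⟨fun k A => FRD.covKer L N (k - 1) A, ?_, ?_, ?_, ?_⟩
  · intro k _
    refine ⟨fun A hA => ?_, fun A _ => FRD.sum_fourierKer _⟩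
    obtain ⟨c, hc, hcA⟩ := FRD.exists_coercive hA
    exact FRD.analyticAt_covKer hc (FRD.coercive_cplx hcA) (by omega) (by omega) _
  · intro A hA
    refine ⟨fun k hk => ?_, ?_⟩
    · rw [Finset.mem_Icc] at hk
      exact FRD.isPosDefOp_covKer hA (by omega) (by omega) rfl (by omega)
    · rw [FRD.greenOp_eq_sum (L := L) (N := N) hA, Finset.range_eq_Ico]
      exact Finset.sum_Ico_add' (fun k => FRD.kernelOp (FRD.covKer L N (k - 1) A)) 0 (N + 1) 1
  · intro A _ k hk
    rw [Finset.mem_Icc] at hk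
    obtain ⟨M, hM⟩ := FRD.exists_covKer_eq (m := m) A hL rfl (j := k - 1) (N := N) (by omega)
    rw [Nat.sub_add_cancel hk.1] at hM
    exact ⟨M, hM⟩
  · intro α c Λ hc A₀ hA₀ hΛ k hk i x A' hA'
    rw [Finset.mem_Icc] at hk
    refine (FRD.norm_nablaPow_iteratedFDeriv_covKer_le hc hA₀ hΛ hA' (by omega) (by omega) rfl
      (by omega) α i x).trans (le_of_eq ?_)
    have hL0 : (0 : ℝ) < L := by exact_mod_cast (by omega : 0 < L)
    obtain ⟨k, rfl⟩ := Nat.exists_eq_add_of_le' hk.1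
    have e1 : (L : ℝ) ^ (-((((k + 1 : ℕ) : ℝ) - 1) * ((d : ℝ) - 2 + ((∑ i, α i : ℕ) : ℝ)))) =
        ((L : ℝ) ^ k) ^ 2 * (((L : ℝ) ^ k) ^ (∑ i, α i + d))⁻¹ := by
      rw [← pow_mul, ← pow_mul, ← Real.rpow_natCast, ← Real.rpow_natCast, ← Real.rpow_neg hL0.le,
        ← Real.rpow_add hL0]
      congr 1
      push_cast
      ring
    rw [e1, Real.rpow_natCast, pow_mul _ _ 2, Nat.add_sub_cancel, div_pow, div_pow]
    field_simp

end
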